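/- Let $q>0$ and $J\in\mathbb N$, $J\ge 1$. On a complete probability space $(\Omega,\mathcal F,\mathbb P)$ let arms $j\in\mathcal J=\{1,\dots,J\}$ be given by sequences $(X^j_s,W^j_s,\mathcal F^j_s)_{s\ge 0}$, where $\mathbb F^j=(\mathcal F^j_s)_{s\ge0}$ is a $\mathbb P$-completed filtration, the $\sigma$-algebras $\bigvee_{s}\mathcal F^j_s$, $j\in\mathcal J$, are independent, the real random variable $X^j_s$ is $\mathcal F^j_s$-measurable, and for each $j$ the $W^j_s$ are i.i.d. and strictly positive, with $W^j_s$ independent of $\mathcal F^j_s$ and $\mathcal F^j_{s+1}$-measurable. Put $T^j_s=W^j_0+\dots+W^j_{s-1}$ and assume $$\mathbb E\Big[\sum_{s\ge0}|X^j_s|\int_{T^j_s}^{T^j_{s+1}}e^{-qr}\,dr\Big]<\infty,\qquad j\in\mathcal J.$$ For $\mathbf s\in\mathbb N_0^J$ let $\mathcal F_{\mathbf s}=\mathcal F^1_{s^1}\vee\dots\vee\mathcal F^J_{s^J}$. An admissible strategy is an $\mathbb N_0^J$-valued process $\pi=(\pi(t))_{t\in\mathbb N_0}$ with $\pi(0)=0$,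 $\sum_j\pi^j(t)=t$, $\pi(t+1)=\pi(t)+\mathbf e_{j}$ for some $j=\mathrm j_t\in\mathcal J$ (the arm operated in period $t$), and $\{\pi(t)=\mathbf s\}\in\mathcal F_{\mathbf s}$ for all $t,\mathbf s$. Period $t$ has duration $\mathcal W_t=W^{\mathrm j_t}_{\pi^{\mathrm j_t}(t)}$ and reward $\mathcal X_t=X^{\mathrm j_t}_{\pi^{\mathrm j_t}(t)}$; put $\mathcal T_t=\mathcal W_0+\dots+\mathcal W_{t-1}$ and $$V(\pi)=\mathbb E\Big[\sum_{t\ge0}\mathcal X_t\int_{\mathcal T_t}^{\mathcal T_{t+1}}e^{-qr}\,dr\,\Big|\,\mathcal F_{\mathbf 0}\Big].$$ The Gittins index of arm $j$ after $s$ operations is $$\Gamma^j_s=\operatorname*{ess\,sup}_{\tau>s}\frac{\mathbb E\big[\sum_{u=s}^{\tau-1}e^{-q(W^j_s+\dots+W^j_{u-1})}X^j_u\,\big|\,\mathcal F^j_s\big]}{\mathbb E\big[\sum_{u=s}^{\tau-1}e^{-q(W^j_s+\dots+W^j_{u-1})}\,\big|\,\mathcal F^j_s\big]},$$ the essential supremum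 being over all (possibly infinite) $\mathbb F^j$-stopping times $\tau>s$; here $\mathbb E[Z\,|\,\mathcal G]$ denotes $\mathbb E[Z^+|\mathcal G]-\mathbb E[Z^-|\mathcal G]$. Then: 1. for every admissible $\pi$ the series in $V(\pi)$ converges almost surely to an integrable random variable; 2. the indices $\Gamma^j_s$ exist as real-valued random variables, and $$\Gamma^j_s=\operatorname*{ess\,sup}_{\tau>s}\frac{\mathbb E\big[\sum_{u=s}^{\tau-1}e^{-qT^j_u}X^j_u\,\big|\,\mathcal F^j_s\big]}{\mathbb E\big[\sum_{u=s}^{\tau-1}e^{-qT^j_u}\,\big|\,\mathcal F^j_s\big]}\quad\text{almost surely};$$ 3. the Gittins index strategy is optimal: there is an admissible strategy $\pi$ that at the onset of each period $t\in\mathbb N_0$ operates an arm in $\arg\max_{j\in\mathcal J}\Gamma^j_{\pi^j(t)}$, and every admissible strategy $\pi^*$ that almost surely does so in each period satisfies $V(\pi)\le V(\pi^*)$ almost surely for every admissible strategy $\pi$. -/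

import Mathlib

open MeasureTheory ProbabilityTheory Filter
open scoped ENNReal

noncomputable section

/-- The conditional expectation `E[Z | 𝓖] = E[Z⁺ | 𝓖] - E[Z⁻ | 𝓖]` of a real random variable `Z`,
built from the conditional expectations of the nonnegative variables `Z⁺` and `Z⁻`. It agrees almost
surely with `P[Z | 𝓖]` when `Z` is integrable, and it is also meaningful when only
`E[|Z| | 𝓖] < ∞` almost surely. -/
def genCondExp {Ω : Type*} {mΩ : MeasurableSpace Ω} (P : Measure Ω) (𝓖 : MeasurableSpace Ω)
    (Z : Ω → ℝ) : Ω → ℝ := fun ω =>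
  (condLExp 𝓖 P (fun ω' => ENNReal.ofReal (Z ω')) ω).toReal -
    (condLExp 𝓖 P (fun ω' => ENNReal.ofReal (-Z ω')) ω).toReal

/-- `g` is (a version of) the essential supremum of the family `S` of real random variables: the
least measurable function, up to almost sure order, that dominates every member of `S`. -/
def IsEssSup {Ω : Type*} {mΩ : MeasurableSpace Ω} (P : Measure Ω) (S : Set (Ω → ℝ))
    (g : Ω → ℝ) : Prop :=
  AEMeasurable g P ∧ (∀ f ∈ S, f ≤ᵐ[P] g) ∧
    ∀ h : Ω → ℝ, AEMeasurable h P → (∀ f ∈ S, f ≤ᵐ[P] h) → g ≤ᵐ[P] h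

/-- A bandit with `J` independent arms. `X j s` is the reward (rate) of arm `j` when it is selected
after `s` previous operations, `W j s` the duration for which it then stays active, and `F j` the
filtration of arm `j`. -/
structure RenewalBandit {Ω : Type*} {mΩ : MeasurableSpace Ω} (P : Measure Ω) (J : ℕ) where
  X : Fin J → ℕ → Ω → ℝ
  W : Fin J → ℕ → Ω → ℝ
  F : Fin J → Filtration ℕ mΩ
  /-- The filtrations, hence also the probability space, are complete: they contain all subsets of
  null sets (for a set that is not known to be measurable, `P A` is its outer measure). -/
  complete : ∀ j s (A : Set Ω), P A = 0 → MeasurableSet[F j s] A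
  measurable_X : ∀ j s, Measurable[F j s] (X j s)
  measurable_W : ∀ j s, Measurable[F j (s + 1)] (W j s)
  /-- `W j s` is independent of `F j s`. -/
  indep_W : ∀ j s, Indep (MeasurableSpace.comap (W j s) inferInstance) (F j s) P
  iIndep_W : ∀ j, iIndepFun (W j) P
  ident_W : ∀ j s, IdentDistrib (W j s) (W j 0) P P
  pos_W : ∀ j s, ∀ᵐ ω ∂P, 0 < W j s ω
  /-- The arms are independent. -/
  indep_arms : iIndep (fun j => ⨆ s, (F j s : MeasurableSpace Ω)) P

namespace RenewalBandit

variable {Ω : Type*} {mΩ : MeasurableSpace Ω} {P : Measure Ω} {J : ℕ}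

/-- The total operating time `T j s = W j 0 + ⋯ + W j (s - 1)` of the first `s` operations of
arm `j`. -/
def T (B : RenewalBandit P J) (j : Fin J) (s : ℕ) (ω : Ω) : ℝ :=
  ∑ u ∈ Finset.range s, B.W j u ω

/-- The standing integrability assumption
`E [∑ₛ |X j s| ∫_{T j s}^{T j (s+1)} e^{-qr} dr] < ∞` for every arm `j`. -/
def RewardsIntegrable (B : RenewalBandit P J) (q : ℝ) : Prop :=
  ∀ j, ∫⁻ ω, ∑' s : ℕ, ENNReal.ofReal
    (|B.X j s ω| * ∫ r in (B.T j s ω)..(B.T j (s + 1) ω), Real.exp (-q * r)) ∂P < ∞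

/-- The information `F_s = F¹_{s¹} ∨ ⋯ ∨ Fᴶ_{sᴶ}` after `s j` operations of each arm `j`. -/
abbrev info (B : RenewalBandit P J) (s : Fin J → ℕ) : MeasurableSpace Ω :=
  ⨆ j, (B.F j (s j) : MeasurableSpace Ω)

/-- An admissible strategy: `count t ω j` is the number of times that arm `j` has been selected
during periods `0, …, t - 1`. -/
structure Strategy (B : RenewalBandit P J) where
  count : ℕ → Ω → Fin J → ℕ
  count_zero : ∀ ω, count 0 ω = 0
  sum_count : ∀ t ω, ∑ j, count t ω j = t
  count_succ : ∀ t ω, ∃ j, count (t + 1) ω = count t ω + Pi.single j 1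
  measurableSet_count : ∀ t (s : Fin J → ℕ), MeasurableSet[B.info s] {ω | count t ω = s}

namespace Strategy

variable {B : RenewalBandit P J}

/-- The arm selected at the onset of period `t`, i.e. the unique `j` with
`count (t + 1) ω = count t ω + e_j`. -/
def arm (π : B.Strategy) (t : ℕ) (ω : Ω) : Fin J := (π.count_succ t ω).choose

/-- The duration of period `t`. -/
def duration (π : B.Strategy) (t : ℕ) (ω : Ω) : ℝ :=
  B.W (π.arm t ω) (π.count t ω (π.arm t ω)) ω

/-- The reward (rate) collected in period `t`. -/
def reward (π : B.Strategy) (t : ℕ) (ω : Ω) : ℝ :=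
  B.X (π.arm t ω) (π.count t ω (π.arm t ω)) ω

/-- The real time at which period `t` begins. -/
def time (π : B.Strategy) (t : ℕ) (ω : Ω) : ℝ :=
  ∑ u ∈ Finset.range t, π.duration u ω

/-- The discounted reward collected in period `t`. -/
def periodReward (π : B.Strategy) (q : ℝ) (t : ℕ) (ω : Ω) : ℝ :=
  π.reward t ω * ∫ r in (π.time t ω)..(π.time (t + 1) ω), Real.exp (-q * r)

/-- The total discounted reward. -/
def totalReward (π : B.Strategy) (q : ℝ) (ω : Ω) : ℝ :=
  ∑' t : ℕ, π.periodReward q t ω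

/-- The expected discounted reward given the initial information; a random variable. -/
def value (π : B.Strategy) (q : ℝ) : Ω → ℝ :=
  condExp (B.info 0) P (π.totalReward q)

/-- `π` is optimal: its value dominates that of every admissible strategy. -/
def IsOptimal (π : B.Strategy) (q : ℝ) : Prop :=
  ∀ π' : B.Strategy, π'.value q ≤ᵐ[P] π.value q

/-- At the onset of every period, `π` operates an arm whose current index is maximal. -/
def FollowsIndex (π : B.Strategy) (Γ : Fin J → ℕ → Ω → ℝ) : Prop :=
  ∀ t, ∀ᵐ ω ∂P, ∀ j, Γ j (π.count t ω j) ω ≤ Γ (π.arm t ω) (π.count t ω (π.arm t ω)) ω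

end Strategy

/-- `∑_{u = s}^{τ - 1} e^{-q (W j s + ⋯ + W j (u - 1))} Y_u`; the sum is over all `u ≥ s` where
`τ = ∞`. -/
def discountedSum (B : RenewalBandit P J) (q : ℝ) (j : Fin J) (s : ℕ) (τ : Ω → WithTop ℕ)
    (Y : ℕ → Ω → ℝ) (ω : Ω) : ℝ :=
  ∑' u : ℕ, Set.indicator {u : ℕ | s ≤ u ∧ (u : WithTop ℕ) < τ ω}
    (fun u => Real.exp (-q * ∑ v ∈ Finset.Ico s u, B.W j v ω) * Y u ω) u

/-- `∑_{u = s}^{τ - 1} e^{-q T j u} Y_u`, discounted to time `0` instead. -/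
def discountedSum₀ (B : RenewalBandit P J) (q : ℝ) (j : Fin J) (s : ℕ) (τ : Ω → WithTop ℕ)
    (Y : ℕ → Ω → ℝ) (ω : Ω) : ℝ :=
  ∑' u : ℕ, Set.indicator {u : ℕ | s ≤ u ∧ (u : WithTop ℕ) < τ ω}
    (fun u => Real.exp (-q * B.T j u ω) * Y u ω) u

/-- The ratio of conditional expected discounted rewards to discounted time for the rule `τ`. -/
def ratio (B : RenewalBandit P J) (q : ℝ) (j : Fin J) (s : ℕ) (τ : Ω → WithTop ℕ) : Ω → ℝ :=
  fun ω => genCondExp P (B.F j s) (B.discountedSum q j s τ (B.X j)) ω /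
    genCondExp P (B.F j s) (B.discountedSum q j s τ (fun _ _ => 1)) ω

/-- The same ratio with all terms discounted to time `0`. -/
def ratio₀ (B : RenewalBandit P J) (q : ℝ) (j : Fin J) (s : ℕ) (τ : Ω → WithTop ℕ) : Ω → ℝ :=
  fun ω => genCondExp P (B.F j s) (B.discountedSum₀ q j s τ (B.X j)) ω /
    genCondExp P (B.F j s) (B.discountedSum₀ q j s τ (fun _ _ => 1)) ω

/-- The stopping times (possibly infinite) of arm `j` that are larger than `s`. -/
def stoppingTimesAfter (B : RenewalBandit P J) (j : Fin J) (s : ℕ) : Set (Ω → WithTop ℕ) :=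
  {τ | IsStoppingTime (B.F j) τ ∧ ∀ ω, (s : WithTop ℕ) < τ ω}

/-- `Γ` is (a version of) the Gittins index process. -/
def IsGittinsIndex (B : RenewalBandit P J) (q : ℝ) (Γ : Fin J → ℕ → Ω → ℝ) : Prop :=
  ∀ j s, IsEssSup P (B.ratio q j s '' B.stoppingTimesAfter j s) (Γ j s)

end RenewalBandit

end

/-! The idea is Weber's. Charge every operation of an arm, per unit of discounted time, the running
minimum of the index of that arm. The conditional expected net income still to come from an arm is
then nonnegative, and it vanishes whenever the index is at its running minimum. In the face of the
other arms, operation `s` of an arm is discounted further by a factor that decreases in `s`. By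
summation by parts, such delays can only lower the expected net income, from zero, and they leave it
at zero if an arm is abandoned only when its index is at its running minimum. So the expected reward
of any strategy is at most its expected charge, with equality for index strategies. Finally, as the
charges of each arm are nonincreasing, an index strategy collects them in decreasing order, so it
maximizes the total discounted charge path by path. -/

section ConditionalExpectation

variable {Ω : Type*} {m mΩ : MeasurableSpace Ω} {P : Measure Ω}

theorem condLExp_mul_of_measurable_left (hm : m ≤ mΩ) [SigmaFinite (P.trim hm)] {c Z : Ω → ℝ≥0∞}
    (hc : Measurable[m] c) (hZ : AEMeasurable Z P) :
    condLExp m P (fun ω => c ω * Z ω) =ᵐ[P] fun ω => c ω * condLExp m P Z ω := by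
  symm
  refine ae_eq_condLExp hm P _ (hc.mul (measurable_condLExp _ _ _)) fun s hs => ?_
  have trim_eq : (P.withDensity (condLExp m P Z)).trim hm = (P.withDensity Z).trim hm := by
    refine @Measure.ext _ m _ _ fun t ht => ?_
    rw [trim_measurableSet_eq hm ht, trim_measurableSet_eq hm ht, withDensity_apply _ (hm t ht),
      withDensity_apply _ (hm t ht), setLIntegral_condLExp hm P Z ht]
  have lintegral_eq_trim {f : Ω → ℝ≥0∞} (hf : AEMeasurable f P) :
      ∫⁻ ω in s, c ω * f ω ∂P = ∫⁻ ω in s, c ω ∂((P.withDensity f).trim hm) := by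
    rw [setLIntegral_trim hm hc hs, restrict_withDensity (hm s hs),
      lintegral_withDensity_eq_lintegral_mul₀ hf.restrict (hc.mono hm le_rfl).aemeasurable]
    exact lintegral_congr fun ω => mul_comm _ _
  rw [lintegral_eq_trim (measurable_condLExp' _ _ _).aemeasurable, trim_eq,
    ← lintegral_eq_trim hZ]

theorem genCondExp_mul_of_measurable_left (hm : m ≤ mΩ) [SigmaFinite (P.trim hm)] {c Z : Ω → ℝ}
    (hc : Measurable[m] c) (hc0 : ∀ ω, 0 ≤ c ω) (hZ : AEMeasurable Z P) :
    genCondExp P m (fun ω => c ω * Z ω) =ᵐ[P] fun ω => c ω * genCondExp P m Z ω := by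
  have pull_out {Y : Ω → ℝ} (hY : AEMeasurable Y P) :
      condLExp m P (fun ω => ENNReal.ofReal (c ω * Y ω)) =ᵐ[P]
        fun ω => ENNReal.ofReal (c ω) * condLExp m P (fun ω' => ENNReal.ofReal (Y ω')) ω := by
    simp only [ENNReal.ofReal_mul (hc0 _)]
    exact condLExp_mul_of_measurable_left hm hc.ennreal_ofReal hY.ennreal_ofReal
  filter_upwards [pull_out hZ, pull_out hZ.neg] with ω hpos hneg
  simp only [Pi.neg_apply] at hneg
  simp only [genCondExp, ← mul_neg, hpos, hneg, ENNReal.toReal_mul, ENNReal.toReal_ofReal (hc0 ω),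
    mul_sub]

theorem genCondExp_ae_eq_condExp {Z : Ω → ℝ} (hZ : Integrable Z P) :
    genCondExp P m Z =ᵐ[P] P[Z | m] := by
  have toReal_eq {Y : Ω → ℝ} (hY : Integrable Y P) :
      (fun ω => (condLExp m P (fun ω' => ENNReal.ofReal (Y ω')) ω).toReal) =ᵐ[P]
        P[fun ω => max (Y ω) 0 | m] :=
    toReal_condLExp m hY.aemeasurable.ennreal_ofReal hY.lintegral_lt_top.ne
  have hsub : P[Z | m] =ᵐ[P] P[fun ω => max (Z ω) 0 | m] - P[fun ω => max (-Z ω) 0 | m] := by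
    refine EventuallyEq.trans ?_ (condExp_sub hZ.pos_part hZ.neg_part m)
    exact condExp_congr_ae (.of_forall fun ω => (max_zero_sub_max_neg_zero_eq_self (Z ω)).symm)
  filter_upwards [toReal_eq hZ, toReal_eq hZ.neg, hsub] with ω hpos hneg hsub
  rw [hsub, Pi.sub_apply, ← hpos]
  exact congrArg _ hneg

theorem condExp_pos_of_pos (hm : m ≤ mΩ) [SigmaFinite (P.trim hm)] {f : Ω → ℝ}
    (hf : Integrable f P) (hpos : ∀ ω, 0 < f ω) : ∀ᵐ ω ∂P, 0 < (P[f | m]) ω := by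
  have hs : MeasurableSet[m] {ω | (P[f | m]) ω ≤ 0} :=
    measurableSet_le stronglyMeasurable_condExp.measurable measurable_const
  have hint : ∫ ω in {ω | (P[f | m]) ω ≤ 0}, f ω ∂P ≤ 0 := by
    rw [← setIntegral_condExp hm hf hs]
    exact setIntegral_nonpos (hm _ hs) fun ω h => h
  have hsupport : Function.support f = Set.univ := Set.eq_univ_of_forall fun ω => (hpos ω).ne'
  have hnull := (setIntegral_pos_iff_support_of_nonneg_ae
    (.of_forall fun ω => (hpos ω).le) hf.integrableOn).not.1 hint.not_gt
  rw [hsupport, Set.univ_inter, not_lt, nonpos_iff_eq_zero] at hnull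
  simpa [ae_iff] using hnull

theorem condExp_le_of_forall_setIntegral_le (hm : m ≤ mΩ) [SigmaFinite (P.trim hm)] {f g : Ω → ℝ}
    (hf : Integrable f P) (hgi : Integrable g P) (hg : StronglyMeasurable[m] g)
    (h : ∀ A, MeasurableSet[m] A → ∫ ω in A, f ω ∂P ≤ ∫ ω in A, g ω ∂P) : P[f | m] ≤ᵐ[P] g := by
  refine ae_le_of_ae_le_trim (hm := hm) (ae_le_of_forall_setIntegral_le
    (integrable_condExp.trim hm stronglyMeasurable_condExp) (hgi.trim hm hg) fun s hs _ => ?_)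
  rw [← setIntegral_trim hm stronglyMeasurable_condExp hs, ← setIntegral_trim hm hg hs,
    setIntegral_condExp hm hf hs]
  exact h s hs

end ConditionalExpectation

section EssSup

variable {Ω : Type*} {m mΩ : MeasurableSpace Ω} {P : Measure Ω}

theorem IsEssSup.congr_image {ι : Type*} {T : Set ι} {f f' : ι → Ω → ℝ} {g : Ω → ℝ}
    (h : IsEssSup P (f '' T) g) (hf : ∀ i ∈ T, f i =ᵐ[P] f' i) : IsEssSup P (f' '' T) g := by
  refine ⟨h.1, Set.forall_mem_image.2 fun i hi => ?_,
    fun k hk hb => h.2.2 k hk (Set.forall_mem_image.2 fun i hi => ?_)⟩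
  · exact (hf i hi).symm.le.trans (h.2.1 _ (Set.mem_image_of_mem _ hi))
  · exact (hf i hi).le.trans (hb _ (Set.mem_image_of_mem _ hi))

/- The supremum is taken among measures, where it exists by completeness of the lattice, and is
brought back to functions by the Radon–Nikodym theorem. -/
theorem exists_essSup_ennreal [SigmaFinite P] {S : Set (Ω → ℝ≥0∞)} (hS : ∀ f ∈ S, AEMeasurable f P)
    {b : Ω → ℝ≥0∞} (hb : ∫⁻ ω, b ω ∂P ≠ ∞) (hSb : ∀ f ∈ S, f ≤ᵐ[P] b) :
    ∃ G, Measurable G ∧ (∀ᵐ ω ∂P, G ω < ∞) ∧ (∀ f ∈ S, f ≤ᵐ[P] G) ∧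
      ∀ h : Ω → ℝ≥0∞, (∀ f ∈ S, f ≤ᵐ[P] h) → G ≤ᵐ[P] h := by
  set μ : Measure Ω := sSup (P.withDensity '' S)
  have hμ_le {h : Ω → ℝ≥0∞} (hh : ∀ f ∈ S, f ≤ᵐ[P] h) : μ ≤ P.withDensity h :=
    sSup_le (Set.forall_mem_image.2 fun f hf => withDensity_mono (hh f hf))
  have : IsFiniteMeasure (P.withDensity b) := isFiniteMeasure_withDensity hb
  have : IsFiniteMeasure μ := isFiniteMeasure_of_le _ (hμ_le hSb)
  have hμ : P.withDensity (μ.rnDeriv P) = μ := Measure.withDensity_rnDeriv_eq _ _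
    ((Measure.absolutelyContinuous_of_le (hμ_le hSb)).trans (withDensity_absolutelyContinuous _ _))
  have hG := Measure.measurable_rnDeriv μ P
  refine ⟨μ.rnDeriv P, hG, Measure.rnDeriv_lt_top _ _, fun f hf => ?_, fun h hh => ?_⟩
  · refine ae_le_of_forall_setLIntegral_le_of_sigmaFinite₀ (hS f hf) fun s hs _ => ?_
    rw [← withDensity_apply _ hs, ← withDensity_apply _ hs, hμ]
    exact le_sSup (Set.mem_image_of_mem P.withDensity hf) s
  · refine ae_le_of_forall_setLIntegral_le_of_sigmaFinite hG fun s hs _ => ?_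
    rw [← withDensity_apply _ hs, ← withDensity_apply _ hs, hμ]
    exact hμ_le hh s

theorem exists_isEssSup [IsFiniteMeasure P] {S : Set (Ω → ℝ)} (hne : S.Nonempty) {b : Ω → ℝ}
    (hb : AEMeasurable b P) (hS : ∀ f ∈ S, AEMeasurable f P) (hSb : ∀ f ∈ S, f ≤ᵐ[P] b) :
    ∃ g, IsEssSup P S g := by
  set e : (Ω → ℝ) → Ω → ℝ≥0∞ := fun f ω => ENNReal.ofReal (Real.exp (f ω - b ω)) with he
  have he_mono {f h : Ω → ℝ} (hfh : f ≤ᵐ[P] h) : e f ≤ᵐ[P] e h := by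
    filter_upwards [hfh] with ω hω
    exact ENNReal.ofReal_le_ofReal (Real.exp_le_exp.2 (sub_le_sub_right hω _))
  have he_b : e b = 1 := by ext ω; simp [he]
  obtain ⟨G, hGm, hGfin, hle_G, hG_le⟩ := exists_essSup_ennreal (S := e '' S) (b := 1)
    (Set.forall_mem_image.2 fun f hf =>
      (Real.measurable_exp.comp_aemeasurable ((hS f hf).sub hb)).ennreal_ofReal)
    (by simp) (Set.forall_mem_image.2 fun f hf => he_b ▸ he_mono (hSb f hf))
  have hGpos : ∀ᵐ ω ∂P, 0 < (G ω).toReal := by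
    obtain ⟨f₀, hf₀⟩ := hne
    filter_upwards [hle_G _ (Set.mem_image_of_mem e hf₀), hGfin] with ω hle hfin
    exact ENNReal.toReal_pos ((ENNReal.ofReal_pos.2 (Real.exp_pos _)).trans_le hle).ne' hfin.ne
  refine ⟨fun ω => b ω + Real.log (G ω).toReal,
    hb.add (Real.measurable_log.comp hGm.ennreal_toReal).aemeasurable, fun f hf => ?_,
    fun h _ hub => ?_⟩
  · filter_upwards [hle_G _ (Set.mem_image_of_mem e hf), hGfin, hGpos] with ω hle hfin hpos
    have := (Real.le_log_iff_exp_le hpos).2 ((ENNReal.ofReal_le_iff_le_toReal hfin.ne).1 hle)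
    linarith
  · filter_upwards [hG_le (e h) (Set.forall_mem_image.2 fun f hf => he_mono (hub f hf)), hGpos]
      with ω hle hpos
    have := (Real.log_le_iff_le_exp hpos).2 (ENNReal.toReal_le_of_le_ofReal (Real.exp_pos _).le hle)
    linarith

/- With `E = exp (g - b)`, the variable `b + log P[E | m]` is an `m`-measurable upper bound of `S`,
so `E ≤ P[E | m]`; as both sides have the same integral, they agree. -/
theorem IsEssSup.exists_measurable_ae_eq [IsFiniteMeasure P] (hm : m ≤ mΩ) {S : Set (Ω → ℝ)}
    {g : Ω → ℝ} (hg : IsEssSup P S g) {b : Ω → ℝ} (hb : Measurable[m] b)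
    (hS : ∀ f ∈ S, Measurable[m] f) (hSb : ∀ f ∈ S, f ≤ᵐ[P] b) :
    ∃ g', Measurable[m] g' ∧ g =ᵐ[P] g' := by
  have hb' : Measurable b := hb.mono hm le_rfl
  have hint {f : Ω → ℝ} (hf : AEMeasurable f P) (hfb : f ≤ᵐ[P] b) :
      Integrable (fun ω => Real.exp (f ω - b ω)) P := by
    refine .of_bound (Real.measurable_exp.comp_aemeasurable
      (hf.sub hb'.aemeasurable)).aestronglyMeasurable 1 ?_
    filter_upwards [hfb] with ω h
    rw [Real.norm_eq_abs, Real.abs_exp]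
    exact Real.exp_le_one_iff.2 (sub_nonpos.2 h)
  set E : Ω → ℝ := fun ω => Real.exp (g ω - b ω) with hE
  have hEi : Integrable E P := hint hg.1 (hg.2.2 b hb'.aemeasurable hSb)
  have hpos := condExp_pos_of_pos hm hEi fun ω => Real.exp_pos _
  have hbound : Measurable[m] fun ω => b ω + Real.log ((P[E | m]) ω) :=
    hb.add (Real.measurable_log.comp stronglyMeasurable_condExp.measurable)
  have hg_le : g ≤ᵐ[P] fun ω => b ω + Real.log ((P[E | m]) ω) := by
    refine hg.2.2 _ (hbound.mono hm le_rfl).aemeasurable fun f hf => ?_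
    have hfi := hint ((hS f hf).mono hm le_rfl).aemeasurable (hSb f hf)
    have hle : P[fun ω => Real.exp (f ω - b ω) | m] ≤ᵐ[P] P[E | m] := by
      refine condExp_mono hfi hEi ?_
      filter_upwards [hg.2.1 f hf] with ω h
      exact Real.exp_le_exp.2 (sub_le_sub_right h _)
    have hfm : StronglyMeasurable[m] fun ω => Real.exp (f ω - b ω) :=
      (Real.measurable_exp.comp ((hS f hf).sub hb)).stronglyMeasurable
    rw [condExp_of_stronglyMeasurable hm hfm hfi] at hle
    filter_upwards [hle, hpos] with ω hle hpos
    have := (Real.le_log_iff_exp_le hpos).2 hle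
    linarith
  have hE_le : E ≤ᵐ[P] P[E | m] := by
    filter_upwards [hg_le, hpos] with ω hle hpos
    rw [← Real.le_log_iff_exp_le hpos]
    linarith
  have hE_eq : E =ᵐ[P] P[E | m] :=
    (integral_eq_iff_of_ae_le hEi integrable_condExp hE_le).1 (integral_condExp hm).symm
  refine ⟨_, hbound, ?_⟩
  filter_upwards [hE_eq] with ω h
  rw [← h, hE, Real.log_exp, add_sub_cancel]

end EssSup

section Independence

variable {Ω : Type*}

theorem isPiSystem_image2_inter (m₁ m₂ : MeasurableSpace Ω) :
    IsPiSystem (Set.image2 (· ∩ ·) {a | MeasurableSet[m₁] a} {b | MeasurableSet[m₂] b}) := by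
  rintro _ ⟨a, ha, b, hb, rfl⟩ _ ⟨a', ha', b', hb', rfl⟩ _
  exact ⟨a ∩ a', @MeasurableSet.inter _ m₁ _ _ ha ha', b ∩ b', @MeasurableSet.inter _ m₂ _ _ hb hb',
    Set.inter_inter_inter_comm _ _ _ _⟩

theorem sup_eq_generateFrom_image2_inter (m₁ m₂ : MeasurableSpace Ω) :
    m₁ ⊔ m₂ = .generateFrom
      (Set.image2 (· ∩ ·) {a | MeasurableSet[m₁] a} {b | MeasurableSet[m₂] b}) := by
  apply le_antisymm
  · refine sup_le (fun a ha => ?_) fun b hb => ?_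
    · exact MeasurableSpace.measurableSet_generateFrom
        ⟨a, ha, Set.univ, @MeasurableSet.univ _ m₂, Set.inter_univ a⟩
    · exact MeasurableSpace.measurableSet_generateFrom
        ⟨Set.univ, @MeasurableSet.univ _ m₁, b, hb, Set.univ_inter b⟩
  · refine MeasurableSpace.generateFrom_le ?_
    rintro _ ⟨a, ha, b, hb, rfl⟩
    exact @MeasurableSet.inter _ (m₁ ⊔ m₂) _ _ (le_sup_left (a := m₁) (b := m₂) _ ha)
      (le_sup_right (a := m₁) (b := m₂) _ hb)

variable {m n₁ n₂ m₁ m₂ mΩ : MeasurableSpace Ω} {P : Measure Ω}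

theorem setIntegral_eq_of_forall_inter (h₁ : m₁ ≤ mΩ) (h₂ : m₂ ≤ mΩ) {f g : Ω → ℝ}
    (hf : Integrable f P) (hg : Integrable g P)
    (h : ∀ a b, MeasurableSet[m₁] a → MeasurableSet[m₂] b →
      ∫ ω in a ∩ b, f ω ∂P = ∫ ω in a ∩ b, g ω ∂P) {s : Set Ω} (hs : MeasurableSet[m₁ ⊔ m₂] s) :
    ∫ ω in s, f ω ∂P = ∫ ω in s, g ω ∂P := by
  have hle : m₁ ⊔ m₂ ≤ mΩ := sup_le h₁ h₂
  have huniv : ∫ ω, f ω ∂P = ∫ ω, g ω ∂P := by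
    simpa using h Set.univ Set.univ (@MeasurableSet.univ _ m₁) (@MeasurableSet.univ _ m₂)
  induction s, hs using MeasurableSpace.induction_on_inter (sup_eq_generateFrom_image2_inter m₁ m₂)
    (isPiSystem_image2_inter m₁ m₂) with
  | empty => simp
  | basic t ht =>
    obtain ⟨a, ha, b, hb, rfl⟩ := ht
    exact h a b ha hb
  | compl t ht hC =>
    rw [setIntegral_compl (hle _ ht) hf, setIntegral_compl (hle _ ht) hg, hC, huniv]
  | iUnion t hd ht hC =>
    rw [integral_iUnion (fun i => hle _ (ht i)) hd hf.integrableOn,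
      integral_iUnion (fun i => hle _ (ht i)) hd hg.integrableOn]
    exact tsum_congr hC

theorem integral_mul_condExp (hm : m ≤ mΩ) [SigmaFinite (P.trim hm)] {R f : Ω → ℝ}
    (hR : StronglyMeasurable[m] R) (hRf : Integrable (fun ω => R ω * f ω) P)
    (hf : Integrable f P) : ∫ ω, R ω * (P[f | m]) ω ∂P = ∫ ω, R ω * f ω ∂P := by
  rw [← integral_condExp hm (f := fun ω => R ω * f ω)]
  exact integral_congr_ae (condExp_mul_of_stronglyMeasurable_left hR hRf hf).symm

theorem norm_indicator_one_le (b : Set Ω) (ω : Ω) : ‖b.indicator (1 : Ω → ℝ) ω‖ ≤ 1 := by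
  simpa using norm_indicator_le_norm_self (s := b) (1 : Ω → ℝ) ω

theorem ae_norm_condExp_indicator_one_le (b : Set Ω) :
    ∀ᵐ ω ∂P, ‖(P[b.indicator (1 : Ω → ℝ) | m]) ω‖ ≤ 1 :=
  ae_bdd_abs_condExp_of_ae_bdd_abs (.of_forall (norm_indicator_one_le b))

variable [IsProbabilityMeasure P]

theorem setIntegral_inter_of_indep (h₁ : m₁ ≤ mΩ) (h₂ : m₂ ≤ mΩ) (hi : Indep m₁ m₂ P) {f : Ω → ℝ}
    (hf : StronglyMeasurable[m₁] f) (hfi : Integrable f P) {a b : Set Ω} (ha : MeasurableSet[m₁] a)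
    (hb : MeasurableSet[m₂] b) :
    ∫ ω in a ∩ b, f ω ∂P = P.real b * ∫ ω in a, f ω ∂P := by
  have hconst := condExp_indep_eq h₁ h₂ (hf.indicator ha) hi
  rw [Set.inter_comm, ← setIntegral_indicator (h₁ _ ha),
    ← setIntegral_condExp h₂ (hfi.indicator (h₁ _ ha)) hb,
    setIntegral_congr_ae (h₂ _ hb) (hconst.mono fun ω hω _ => hω), setIntegral_const,
    integral_indicator (h₁ _ ha), smul_eq_mul]

theorem condExp_sup_of_indep (hm : m ≤ m₁) (h₁ : m₁ ≤ mΩ) (h₂ : m₂ ≤ mΩ)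
    (hi : Indep m₁ m₂ P) {f : Ω → ℝ} (hf : StronglyMeasurable[m₁] f) (hfi : Integrable f P) :
    P[f | m ⊔ m₂] =ᵐ[P] P[f | m] := by
  have hcm : StronglyMeasurable[m ⊔ m₂] (P[f | m]) :=
    (stronglyMeasurable_condExp (m := m)).mono le_sup_left
  refine (ae_eq_condExp_of_forall_setIntegral_eq (sup_le (hm.trans h₁) h₂) hfi
    (fun s _ _ => integrable_condExp.integrableOn) (fun s hs _ => ?_)
    hcm.aestronglyMeasurable).symm
  refine setIntegral_eq_of_forall_inter (hm.trans h₁) h₂ integrable_condExp hfi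
    (fun a b ha hb => ?_) hs
  rw [setIntegral_inter_of_indep h₁ h₂ hi (stronglyMeasurable_condExp.mono hm) integrable_condExp
    (hm _ ha) hb, setIntegral_inter_of_indep h₁ h₂ hi hf hfi (hm _ ha) hb,
    setIntegral_condExp (hm.trans h₁) hfi ha]

theorem integral_mul_condExp_of_indep (hm : m ≤ m₁) (h₁ : m₁ ≤ mΩ)
    (h₂ : m₂ ≤ mΩ) (hi : Indep m₁ m₂ P) {f R : Ω → ℝ} (hf : StronglyMeasurable[m₁] f)
    (hfi : Integrable f P) (hR : StronglyMeasurable[m ⊔ m₂] R)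
    (hRf : Integrable (fun ω => R ω * f ω) P) :
    ∫ ω, R ω * (P[f | m]) ω ∂P = ∫ ω, R ω * f ω ∂P := by
  rw [← integral_mul_condExp (sup_le (hm.trans h₁) h₂) hR hRf hfi]
  refine integral_congr_ae ?_
  filter_upwards [condExp_sup_of_indep hm h₁ h₂ hi hf hfi] with ω h
  rw [h]

theorem setIntegral_inter_eq_setIntegral_mul_condExp (hn₂ : n₂ ≤ m₂) (h₁ : m₁ ≤ mΩ)
    (h₂ : m₂ ≤ mΩ) (hi : Indep m₁ m₂ P) {a b : Set Ω} (ha : MeasurableSet[m₁] a)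
    (hb : MeasurableSet[m₂] b) {g : Ω → ℝ} (hg : StronglyMeasurable[m₁ ⊔ n₂] g)
    (hgi : Integrable g P) :
    ∫ ω in a ∩ b, g ω ∂P = ∫ ω in a, g ω * (P[b.indicator (1 : Ω → ℝ) | n₂]) ω ∂P := by
  have ha' : MeasurableSet a := h₁ _ ha
  have hb' : MeasurableSet b := h₂ _ hb
  have hbi : Integrable (b.indicator (1 : Ω → ℝ)) P := (integrable_const 1).indicator hb'
  have hag : StronglyMeasurable[n₂ ⊔ m₁] (a.indicator g) :=
    (sup_comm m₁ n₂ ▸ hg).indicator (le_sup_right (a := n₂) _ ha)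
  have hagb : Integrable (fun ω => a.indicator g ω * b.indicator (1 : Ω → ℝ) ω) P :=
    (hgi.indicator ha').mul_bdd hbi.1 (.of_forall (norm_indicator_one_le b))
  rw [← setIntegral_indicator hb', ← integral_indicator ha', ← integral_indicator ha']
  convert (integral_mul_condExp_of_indep hn₂ h₂ h₁ hi.symm (stronglyMeasurable_one.indicator hb)
    hbi hag hagb).symm using 2
  · ext ω
    by_cases h₁ : ω ∈ a <;> by_cases h₂ : ω ∈ b <;> simp [h₁, h₂]
  · ext ω
    by_cases h : ω ∈ a <;> simp [h]

theorem condExp_sup_eq_of_indep (hn₁ : n₁ ≤ m₁) (hn₂ : n₂ ≤ m₂) (h₁ : m₁ ≤ mΩ) (h₂ : m₂ ≤ mΩ)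
    (hi : Indep m₁ m₂ P) {f : Ω → ℝ} (hf : StronglyMeasurable[m₁ ⊔ n₂] f) (hfi : Integrable f P) :
    P[f | n₁ ⊔ m₂] =ᵐ[P] P[f | n₁ ⊔ n₂] := by
  have hle : n₁ ⊔ n₂ ≤ mΩ := sup_le (hn₁.trans h₁) (hn₂.trans h₂)
  have hcm : StronglyMeasurable[n₁ ⊔ m₂] (P[f | n₁ ⊔ n₂]) :=
    stronglyMeasurable_condExp.mono (sup_le_sup_left hn₂ n₁)
  refine (ae_eq_condExp_of_forall_setIntegral_eq (sup_le (hn₁.trans h₁) h₂) hfi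
    (fun s _ _ => integrable_condExp.integrableOn) (fun s hs _ => ?_)
    hcm.aestronglyMeasurable).symm
  refine setIntegral_eq_of_forall_inter (hn₁.trans h₁) h₂ integrable_condExp hfi
    (fun a b ha hb => ?_) hs
  have ha' : MeasurableSet a := h₁ _ (hn₁ _ ha)
  -- `1_b` is independent of `m₁`, so its projection `p` on `n₂` may replace it on both sides
  set p : Ω → ℝ := P[b.indicator (1 : Ω → ℝ) | n₂]
  have hpm : StronglyMeasurable[n₂] p := stronglyMeasurable_condExp
  have hapm : StronglyMeasurable[n₁ ⊔ n₂] (a.indicator p) :=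
    (hpm.mono (le_sup_right (a := n₁))).indicator (le_sup_left (b := n₂) _ ha)
  have hafp : Integrable (fun ω => a.indicator p ω * f ω) P := by
    refine ((hfi.bdd_mul (hpm.mono (hn₂.trans h₂)).aestronglyMeasurable
      (ae_norm_condExp_indicator_one_le b)).indicator ha').congr (.of_forall fun ω => ?_)
    by_cases h : ω ∈ a <;> simp [h, p]
  have setIntegral_mul_eq (g : Ω → ℝ) : ∫ ω in a, g ω * p ω ∂P = ∫ ω, a.indicator p ω * g ω ∂P := by
    rw [← integral_indicator ha']
    congr 1 with ω
    by_cases h : ω ∈ a <;> simp [h, mul_comm]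
  calc ∫ ω in a ∩ b, (P[f | n₁ ⊔ n₂]) ω ∂P
      = ∫ ω in a, (P[f | n₁ ⊔ n₂]) ω * p ω ∂P :=
        setIntegral_inter_eq_setIntegral_mul_condExp hn₂ h₁ h₂ hi (hn₁ _ ha) hb
          (stronglyMeasurable_condExp.mono (sup_le_sup_right hn₁ n₂)) integrable_condExp
    _ = ∫ ω in a, f ω * p ω ∂P := by
        rw [setIntegral_mul_eq, setIntegral_mul_eq, integral_mul_condExp hle hapm hafp hfi]
    _ = ∫ ω in a ∩ b, f ω ∂P :=
        (setIntegral_inter_eq_setIntegral_mul_condExp hn₂ h₁ h₂ hi (hn₁ _ ha) hb hf hfi).symm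

theorem exists_measurableSet_ae_eq_of_indep (hn₁ : n₁ ≤ m₁) (hn₂ : n₂ ≤ m₂) (h₁ : m₁ ≤ mΩ)
    (h₂ : m₂ ≤ mΩ) (hi : Indep m₁ m₂ P) {A : Set Ω} (hA₁ : MeasurableSet[m₁ ⊔ n₂] A)
    (hA₂ : MeasurableSet[n₁ ⊔ m₂] A) : ∃ A', MeasurableSet[n₁ ⊔ n₂] A' ∧ A =ᵐ[P] A' := by
  set I : Ω → ℝ := A.indicator 1 with hI
  have hIi : Integrable I P := (integrable_const 1).indicator (sup_le h₁ (hn₂.trans h₂) _ hA₁)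
  have hI_eq : I =ᵐ[P] P[I | n₁ ⊔ n₂] := by
    have := condExp_sup_eq_of_indep hn₁ hn₂ h₁ h₂ hi (stronglyMeasurable_one.indicator hA₁) hIi
    rwa [condExp_of_stronglyMeasurable (sup_le (hn₁.trans h₁) h₂)
      (stronglyMeasurable_one.indicator hA₂) hIi] at this
  refine ⟨{ω | (P[I | n₁ ⊔ n₂]) ω = 1},
    measurableSet_eq_fun stronglyMeasurable_condExp.measurable measurable_const, ?_⟩
  filter_upwards [hI_eq] with ω h
  refine propext (?_ : ω ∈ A ↔ (P[I | n₁ ⊔ n₂]) ω = 1)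
  rw [← h, hI]
  by_cases hω : ω ∈ A <;> simp [hω]

end Independence

section AbsSummable

variable {Ω ι : Type*} {mΩ : MeasurableSpace Ω} {P : Measure Ω}

/-- The family `f` of random variables is absolutely summable in `L¹(P)`: the sum of the `L¹` norms
is finite. -/
def AbsSummable (P : Measure Ω) (f : ι → Ω → ℝ) : Prop :=
  (∀ i, AEStronglyMeasurable (f i) P) ∧ ∑' i, ∫⁻ ω, ‖f i ω‖ₑ ∂P ≠ ∞

namespace AbsSummable

variable {f g : ι → Ω → ℝ}

theorem integrable (hf : AbsSummable P f) (i : ι) : Integrable (f i) P :=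
  ⟨hf.1 i, (ENNReal.ne_top_of_tsum_ne_top hf.2 i).lt_top⟩

theorem mono (hf : AbsSummable P f) (hg : ∀ i, AEStronglyMeasurable (g i) P)
    (hgf : ∀ i, ∀ᵐ ω ∂P, |g i ω| ≤ |f i ω|) : AbsSummable P g := by
  refine ⟨hg, ne_top_of_le_ne_top hf.2 (ENNReal.tsum_le_tsum fun i => lintegral_mono_ae ?_)⟩
  filter_upwards [hgf i] with ω h
  rwa [← ofReal_norm, ← ofReal_norm, ENNReal.ofReal_le_ofReal_iff (norm_nonneg _)]

theorem abs (hf : AbsSummable P f) : AbsSummable P fun i ω => |f i ω| :=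
  hf.mono (fun i => (hf.1 i).norm) fun i => .of_forall fun ω => by rw [abs_abs]

theorem add (hf : AbsSummable P f) (hg : AbsSummable P g) :
    AbsSummable P fun i ω => f i ω + g i ω := by
  refine ⟨fun i => (hf.1 i).add (hg.1 i),
    ne_top_of_le_ne_top (ENNReal.add_ne_top.2 ⟨hf.2, hg.2⟩) ?_⟩
  rw [← ENNReal.tsum_add]
  refine ENNReal.tsum_le_tsum fun i => ?_
  rw [← lintegral_add_left' (hf.1 i).enorm]
  exact lintegral_mono fun ω => enorm_add_le _ _

theorem neg (hf : AbsSummable P f) : AbsSummable P fun i ω => -f i ω :=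
  hf.mono (fun i => (hf.1 i).neg) fun i => .of_forall fun ω => by rw [abs_neg]

theorem sub (hf : AbsSummable P f) (hg : AbsSummable P g) :
    AbsSummable P fun i ω => f i ω - g i ω := by
  simpa only [sub_eq_add_neg] using hf.add hg.neg

theorem comp_injective {κ : Type*} (hf : AbsSummable P f) {e : κ → ι}
    (he : Function.Injective e) : AbsSummable P fun k => f (e k) :=
  ⟨fun _ => hf.1 _, ne_top_of_le_ne_top hf.2 (ENNReal.tsum_comp_le_tsum_of_injective he _)⟩

theorem indicator (hf : AbsSummable P f) {S : ι → Set Ω} (hS : ∀ i, MeasurableSet (S i)) :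
    AbsSummable P fun i => (S i).indicator (f i) := by
  refine hf.mono (fun i => (hf.1 i).indicator (hS i)) fun i => .of_forall fun ω => ?_
  by_cases h : ω ∈ S i <;> simp [h]

theorem prod {κ : Type*} [Finite κ] {f : κ → ι → Ω → ℝ} (hf : ∀ k, AbsSummable P (f k)) :
    AbsSummable P fun x : κ × ι => f x.1 x.2 := by
  have := Fintype.ofFinite κ
  refine ⟨fun x => (hf x.1).1 x.2, ?_⟩
  rw [ENNReal.tsum_prod (f := fun k i => ∫⁻ ω, ‖f k i ω‖ₑ ∂P), tsum_fintype]
  exact ENNReal.sum_ne_top.2 fun k _ => (hf k).2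

theorem of_summable_integral {b : ι → Ω → ℝ} (hf : ∀ i, AEStronglyMeasurable (f i) P)
    (hb : ∀ i, Integrable (b i) P) (hfb : ∀ i, ∀ᵐ ω ∂P, |f i ω| ≤ b i ω)
    (hs : Summable fun i => ∫ ω, b i ω ∂P) : AbsSummable P f := by
  have hb0 (i : ι) : 0 ≤ᵐ[P] b i := (hfb i).mono fun ω h => (abs_nonneg _).trans h
  refine ⟨hf, ne_top_of_le_ne_top hs.tsum_ofReal_ne_top (ENNReal.tsum_le_tsum fun i => ?_)⟩
  rw [ofReal_integral_eq_lintegral_ofReal (hb i) (hb0 i)]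
  refine lintegral_mono_ae ?_
  filter_upwards [hfb i] with ω h
  rw [← ofReal_norm]
  exact ENNReal.ofReal_le_ofReal h

theorem summable_setIntegral (hf : AbsSummable P f) (A : Set Ω) :
    Summable fun i => ∫ ω in A, f i ω ∂P := by
  refine .of_norm (.of_nonneg_of_le (fun _ => norm_nonneg _) (fun i => ?_)
    (ENNReal.summable_toReal hf.2))
  rw [← integral_norm_eq_lintegral_enorm (hf.1 i)]
  exact (norm_integral_le_integral_norm _).trans
    (setIntegral_le_integral (hf.integrable i).norm (.of_forall fun ω => norm_nonneg _))

theorem summable_integral_abs (hf : AbsSummable P f) : Summable fun i => ∫ ω, |f i ω| ∂P := by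
  simpa using hf.abs.summable_setIntegral Set.univ

variable [Countable ι]

theorem ae_summable_abs (hf : AbsSummable P f) : ∀ᵐ ω ∂P, Summable fun i => |f i ω| := by
  have hlt := hf.2
  rw [← lintegral_tsum fun i => (hf.1 i).enorm] at hlt
  filter_upwards [ae_lt_top' (AEMeasurable.tsum fun i => (hf.1 i).enorm) hlt] with ω hω
  exact tsum_enorm_ne_top_iff_summable_norm.1 hω.ne

theorem ae_summable (hf : AbsSummable P f) : ∀ᵐ ω ∂P, Summable fun i => f i ω :=
  hf.ae_summable_abs.mono fun _ h => h.of_abs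

theorem hasSum_setIntegral (hf : AbsSummable P f) (A : Set Ω) :
    HasSum (fun i => ∫ ω in A, f i ω ∂P) (∫ ω in A, ∑' i, f i ω ∂P) := by
  rw [integral_tsum (fun i => (hf.1 i).restrict) (ne_top_of_le_ne_top hf.2
    (ENNReal.tsum_le_tsum fun i => setLIntegral_le_lintegral _ _))]
  exact (hf.summable_setIntegral A).hasSum

theorem hasSum_integral (hf : AbsSummable P f) :
    HasSum (fun i => ∫ ω, f i ω ∂P) (∫ ω, ∑' i, f i ω ∂P) := by
  simpa using hf.hasSum_setIntegral Set.univ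

theorem aestronglyMeasurable_tsum (hf : AbsSummable P f) :
    AEStronglyMeasurable (fun ω => ∑' i, f i ω) P := by
  obtain ⟨s, hs⟩ := (atTop : Filter (Finset ι)).exists_seq_tendsto
  refine aestronglyMeasurable_of_tendsto_ae atTop (f := fun n ω => ∑ i ∈ s n, f i ω)
    (fun n => Finset.aestronglyMeasurable_fun_sum _ fun i _ => hf.1 i) ?_
  filter_upwards [hf.ae_summable] with ω hω
  exact hω.hasSum.comp hs

theorem integrable_tsum (hf : AbsSummable P f) : Integrable (fun ω => ∑' i, f i ω) P := by
  refine ⟨hf.aestronglyMeasurable_tsum, lt_of_le_of_lt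
    (lintegral_mono fun ω => enorm_tsum_le_tsum_enorm) ?_⟩
  rw [lintegral_tsum fun i => (hf.1 i).enorm]
  exact hf.2.lt_top

end AbsSummable

end AbsSummable

section BlockSum

variable {Ω : Type*}

/-- The sum of `Z u` over `s ≤ u < τ`. The constraint on `u` is an indicator, so that `τ = ∞` is
allowed. -/
noncomputable def blockSum (s : ℕ) (τ : Ω → WithTop ℕ) (Z : ℕ → Ω → ℝ) (ω : Ω) : ℝ :=
  ∑' u : ℕ, Set.indicator {u : ℕ | s ≤ u ∧ (u : WithTop ℕ) < τ ω} (fun u => Z u ω) u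

theorem blockSum_coe (s : ℕ) (t : Ω → ℕ) (Z : ℕ → Ω → ℝ) (ω : Ω) :
    blockSum s (fun ω => (t ω : WithTop ℕ)) Z ω = ∑ u ∈ Finset.Ico s (t ω), Z u ω := by
  rw [blockSum, tsum_eq_sum (s := Finset.Ico s (t ω))]
  · refine Finset.sum_congr rfl fun u hu => ?_
    simp [Finset.mem_Ico.1 hu]
  · refine fun u hu => Set.indicator_of_notMem (fun h => hu (Finset.mem_Ico.2 ?_)) _
    simpa using h

theorem blockSum_eq_tsum_add (s : ℕ) (τ : Ω → WithTop ℕ) (Z : ℕ → Ω → ℝ) (ω : Ω) :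
    blockSum s τ Z ω =
      ∑' v, Set.indicator {ω | ((s + v : ℕ) : WithTop ℕ) < τ ω} (Z (s + v)) ω := by
  rw [blockSum, ← (add_right_injective s).tsum_eq]
  · exact tsum_congr fun v => by simp [Set.indicator_apply]
  · intro u hu
    exact ⟨u - s, Nat.add_sub_cancel' (Set.mem_of_indicator_ne_zero hu).1⟩

theorem abs_blockSum_le {s : ℕ} {Z : ℕ → Ω → ℝ} {ω : Ω} (hZ : Summable fun u => |Z u ω|)
    (τ : Ω → WithTop ℕ) : |blockSum s τ Z ω| ≤ ∑' v, |Z (s + v) ω| := by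
  have hle (v : ℕ) : ‖Set.indicator {ω | ((s + v : ℕ) : WithTop ℕ) < τ ω} (Z (s + v)) ω‖ ≤
      |Z (s + v) ω| := norm_indicator_le_norm_self (Z (s + v)) ω
  have hsum : Summable fun v => |Z (s + v) ω| := hZ.comp_injective (add_right_injective s)
  rw [blockSum_eq_tsum_add]
  exact tsum_of_norm_bounded hsum.hasSum hle

theorem le_blockSum {s : ℕ} {Z : ℕ → Ω → ℝ} {ω : Ω} (hZ : Summable fun u => Z u ω)
    (hZ0 : ∀ u ω, 0 ≤ Z u ω) {τ : Ω → WithTop ℕ} (hτ : (s : WithTop ℕ) < τ ω) :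
    Z s ω ≤ blockSum s τ Z ω := by
  have hsum : Summable (Set.indicator {u : ℕ | s ≤ u ∧ (u : WithTop ℕ) < τ ω} (Z · ω)) :=
    hZ.indicator _
  simpa [blockSum, hτ] using hsum.le_tsum s fun u _ => Set.indicator_nonneg (fun u _ => hZ0 u ω) u

theorem blockSum_sub_mul_le {s : ℕ} {X d M : ℕ → Ω → ℝ} {ω : Ω} (hX : Summable fun u => X u ω)
    (hd : Summable fun u => d u ω) (hdM : Summable fun u => d u ω * M u ω)
    (hd0 : ∀ u, 0 ≤ d u ω) (hM : ∀ u ≥ s, M u ω ≤ M s ω) (τ : Ω → WithTop ℕ) :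
    blockSum s τ X ω - M s ω * blockSum s τ d ω ≤
      blockSum s τ (fun u ω => X u ω - d u ω * M u ω) ω := by
  rw [blockSum, blockSum, ← tsum_mul_left,
    ← (hX.indicator _).tsum_sub ((hd.indicator _).mul_left _)]
  refine ((hX.indicator _).sub ((hd.indicator _).mul_left _)).tsum_le_tsum (fun u => ?_)
    ((hX.sub hdM).indicator _)
  by_cases hu : u ∈ {u : ℕ | s ≤ u ∧ (u : WithTop ℕ) < τ ω}
  · simp only [Set.indicator_of_mem hu]
    linarith [mul_le_mul_of_nonneg_left (hM u hu.1) (hd0 u)]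
  · simp only [Set.indicator_of_notMem hu, mul_zero, sub_zero, le_refl]

variable {mΩ : MeasurableSpace Ω} {P : Measure Ω} {F : Filtration ℕ mΩ} {Y : ℕ → Ω → ℝ}

theorem AbsSummable.comp_add_left (hY : AbsSummable P Y) (s : ℕ) :
    AbsSummable P fun v => Y (s + v) := hY.comp_injective (add_right_injective s)

theorem AbsSummable.indicator_lt_stoppingTime (hY : AbsSummable P Y) {τ : Ω → WithTop ℕ}
    (hτ : IsStoppingTime F τ) (s : ℕ) :
    AbsSummable P fun v => Set.indicator {ω | ((s + v : ℕ) : WithTop ℕ) < τ ω} (Y (s + v)) :=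
  (hY.comp_add_left s).indicator fun _ => F.le _ _ (hτ.measurableSet_gt _)

theorem integrable_blockSum (hY : AbsSummable P Y) {τ : Ω → WithTop ℕ} (hτ : IsStoppingTime F τ)
    (s : ℕ) : Integrable (blockSum s τ Y) P := by
  simpa only [funext fun ω => blockSum_eq_tsum_add s τ Y ω] using
    (hY.indicator_lt_stoppingTime hτ s).integrable_tsum

theorem hasSum_setIntegral_blockSum (hY : AbsSummable P Y) {τ : Ω → WithTop ℕ}
    (hτ : IsStoppingTime F τ) (s : ℕ) (A : Set Ω) :
    HasSum (fun v => ∫ ω in A ∩ {ω | ((s + v : ℕ) : WithTop ℕ) < τ ω}, Y (s + v) ω ∂P)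
      (∫ ω in A, blockSum s τ Y ω ∂P) := by
  have hsum := (hY.indicator_lt_stoppingTime hτ s).hasSum_setIntegral A
  simp only [← blockSum_eq_tsum_add] at hsum
  exact hsum.congr_fun fun v => (setIntegral_indicator (F.le _ _ (hτ.measurableSet_gt _))).symm

theorem tendsto_setIntegral_tsum_add (hY : AbsSummable P Y) (A : Set Ω) :
    Tendsto (fun n => ∫ ω in A, ∑' v, Y (n + v) ω ∂P) atTop (nhds 0) := by
  refine (tendsto_sum_nat_add fun v => ∫ ω in A, Y v ω ∂P).congr fun n => ?_
  rw [← ((hY.comp_add_left n).hasSum_setIntegral A).tsum_eq]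
  exact tsum_congr fun v => by rw [add_comm]

theorem ae_tsum_add_eq (hY : AbsSummable P Y) (u : ℕ) :
    (fun ω => ∑' v, Y (u + v) ω) =ᵐ[P] fun ω => Y u ω + ∑' v, Y (u + 1 + v) ω := by
  filter_upwards [(hY.comp_add_left u).ae_summable] with ω h
  rw [h.tsum_eq_zero_add]
  simp only [add_zero, add_assoc, add_comm 1]

end BlockSum

section RunningMinimum

variable {Ω : Type*}

/-- The running minimum `min (g 0, …, g s)`. -/
noncomputable def runMin (g : ℕ → Ω → ℝ) (s : ℕ) (ω : Ω) : ℝ :=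
  (Finset.range (s + 1)).inf' Finset.nonempty_range_add_one fun u => g u ω

theorem runMin_le {g : ℕ → Ω → ℝ} {u s : ℕ} (h : u ≤ s) (ω : Ω) : runMin g s ω ≤ g u ω :=
  Finset.inf'_le _ (Finset.mem_range.2 (Nat.lt_succ_of_le h))

theorem le_runMin {g : ℕ → Ω → ℝ} {s : ℕ} {ω : Ω} {a : ℝ} (h : ∀ u ≤ s, a ≤ g u ω) :
    a ≤ runMin g s ω :=
  Finset.le_inf' _ _ fun u hu => h u (Nat.le_of_lt_succ (Finset.mem_range.1 hu))

theorem runMin_antitone (g : ℕ → Ω → ℝ) (ω : Ω) : Antitone fun s => runMin g s ω :=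
  fun _ _ h => le_runMin fun _ hu => runMin_le (hu.trans h) ω

theorem exists_runMin_eq (g : ℕ → Ω → ℝ) (s : ℕ) (ω : Ω) : ∃ u ≤ s, runMin g s ω = g u ω := by
  obtain ⟨u, hu, h⟩ := Finset.exists_mem_eq_inf' (Finset.nonempty_range_add_one (n := s))
    fun u => g u ω
  exact ⟨u, Nat.le_of_lt_succ (Finset.mem_range.1 hu), h⟩

theorem runMin_succ_of_ne {g : ℕ → Ω → ℝ} {s : ℕ} {ω : Ω}
    (h : g (s + 1) ω ≠ runMin g (s + 1) ω) : runMin g (s + 1) ω = runMin g s ω := by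
  refine le_antisymm (runMin_antitone g ω (Nat.le_succ s)) ?_
  obtain ⟨u, hu, hu_eq⟩ := exists_runMin_eq g (s + 1) ω
  rcases hu.lt_or_eq with hlt | rfl
  · rw [hu_eq]
    exact runMin_le (Nat.le_of_lt_succ hlt) ω
  · exact absurd hu_eq.symm h

theorem measurable_runMin {mΩ : MeasurableSpace Ω} {F : Filtration ℕ mΩ} {g : ℕ → Ω → ℝ}
    (hg : ∀ s, Measurable[F s] (g s)) (s : ℕ) : Measurable[F s] (runMin g s) := by
  have hinf : runMin g s = (Finset.range (s + 1)).inf' Finset.nonempty_range_add_one g := by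
    funext ω
    rw [Finset.inf'_apply]
    rfl
  rw [hinf]
  exact Finset.inf'_induction (p := fun f => Measurable[F s] f) _ _ (fun _ h _ h' => h.inf h')
    fun u hu => (hg u).mono (F.mono (Nat.le_of_lt_succ (Finset.mem_range.1 hu))) le_rfl

end RunningMinimum

section Snell

variable {Ω : Type*} {mΩ : MeasurableSpace Ω}

/-- `k` steps of backward induction for the problem of stopping the accumulation of `Y`. -/
noncomputable def snellIterate (P : Measure Ω) (F : Filtration ℕ mΩ) (Y : ℕ → Ω → ℝ) :
    ℕ → ℕ → Ω → ℝ
  | 0, _ => 0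
  | k + 1, u => fun ω => max 0 (Y u ω + (P[snellIterate P F Y k (u + 1) | F u]) ω)

/-- The Snell envelope of the problem of stopping the accumulation of `Y`: the optimal expected
future gain. -/
noncomputable def snellEnvelope (P : Measure Ω) (F : Filtration ℕ mΩ) (Y : ℕ → Ω → ℝ)
    (u : ℕ) (ω : Ω) : ℝ := ⨆ k, snellIterate P F Y k u ω

variable {P : Measure Ω} {F : Filtration ℕ mΩ} {Y : ℕ → Ω → ℝ}

theorem stronglyMeasurable_snellIterate (hYm : ∀ u, StronglyMeasurable[F u] (Y u)) (k u : ℕ) :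
    StronglyMeasurable[F u] (snellIterate P F Y k u) := by
  cases k with
  | zero => exact stronglyMeasurable_zero
  | succ k =>
    exact (measurable_const.max
      ((hYm u).measurable.add stronglyMeasurable_condExp.measurable)).stronglyMeasurable

theorem snellIterate_nonneg (k u : ℕ) (ω : Ω) : 0 ≤ snellIterate P F Y k u ω := by
  cases k with
  | zero => exact le_rfl
  | succ k => exact le_max_left _ _

theorem integrable_snellIterate (hY : AbsSummable P Y) (k u : ℕ) :
    Integrable (snellIterate P F Y k u) P := by
  cases k with
  | zero => exact integrable_zero _ _ _
  | succ k => exact (integrable_zero _ _ _).sup ((hY.integrable u).add integrable_condExp)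

theorem snellIterate_le_succ (hY : AbsSummable P Y) (k u : ℕ) :
    snellIterate P F Y k u ≤ᵐ[P] snellIterate P F Y (k + 1) u := by
  induction k generalizing u with
  | zero => exact .of_forall fun ω => snellIterate_nonneg _ _ _
  | succ k ih =>
    filter_upwards [condExp_mono (m := F u) (integrable_snellIterate hY k (u + 1))
      (integrable_snellIterate hY (k + 1) (u + 1)) (ih (u + 1))] with ω h
    exact max_le_max_left _ (add_le_add_right h _)

theorem measurable_snellEnvelope (hYm : ∀ u, StronglyMeasurable[F u] (Y u)) (u : ℕ) :
    Measurable[F u] (snellEnvelope P F Y u) :=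
  Measurable.iSup fun k => (stronglyMeasurable_snellIterate hYm k u).measurable

theorem snellEnvelope_nonneg (u : ℕ) (ω : Ω) : 0 ≤ snellEnvelope P F Y u ω :=
  Real.iSup_nonneg fun k => snellIterate_nonneg k u ω

variable [IsFiniteMeasure P]

theorem condExp_tsum_add_eq (hY : AbsSummable P Y) (hYm : ∀ u, StronglyMeasurable[F u] (Y u))
    (u : ℕ) : P[fun ω => ∑' v, Y (u + v) ω | F u] =ᵐ[P]
      fun ω => Y u ω + (P[P[fun ω => ∑' v, Y (u + 1 + v) ω | F (u + 1)] | F u]) ω := by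
  filter_upwards [condExp_congr_ae (m := F u) (ae_tsum_add_eq hY u),
    condExp_add (hY.integrable u) (hY.comp_add_left (u + 1)).integrable_tsum (F u),
    condExp_condExp_of_le (μ := P) (f := fun ω => ∑' v, Y (u + 1 + v) ω)
      (F.mono (Nat.le_succ u)) (F.le (u + 1))] with ω hsplit hadd htower
  rw [hsplit, htower]
  refine hadd.trans ?_
  rw [Pi.add_apply, condExp_of_stronglyMeasurable (F.le u) (hYm u) (hY.integrable u)]

theorem snellIterate_le (hY : AbsSummable P Y) (hYm : ∀ u, StronglyMeasurable[F u] (Y u))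
    (k u : ℕ) : snellIterate P F Y k u ≤ᵐ[P] P[fun ω => ∑' v, |Y (u + v) ω| | F u] := by
  have hYa (u : ℕ) : StronglyMeasurable[F u] fun ω => |Y u ω| :=
    continuous_abs.comp_stronglyMeasurable (hYm u)
  have hpos (u : ℕ) : 0 ≤ᵐ[P] P[fun ω => ∑' v, |Y (u + v) ω| | F u] :=
    condExp_nonneg (.of_forall fun ω => tsum_nonneg fun v => abs_nonneg _)
  induction k generalizing u with
  | zero => exact hpos u
  | succ k ih =>
    filter_upwards [condExp_mono (m := F u) (integrable_snellIterate hY k (u + 1))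
      integrable_condExp (ih (u + 1)), condExp_tsum_add_eq hY.abs hYa u, hpos u]
      with ω hstep hrec hnonneg
    refine max_le hnonneg ?_
    rw [hrec]
    exact add_le_add (le_abs_self _) hstep

theorem ae_tendsto_snellIterate (hY : AbsSummable P Y) (hYm : ∀ u, StronglyMeasurable[F u] (Y u))
    (u : ℕ) : ∀ᵐ ω ∂P, (∀ k, snellIterate P F Y k u ω ≤ snellEnvelope P F Y u ω) ∧
      Tendsto (fun k => snellIterate P F Y k u ω) atTop (nhds (snellEnvelope P F Y u ω)) := by
  filter_upwards [ae_all_iff.2 fun k => snellIterate_le_succ (F := F) hY k u,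
    ae_all_iff.2 fun k => snellIterate_le hY hYm k u] with ω hmono hle
  have hbdd : BddAbove (Set.range fun k => snellIterate P F Y k u ω) :=
    ⟨_, by rintro _ ⟨k, rfl⟩; exact hle k⟩
  exact ⟨fun k => le_ciSup hbdd k, tendsto_atTop_ciSup (monotone_nat_of_le_succ hmono) hbdd⟩

theorem snellEnvelope_le (hY : AbsSummable P Y) (hYm : ∀ u, StronglyMeasurable[F u] (Y u))
    (u : ℕ) : snellEnvelope P F Y u ≤ᵐ[P] P[fun ω => ∑' v, |Y (u + v) ω| | F u] := by
  filter_upwards [ae_all_iff.2 fun k => snellIterate_le hY hYm k u] with ω hle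
  exact ciSup_le hle

theorem integrable_snellEnvelope (hY : AbsSummable P Y) (hYm : ∀ u, StronglyMeasurable[F u] (Y u))
    (u : ℕ) : Integrable (snellEnvelope P F Y u) P := by
  refine (integrable_condExp (m := F u) (f := fun ω => ∑' v, |Y (u + v) ω|)).mono'
    ((measurable_snellEnvelope hYm u).mono (F.le u) le_rfl).aestronglyMeasurable ?_
  filter_upwards [snellEnvelope_le hY hYm u] with ω h
  rwa [Real.norm_of_nonneg (snellEnvelope_nonneg u ω)]

theorem tendsto_setIntegral_snellEnvelope (hY : AbsSummable P Y)
    (hYm : ∀ u, StronglyMeasurable[F u] (Y u)) (A : Set Ω) :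
    Tendsto (fun n => ∫ ω in A, snellEnvelope P F Y n ω ∂P) atTop (nhds 0) := by
  refine squeeze_zero (fun n => integral_nonneg (snellEnvelope_nonneg n)) (fun n => ?_)
    (tendsto_setIntegral_tsum_add hY.abs Set.univ)
  calc ∫ ω in A, snellEnvelope P F Y n ω ∂P
      ≤ ∫ ω, snellEnvelope P F Y n ω ∂P :=
        setIntegral_le_integral (integrable_snellEnvelope hY hYm n)
          (.of_forall (snellEnvelope_nonneg n))
    _ ≤ ∫ ω, (P[fun ω => ∑' v, |Y (n + v) ω| | F n]) ω ∂P :=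
        integral_mono_ae (integrable_snellEnvelope hY hYm n) integrable_condExp
          (snellEnvelope_le hY hYm n)
    _ = ∫ ω in Set.univ, ∑' v, |Y (n + v) ω| ∂P := by
        rw [integral_condExp (F.le n), setIntegral_univ]

theorem tendsto_setIntegral_snellIterate (hY : AbsSummable P Y)
    (hYm : ∀ u, StronglyMeasurable[F u] (Y u)) (u : ℕ) (A : Set Ω) :
    Tendsto (fun k => ∫ ω in A, snellIterate P F Y k u ω ∂P) atTop
      (nhds (∫ ω in A, snellEnvelope P F Y u ω ∂P)) := by
  refine tendsto_integral_of_dominated_convergence (snellEnvelope P F Y u)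
    (fun k => (integrable_snellIterate hY k _).1.restrict)
    (integrable_snellEnvelope hY hYm _).integrableOn
    (fun k => ae_restrict_of_ae ?_) (ae_restrict_of_ae ?_)
  · filter_upwards [ae_tendsto_snellIterate hY hYm u] with ω h
    rw [Real.norm_of_nonneg (snellIterate_nonneg _ _ _)]
    exact h.1 k
  · filter_upwards [ae_tendsto_snellIterate hY hYm u] with ω h using h.2

theorem setIntegral_add_snellEnvelope_le (hY : AbsSummable P Y)
    (hYm : ∀ u, StronglyMeasurable[F u] (Y u)) {u : ℕ} {A : Set Ω} (hA : MeasurableSet[F u] A) :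
    ∫ ω in A, Y u ω ∂P + ∫ ω in A, snellEnvelope P F Y (u + 1) ω ∂P ≤
      ∫ ω in A, snellEnvelope P F Y u ω ∂P := by
  refine le_of_tendsto' ((tendsto_setIntegral_snellIterate hY hYm (u + 1) A).const_add _)
    fun k => ?_
  rw [← setIntegral_condExp (F.le u) (integrable_snellIterate hY k _) hA,
    ← integral_add (hY.integrable u).integrableOn integrable_condExp.integrableOn]
  refine integral_mono_ae ((hY.integrable u).add integrable_condExp).integrableOn
    (integrable_snellEnvelope hY hYm u).integrableOn (ae_restrict_of_ae ?_)
  filter_upwards [ae_tendsto_snellIterate hY hYm u] with ω h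
  exact (le_max_right _ _).trans (h.1 (k + 1))

theorem snellEnvelope_le_max (hY : AbsSummable P Y) (hYm : ∀ u, StronglyMeasurable[F u] (Y u))
    (u : ℕ) : ∀ᵐ ω ∂P, snellEnvelope P F Y u ω ≤
      max 0 (Y u ω + (P[snellEnvelope P F Y (u + 1) | F u]) ω) := by
  have hmono (k : ℕ) : P[snellIterate P F Y k (u + 1) | F u] ≤ᵐ[P]
      P[snellEnvelope P F Y (u + 1) | F u] :=
    condExp_mono (integrable_snellIterate hY k _) (integrable_snellEnvelope hY hYm _)
      ((ae_tendsto_snellIterate hY hYm (u + 1)).mono fun ω h => h.1 k)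
  filter_upwards [ae_all_iff.2 hmono] with ω h
  refine ciSup_le fun k => ?_
  cases k with
  | zero => exact le_max_left _ _
  | succ k => exact max_le_max_left _ (add_le_add le_rfl (h k))

theorem setIntegral_inter_lt_add_snellEnvelope_le (hY : AbsSummable P Y)
    (hYm : ∀ u, StronglyMeasurable[F u] (Y u)) {τ : Ω → WithTop ℕ} (hτ : IsStoppingTime F τ)
    {n : ℕ} {A : Set Ω} (hA : MeasurableSet[F (n + 1)] A) :
    ∫ ω in A ∩ {ω | ((n + 1 : ℕ) : WithTop ℕ) < τ ω}, Y (n + 1) ω ∂P +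
        ∫ ω in A ∩ {ω | ((n + 1 : ℕ) : WithTop ℕ) < τ ω}, snellEnvelope P F Y (n + 2) ω ∂P ≤
      ∫ ω in A ∩ {ω | (n : WithTop ℕ) < τ ω}, snellEnvelope P F Y (n + 1) ω ∂P := by
  refine (setIntegral_add_snellEnvelope_le hY hYm
    (MeasurableSet.inter hA (hτ.measurableSet_gt _))).trans ?_
  refine setIntegral_mono_set (integrable_snellEnvelope hY hYm _).integrableOn
    (.of_forall fun ω => snellEnvelope_nonneg _ ω) (LE.le.eventuallyLE ?_)
  exact Set.inter_subset_inter_right _ fun ω (hω : ((n + 1 : ℕ) : WithTop ℕ) < τ ω) =>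
    (WithTop.coe_lt_coe.2 n.lt_succ_self).trans hω

theorem sum_setIntegral_add_snellEnvelope_le (hY : AbsSummable P Y)
    (hYm : ∀ u, StronglyMeasurable[F u] (Y u)) {τ : Ω → WithTop ℕ} (hτ : IsStoppingTime F τ)
    {s : ℕ} (hs : ∀ ω, (s : WithTop ℕ) < τ ω) {A : Set Ω} (hA : MeasurableSet[F s] A) (k : ℕ) :
    ∑ v ∈ Finset.range (k + 1),
        ∫ ω in A ∩ {ω | ((s + v : ℕ) : WithTop ℕ) < τ ω}, Y (s + v) ω ∂P +
      ∫ ω in A ∩ {ω | ((s + k : ℕ) : WithTop ℕ) < τ ω}, snellEnvelope P F Y (s + k + 1) ω ∂P ≤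
      ∫ ω in A, (Y s ω + snellEnvelope P F Y (s + 1) ω) ∂P := by
  induction k with
  | zero =>
    rw [integral_add (hY.integrable s).integrableOn
      (integrable_snellEnvelope hY hYm _).integrableOn]
    simp [hs]
  | succ k ih =>
    have hstep := setIntegral_inter_lt_add_snellEnvelope_le hY hYm hτ (n := s + k)
      (F.mono (by omega) _ hA)
    rw [Finset.sum_range_succ]
    simp only [← add_assoc] at hstep ⊢
    linarith

theorem setIntegral_blockSum_le (hY : AbsSummable P Y) (hYm : ∀ u, StronglyMeasurable[F u] (Y u))
    {τ : Ω → WithTop ℕ} (hτ : IsStoppingTime F τ) {s : ℕ} (hs : ∀ ω, (s : WithTop ℕ) < τ ω)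
    {A : Set Ω} (hA : MeasurableSet[F s] A) :
    ∫ ω in A, blockSum s τ Y ω ∂P ≤ ∫ ω in A, (Y s ω + snellEnvelope P F Y (s + 1) ω) ∂P := by
  refine le_of_tendsto' ((hasSum_setIntegral_blockSum hY hτ s A).tendsto_sum_nat.comp
    (tendsto_add_atTop_nat 1)) fun k => ?_
  exact (le_add_of_nonneg_right (integral_nonneg (snellEnvelope_nonneg _))).trans
    (sum_setIntegral_add_snellEnvelope_le hY hYm hτ hs hA k)

theorem setIntegral_snellEnvelope_le_add (hY : AbsSummable P Y)
    (hYm : ∀ u, StronglyMeasurable[F u] (Y u)) {u : ℕ}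
    (hC : ∀ᵐ ω ∂P, 0 ≤ Y u ω + (P[snellEnvelope P F Y (u + 1) | F u]) ω) {A : Set Ω}
    (hA : MeasurableSet[F u] A) :
    ∫ ω in A, snellEnvelope P F Y u ω ∂P ≤
      ∫ ω in A, Y u ω ∂P + ∫ ω in A, snellEnvelope P F Y (u + 1) ω ∂P := by
  rw [← setIntegral_condExp (F.le u) (integrable_snellEnvelope hY hYm (u + 1)) hA,
    ← integral_add (hY.integrable u).integrableOn integrable_condExp.integrableOn]
  refine integral_mono_ae (integrable_snellEnvelope hY hYm u).integrableOn
    ((hY.integrable u).add integrable_condExp).integrableOn (ae_restrict_of_ae ?_)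
  filter_upwards [hC, snellEnvelope_le_max hY hYm u] with ω hnonneg hmax
  rwa [max_eq_right hnonneg] at hmax

/- If continuing never hurts, never stopping is optimal, so its gain is that of the Snell envelope,
which is nonnegative. -/
theorem setIntegral_tsum_add_nonneg_of_snell (hY : AbsSummable P Y)
    (hYm : ∀ u, StronglyMeasurable[F u] (Y u))
    (hC : ∀ u, ∀ᵐ ω ∂P, 0 ≤ Y u ω + (P[snellEnvelope P F Y (u + 1) | F u]) ω) {s : ℕ} {A : Set Ω}
    (hA : MeasurableSet[F s] A) : 0 ≤ ∫ ω in A, ∑' v, Y (s + v) ω ∂P := by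
  have hle (n : ℕ) : ∫ ω in A, snellEnvelope P F Y s ω ∂P ≤
      ∑ v ∈ Finset.range n, ∫ ω in A, Y (s + v) ω ∂P +
        ∫ ω in A, snellEnvelope P F Y (n + s) ω ∂P := by
    induction n with
    | zero => simp
    | succ n ih =>
      have hstep := setIntegral_snellEnvelope_le_add hY hYm (hC (s + n)) (F.mono (by omega) _ hA)
      rw [Finset.sum_range_succ, add_right_comm n 1 s, add_comm n s]
      rw [add_comm n s] at ih
      linarith
  have hlim := ((hY.comp_add_left s).hasSum_setIntegral A).tendsto_sum_nat.add
    ((tendsto_setIntegral_snellEnvelope (F := F) hY hYm A).comp (tendsto_add_atTop_nat s))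
  rw [add_zero] at hlim
  exact (integral_nonneg (snellEnvelope_nonneg s)).trans (ge_of_tendsto' hlim hle)

end Snell

/-- A single arm, abstracted from the renewal model: discount factors `d` and rewards `X`, both
adapted to `F`. The last fields but one say that `β` is the expected factor by which each operation
shrinks the discount, independently of the past. -/
structure DiscountedArm {Ω : Type*} {mΩ : MeasurableSpace Ω} (P : Measure Ω) where
  F : Filtration ℕ mΩ
  X : ℕ → Ω → ℝ
  d : ℕ → Ω → ℝ
  β : ℝ
  measurable_X : ∀ s, Measurable[F s] (X s)
  measurable_d : ∀ s, Measurable[F s] (d s)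
  d_pos : ∀ s ω, 0 < d s ω
  d_zero : ∀ ω, d 0 ω = 1
  β_nonneg : 0 ≤ β
  β_lt_one : β < 1
  integrable_d_succ : ∀ s (Z : Ω → ℝ), Measurable[F s] Z → Integrable (fun ω => d s ω * Z ω) P →
    Integrable (fun ω => d (s + 1) ω * Z ω) P
  integral_d_succ : ∀ s (Z : Ω → ℝ), Measurable[F s] Z → Integrable (fun ω => d s ω * Z ω) P →
    ∫ ω, d (s + 1) ω * Z ω ∂P = β * ∫ ω, d s ω * Z ω ∂P
  absSummable_d_mul_X : AbsSummable P fun s ω => d s ω * X s ω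

namespace DiscountedArm

variable {Ω : Type*} {mΩ : MeasurableSpace Ω} {P : Measure Ω} (a : DiscountedArm P)

/-- The discounted reward of the operation number `s`. -/
noncomputable def reward (s : ℕ) (ω : Ω) : ℝ := a.d s ω * a.X s ω

/-- The stopping times larger than `s`. -/
def stopsAfter (s : ℕ) : Set (Ω → WithTop ℕ) :=
  {τ | IsStoppingTime a.F τ ∧ ∀ ω, (s : WithTop ℕ) < τ ω}

/-- The conditional expected discounted time in `[s, τ)`. -/
noncomputable def expTime (s : ℕ) (τ : Ω → WithTop ℕ) : Ω → ℝ := P[blockSum s τ a.d | a.F s]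

/-- The conditional expected discounted reward in `[s, τ)`. -/
noncomputable def expReward (s : ℕ) (τ : Ω → WithTop ℕ) : Ω → ℝ :=
  P[blockSum s τ a.reward | a.F s]

/-- The reward per unit of time in `[s, τ)`, whose essential supremum over `τ` is the index. -/
noncomputable def rate (s : ℕ) (τ : Ω → WithTop ℕ) (ω : Ω) : ℝ :=
  a.expReward s τ ω / a.expTime s τ ω

/-- The conditional expected absolute discounted reward from the operation number `s` on. -/
noncomputable def absReward (s : ℕ) : Ω → ℝ := P[fun ω => ∑' v, |a.reward (s + v) ω| | a.F s]

/-- `γ` is an adapted version of the index process of the arm. -/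
def IsIndex (γ : ℕ → Ω → ℝ) : Prop :=
  ∀ s, Measurable[a.F s] (γ s) ∧ IsEssSup P (a.rate s '' a.stopsAfter s) (γ s)

theorem absSummable_reward : AbsSummable P a.reward := a.absSummable_d_mul_X

theorem stronglyMeasurable_reward (s : ℕ) : StronglyMeasurable[a.F s] (a.reward s) :=
  ((a.measurable_d s).mul (a.measurable_X s)).stronglyMeasurable

theorem measurable_absReward (s : ℕ) : Measurable[a.F s] (a.absReward s) :=
  stronglyMeasurable_condExp.measurable

theorem measurable_rate (s : ℕ) (τ : Ω → WithTop ℕ) : Measurable[a.F s] (a.rate s τ) :=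
  Measurable.div (m := a.F s) stronglyMeasurable_condExp.measurable
    stronglyMeasurable_condExp.measurable

theorem measurable_absReward_div_d (s : ℕ) :
    Measurable[a.F s] fun ω => a.absReward s ω / a.d s ω :=
  (a.measurable_absReward s).div (a.measurable_d s)

theorem integrable_d_add_mul {s : ℕ} {Z : Ω → ℝ} (hZ : Measurable[a.F s] Z)
    (hi : Integrable (fun ω => a.d s ω * Z ω) P) (v : ℕ) :
    Integrable (fun ω => a.d (s + v) ω * Z ω) P := by
  induction v with
  | zero => exact hi
  | succ v ih => exact a.integrable_d_succ _ _ (hZ.mono (a.F.mono (Nat.le_add_right _ _)) le_rfl) ih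

theorem integral_d_add_mul {s : ℕ} {Z : Ω → ℝ} (hZ : Measurable[a.F s] Z)
    (hi : Integrable (fun ω => a.d s ω * Z ω) P) (v : ℕ) :
    ∫ ω, a.d (s + v) ω * Z ω ∂P = a.β ^ v * ∫ ω, a.d s ω * Z ω ∂P := by
  induction v with
  | zero => simp
  | succ v ih =>
    rw [← add_assoc, a.integral_d_succ _ _ (hZ.mono (a.F.mono (Nat.le_add_right _ _)) le_rfl)
      (a.integrable_d_add_mul hZ hi v), ih]
    ring

theorem absSummable_d_add_mul {s : ℕ} {Z : Ω → ℝ} (hZ : Measurable[a.F s] Z)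
    (hi : Integrable (fun ω => a.d s ω * Z ω) P) :
    AbsSummable P fun v ω => a.d (s + v) ω * Z ω := by
  have habs (v : ℕ) (ω : Ω) : |a.d v ω * Z ω| = a.d v ω * |Z ω| := by
    rw [abs_mul, abs_of_pos (a.d_pos v ω)]
  have hZa : Measurable[a.F s] fun ω => |Z ω| := continuous_abs.measurable.comp hZ
  have hia : Integrable (fun ω => a.d s ω * |Z ω|) P := by simpa only [habs] using hi.abs
  refine AbsSummable.of_summable_integral (fun v => (a.integrable_d_add_mul hZ hi v).1)
    (fun v => a.integrable_d_add_mul hZa hia v) (fun v => .of_forall fun ω => (habs _ ω).le) ?_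
  simp only [a.integral_d_add_mul hZa hia]
  exact (summable_geometric_of_lt_one a.β_nonneg a.β_lt_one).mul_right _

section

variable {a} {s : ℕ} {τ : Ω → WithTop ℕ}

theorem integrable_blockSum_reward (hτ : τ ∈ a.stopsAfter s) :
    Integrable (blockSum s τ a.reward) P :=
  integrable_blockSum a.absSummable_reward hτ.1 s

theorem abs_expReward_le (hτ : τ ∈ a.stopsAfter s) :
    ∀ᵐ ω ∂P, |a.expReward s τ ω| ≤ a.absReward s ω := by
  have hmono : condExp (a.F s) P |blockSum s τ a.reward| ≤ᵐ[P] a.absReward s :=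
    condExp_mono (integrable_blockSum_reward hτ).abs
      (a.absSummable_reward.abs.comp_add_left s).integrable_tsum
      (a.absSummable_reward.ae_summable_abs.mono fun ω hω => abs_blockSum_le hω τ)
  exact (abs_condExp_ae_le_condExp_abs (μ := P) (m := a.F s) (blockSum s τ a.reward)).trans hmono

theorem succ_mem_stopsAfter (s : ℕ) : (fun _ => ((s + 1 : ℕ) : WithTop ℕ)) ∈ a.stopsAfter s :=
  ⟨isStoppingTime_const a.F (s + 1), fun _ => WithTop.coe_lt_coe.2 (Nat.lt_succ_self s)⟩

theorem blockSum_succ (s : ℕ) (Z : ℕ → Ω → ℝ) :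
    blockSum s (fun _ => ((s + 1 : ℕ) : WithTop ℕ)) Z = Z s := by
  funext ω
  rw [blockSum_coe s (fun _ => s + 1), Nat.Ico_succ_singleton, Finset.sum_singleton]

theorem IsIndex.rate_le {γ : ℕ → Ω → ℝ} (hγ : a.IsIndex γ) (hτ : τ ∈ a.stopsAfter s) :
    a.rate s τ ≤ᵐ[P] γ s :=
  (hγ s).2.2.1 _ ⟨τ, hτ, rfl⟩

end

variable [IsFiniteMeasure P]

theorem absSummable_d : AbsSummable P a.d := by
  have hi : Integrable (fun ω => a.d 0 ω * 1) P := by simp [a.d_zero]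
  simpa using a.absSummable_d_add_mul measurable_const hi

theorem setIntegral_d_add {s : ℕ} {A : Set Ω} (hA : MeasurableSet[a.F s] A) (v : ℕ) :
    ∫ ω in A, a.d (s + v) ω ∂P = a.β ^ v * ∫ ω in A, a.d s ω ∂P := by
  have hmul (u : ℕ) : (fun ω => a.d u ω * A.indicator 1 ω) = A.indicator (a.d u) := by
    funext ω
    by_cases h : ω ∈ A <;> simp [h]
  have hZ : Measurable[a.F s] (A.indicator (1 : Ω → ℝ)) := measurable_const.indicator hA
  have hi : Integrable (fun ω => a.d s ω * A.indicator 1 ω) P := by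
    rw [hmul]
    exact (a.absSummable_d.integrable s).indicator (a.F.le s _ hA)
  simpa only [hmul, integral_indicator (a.F.le s _ hA)] using a.integral_d_add_mul hZ hi v

theorem setIntegral_tsum_d {s : ℕ} {A : Set Ω} (hA : MeasurableSet[a.F s] A) :
    ∫ ω in A, ∑' v, a.d (s + v) ω ∂P = ∫ ω in A, (1 - a.β)⁻¹ * a.d s ω ∂P := by
  rw [← ((a.absSummable_d.comp_add_left s).hasSum_setIntegral A).tsum_eq, integral_const_mul]
  simp only [a.setIntegral_d_add hA]
  rw [tsum_mul_right, tsum_geometric_of_lt_one a.β_nonneg a.β_lt_one]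

variable {a} {s : ℕ} {τ : Ω → WithTop ℕ}

theorem ae_d_le_blockSum (hτ : ∀ ω, (s : WithTop ℕ) < τ ω) :
    a.d s ≤ᵐ[P] blockSum s τ a.d :=
  a.absSummable_d.ae_summable.mono fun ω hω =>
    le_blockSum hω (fun u ω => (a.d_pos u ω).le) (hτ ω)

theorem ae_abs_blockSum_d_le (s : ℕ) (τ : Ω → WithTop ℕ) :
    ∀ᵐ ω ∂P, |blockSum s τ a.d ω| ≤ ∑' v, a.d (s + v) ω := by
  filter_upwards [a.absSummable_d.ae_summable_abs] with ω hω
  simpa only [abs_of_pos (a.d_pos _ ω)] using abs_blockSum_le hω τ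

theorem integrable_blockSum_d (hτ : τ ∈ a.stopsAfter s) : Integrable (blockSum s τ a.d) P :=
  integrable_blockSum a.absSummable_d hτ.1 s

theorem d_le_expTime (hτ : τ ∈ a.stopsAfter s) : a.d s ≤ᵐ[P] a.expTime s τ := by
  have hmono := condExp_mono (m := a.F s) (a.absSummable_d.integrable s) (integrable_blockSum_d hτ)
    (ae_d_le_blockSum hτ.2)
  rwa [condExp_of_stronglyMeasurable (a.F.le s) (a.measurable_d s).stronglyMeasurable
    (a.absSummable_d.integrable s)] at hmono

theorem expTime_pos (hτ : τ ∈ a.stopsAfter s) : ∀ᵐ ω ∂P, 0 < a.expTime s τ ω :=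
  (d_le_expTime hτ).mono fun ω h => (a.d_pos s ω).trans_le h

theorem expTime_le (hτ : τ ∈ a.stopsAfter s) :
    ∀ᵐ ω ∂P, a.expTime s τ ω ≤ (1 - a.β)⁻¹ * a.d s ω := by
  refine condExp_le_of_forall_setIntegral_le (a.F.le s) (integrable_blockSum_d hτ)
    ((a.absSummable_d.integrable s).const_mul _)
    (measurable_const.mul (a.measurable_d s)).stronglyMeasurable fun A hA => ?_
  rw [← a.setIntegral_tsum_d hA]
  exact integral_mono_ae (integrable_blockSum_d hτ).integrableOn
    (a.absSummable_d.comp_add_left s).integrable_tsum.integrableOn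
    (ae_restrict_of_ae ((ae_abs_blockSum_d_le s τ).mono fun ω h => (le_abs_self _).trans h))

theorem rate_le (hτ : τ ∈ a.stopsAfter s) :
    a.rate s τ ≤ᵐ[P] fun ω => a.absReward s ω / a.d s ω := by
  filter_upwards [abs_expReward_le hτ, d_le_expTime hτ] with ω hreward htime
  exact div_le_div₀ ((abs_nonneg _).trans hreward) ((le_abs_self _).trans hreward) (a.d_pos s ω)
    htime

theorem expReward_succ (a : DiscountedArm P) (s : ℕ) :
    a.expReward s (fun _ => ((s + 1 : ℕ) : WithTop ℕ)) = a.reward s := by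
  rw [expReward, blockSum_succ, condExp_of_stronglyMeasurable (a.F.le s)
    (a.stronglyMeasurable_reward s) (a.absSummable_reward.integrable s)]

theorem expTime_succ (a : DiscountedArm P) (s : ℕ) :
    a.expTime s (fun _ => ((s + 1 : ℕ) : WithTop ℕ)) = a.d s := by
  rw [expTime, blockSum_succ, condExp_of_stronglyMeasurable (a.F.le s)
    (a.measurable_d s).stronglyMeasurable (a.absSummable_d.integrable s)]

theorem rate_succ (a : DiscountedArm P) (s : ℕ) :
    a.rate s (fun _ => ((s + 1 : ℕ) : WithTop ℕ)) = a.X s := by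
  funext ω
  rw [rate, expReward_succ, expTime_succ]
  exact mul_div_cancel_left₀ _ (a.d_pos s ω).ne'

theorem exists_isEssSup_rate (a : DiscountedArm P) (s : ℕ) :
    ∃ g, IsEssSup P (a.rate s '' a.stopsAfter s) g := by
  refine exists_isEssSup ⟨_, ⟨_, succ_mem_stopsAfter s, rfl⟩⟩
    ((a.measurable_absReward_div_d s).mono (a.F.le s) le_rfl).aemeasurable ?_ ?_
  · rintro _ ⟨τ, -, rfl⟩
    exact ((a.measurable_rate s τ).mono (a.F.le s) le_rfl).aemeasurable
  · rintro _ ⟨τ, hτ, rfl⟩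
    exact rate_le hτ

theorem exists_measurable_ae_eq_of_isEssSup {g : Ω → ℝ}
    (hg : IsEssSup P (a.rate s '' a.stopsAfter s) g) :
    ∃ g', Measurable[a.F s] g' ∧ g =ᵐ[P] g' := by
  refine hg.exists_measurable_ae_eq (a.F.le s) (a.measurable_absReward_div_d s) ?_ ?_
  · rintro _ ⟨τ, -, rfl⟩
    exact a.measurable_rate s τ
  · rintro _ ⟨τ, hτ, rfl⟩
    exact rate_le hτ

theorem integrable_mul_blockSum_d {Z : Ω → ℝ} (hZ : Measurable[a.F s] Z)
    (hi : Integrable (fun ω => a.d s ω * Z ω) P) (hτ : τ ∈ a.stopsAfter s) :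
    Integrable (fun ω => Z ω * blockSum s τ a.d ω) P := by
  have hfactor (ω : Ω) : ∑' v, |a.d (s + v) ω * Z ω| = |Z ω| * ∑' v, a.d (s + v) ω := by
    rw [← tsum_mul_left]
    exact tsum_congr fun v => by rw [abs_mul, abs_of_pos (a.d_pos _ _), mul_comm]
  refine (a.absSummable_d_add_mul hZ hi).abs.integrable_tsum.mono'
    ((hZ.mono (a.F.le s) le_rfl).aestronglyMeasurable.mul (integrable_blockSum_d hτ).1) ?_
  filter_upwards [ae_abs_blockSum_d_le s τ] with ω hblock
  rw [hfactor, norm_mul, Real.norm_eq_abs, Real.norm_eq_abs]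
  exact mul_le_mul_of_nonneg_left hblock (abs_nonneg _)

theorem condExp_mul_blockSum_d {Z : Ω → ℝ} (hZ : Measurable[a.F s] Z)
    (hi : Integrable (fun ω => a.d s ω * Z ω) P) (hτ : τ ∈ a.stopsAfter s) :
    P[fun ω => Z ω * blockSum s τ a.d ω | a.F s] =ᵐ[P] fun ω => Z ω * a.expTime s τ ω :=
  condExp_mul_of_stronglyMeasurable_left hZ.stronglyMeasurable (integrable_mul_blockSum_d hZ hi hτ)
    (integrable_blockSum_d hτ)

namespace IsIndex

variable {γ : ℕ → Ω → ℝ}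

theorem reward_le (hγ : a.IsIndex γ) (s : ℕ) : a.X s ≤ᵐ[P] γ s := by
  rw [← a.rate_succ s]
  exact hγ.rate_le (succ_mem_stopsAfter s)

theorem le_absReward_div (hγ : a.IsIndex γ) (s : ℕ) :
    γ s ≤ᵐ[P] fun ω => a.absReward s ω / a.d s ω := by
  refine (hγ s).2.2.2 _ ((a.measurable_absReward_div_d s).mono (a.F.le s) le_rfl).aemeasurable ?_
  rintro _ ⟨τ, hτ, rfl⟩
  exact DiscountedArm.rate_le hτ

theorem abs_mul_le (hγ : a.IsIndex γ) (s : ℕ) :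
    ∀ᵐ ω ∂P, |a.d s ω * γ s ω| ≤ a.absReward s ω := by
  have habs := abs_expReward_le (succ_mem_stopsAfter (a := a) s)
  rw [expReward_succ] at habs
  filter_upwards [hγ.reward_le s, hγ.le_absReward_div s, habs] with ω hX hγle hle
  rw [le_div_iff₀ (a.d_pos s ω), mul_comm] at hγle
  have hmul : a.reward s ω ≤ a.d s ω * γ s ω := mul_le_mul_of_nonneg_left hX (a.d_pos s ω).le
  exact abs_le.2 ⟨((abs_le.1 hle).1).trans hmul, hγle⟩

theorem integrable_mul (hγ : a.IsIndex γ) (s : ℕ) : Integrable (fun ω => a.d s ω * γ s ω) P :=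
  (integrable_condExp (m := a.F s)).mono'
    (((a.measurable_d s).mul (hγ s).1).mono (a.F.le s) le_rfl).aestronglyMeasurable
    (hγ.abs_mul_le s)

theorem expReward_le (hγ : a.IsIndex γ) (hτ : τ ∈ a.stopsAfter s) :
    ∀ᵐ ω ∂P, a.expReward s τ ω ≤ γ s ω * a.expTime s τ ω := by
  filter_upwards [hγ.rate_le hτ, expTime_pos hτ] with ω hrate hpos
  exact (div_le_iff₀ hpos).1 hrate

theorem setIntegral_blockSum_le (hγ : a.IsIndex γ) (hτ : τ ∈ a.stopsAfter s) {A : Set Ω}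
    (hA : MeasurableSet[a.F s] A) :
    ∫ ω in A, (blockSum s τ a.reward ω - γ s ω * blockSum s τ a.d ω) ∂P ≤ 0 := by
  have hi := integrable_mul_blockSum_d (hγ s).1 (hγ.integrable_mul s) hτ
  rw [integral_sub (integrable_blockSum_reward hτ).integrableOn hi.integrableOn,
    ← setIntegral_condExp (a.F.le s) (integrable_blockSum_reward hτ) hA,
    ← setIntegral_condExp (a.F.le s) hi hA, sub_nonpos]
  refine integral_mono_ae integrable_condExp.integrableOn integrable_condExp.integrableOn
    (ae_restrict_of_ae ?_)
  filter_upwards [hγ.expReward_le hτ, condExp_mul_blockSum_d (hγ s).1 (hγ.integrable_mul s) hτ]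
    with ω hle heq
  rw [heq]
  exact hle

-- If `C < 0`, spreading `C` over the at most `d s / (1 - β)` units of expected time left lowers
-- the upper bound `γ s` of all rates.
theorem nonneg_of_forall_expReward_le (hγ : a.IsIndex γ) {M C : Ω → ℝ} (hM : M ≤ᵐ[P] γ s)
    (hCm : Measurable[a.F s] C)
    (hC : ∀ τ ∈ a.stopsAfter s, ∀ᵐ ω ∂P, a.expReward s τ ω - M ω * a.expTime s τ ω ≤ C ω) :
    0 ≤ᵐ[P] C := by
  have hβ : 0 < 1 - a.β := sub_pos.2 a.β_lt_one
  have hm : Measurable[a.F s] fun ω => γ s ω + min (C ω) 0 * ((1 - a.β) / a.d s ω) :=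
    (hγ s).1.add ((hCm.min measurable_const).mul (measurable_const.div (a.measurable_d s)))
  have hbound : ∀ f ∈ a.rate s '' a.stopsAfter s,
      f ≤ᵐ[P] fun ω => γ s ω + min (C ω) 0 * ((1 - a.β) / a.d s ω) := by
    rintro _ ⟨τ, hτ, rfl⟩
    filter_upwards [hγ.rate_le hτ, expTime_pos hτ, expTime_le hτ, hC τ hτ, hM]
      with ω hrate hpos htime hCω hMω
    rcases le_total 0 (C ω) with hC0 | hC0
    · rwa [min_eq_right hC0, zero_mul, add_zero]
    have hinv : (1 - a.β) / a.d s ω ≤ (a.expTime s τ ω)⁻¹ := by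
      rw [← inv_div]
      exact inv_anti₀ hpos (by rwa [div_eq_inv_mul])
    calc a.rate s τ ω ≤ M ω + C ω * (a.expTime s τ ω)⁻¹ := by
          rw [rate, div_le_iff₀ hpos, add_mul, inv_mul_cancel_right₀ hpos.ne']
          linarith
      _ ≤ γ s ω + min (C ω) 0 * ((1 - a.β) / a.d s ω) := by
          rw [min_eq_left hC0]
          exact add_le_add hMω (mul_le_mul_of_nonpos_left hinv hC0)
  filter_upwards [(hγ s).2.2.2 _ (hm.mono (a.F.le s) le_rfl).aemeasurable hbound] with ω hle
  have hmin : 0 ≤ min (C ω) 0 :=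
    nonneg_of_mul_nonneg_left (le_add_iff_nonneg_right _ |>.1 hle) (div_pos hβ (a.d_pos s ω))
  exact hmin.trans (min_le_left _ _)

end IsIndex

end DiscountedArm

section NextRecord

variable {Ω : Type*} {g : ℕ → Ω → ℝ} {u N : ℕ} {ω : Ω}

/-- The first time after `u` at which `g` attains its running minimum, cut off at `N`. -/
noncomputable def nextRecord (g : ℕ → Ω → ℝ) (u N : ℕ) : Ω → ℕ :=
  hittingBtwn (fun s ω => g s ω - runMin g s ω) {0} (u + 1) N

theorem lt_nextRecord (h : u < N) (ω : Ω) : u < nextRecord g u N ω :=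
  le_hittingBtwn (Nat.succ_le_of_lt h) ω

theorem nextRecord_le (ω : Ω) : nextRecord g u N ω ≤ N := hittingBtwn_le ω

theorem eq_runMin_of_nextRecord_eq {w : ℕ} (hw : w < N) (h : nextRecord g u N ω = w) :
    g w ω = runMin g w ω := by
  subst h
  exact sub_eq_zero.1 (hittingBtwn_mem_set_of_hittingBtwn_lt hw)

theorem runMin_eq_of_lt_nextRecord (hu : g u ω = runMin g u ω) {v : ℕ} (huv : u ≤ v)
    (hv : v < nextRecord g u N ω) : runMin g v ω = g u ω := by
  induction v, huv using Nat.le_induction with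
  | base => exact hu.symm
  | succ v huv ih =>
    have hne : g (v + 1) ω ≠ runMin g (v + 1) ω := fun heq =>
      notMem_of_lt_hittingBtwn hv (Nat.succ_le_succ huv) (sub_eq_zero.2 heq)
    rw [runMin_succ_of_ne hne]
    exact ih ((Nat.lt_succ_self v).trans hv)

theorem isStoppingTime_nextRecord {mΩ : MeasurableSpace Ω} {F : Filtration ℕ mΩ}
    (hg : ∀ s, Measurable[F s] (g s)) (u N : ℕ) :
    IsStoppingTime F fun ω => (nextRecord g u N ω : WithTop ℕ) :=
  Adapted.isStoppingTime_hittingBtwn (fun s => (hg s).sub (measurable_runMin hg s))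
    (measurableSet_singleton 0)

theorem measurableSet_nextRecord_eq {mΩ : MeasurableSpace Ω} {F : Filtration ℕ mΩ}
    (hg : ∀ s, Measurable[F s] (g s)) (u N w : ℕ) :
    MeasurableSet[F w] {ω | nextRecord g u N ω = w} := by
  simpa only [ENat.some_eq_natCast, Nat.cast_inj] using
    (isStoppingTime_nextRecord hg u N).measurableSet_eq w

theorem sum_Ico_eq_add_sum_indicator_nextRecord (f : ℕ → Ω → ℝ) (h : u < N) (ω : Ω) :
    ∑ v ∈ Finset.Ico u N, f v ω = ∑ v ∈ Finset.Ico u (nextRecord g u N ω), f v ω +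
      ∑ w ∈ Finset.Ioc u N, Set.indicator {ω | nextRecord g u N ω = w}
        (fun ω => ∑ v ∈ Finset.Ico w N, f v ω) ω := by
  have hmem : nextRecord g u N ω ∈ Finset.Ioc u N :=
    Finset.mem_Ioc.2 ⟨lt_nextRecord h ω, nextRecord_le ω⟩
  simp only [Set.indicator_apply, Set.mem_ofPred_eq]
  rw [Finset.sum_ite_eq _ _ fun w => ∑ v ∈ Finset.Ico w N, f v ω, if_pos hmem,
    Finset.sum_Ico_consecutive _ (lt_nextRecord h ω).le (nextRecord_le ω)]

end NextRecord

namespace DiscountedArm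

variable {Ω : Type*} {mΩ : MeasurableSpace Ω} {P : Measure Ω} {γ : ℕ → Ω → ℝ}

/-- The discounted excess of the reward over the running minimum of the index, the prevailing
charge. -/
noncomputable def excess (a : DiscountedArm P) (γ : ℕ → Ω → ℝ) (s : ℕ) (ω : Ω) : ℝ :=
  a.reward s ω - a.d s ω * runMin γ s ω

/-- The conditional expected total excess from the operation number `u` on. -/
noncomputable def potential (a : DiscountedArm P) (γ : ℕ → Ω → ℝ) (u : ℕ) : Ω → ℝ :=
  P[fun ω => ∑' v, a.excess γ (u + v) ω | a.F u]

theorem integrable_potential (a : DiscountedArm P) (γ : ℕ → Ω → ℝ) (u : ℕ) :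
    Integrable (a.potential γ u) P := integrable_condExp

theorem absSummable_sum_range_d_mul_X (a : DiscountedArm P) :
    AbsSummable P fun s ω => ∑ u ∈ Finset.range (s + 1), a.d s ω * |a.X u ω| := by
  have habs (s u : ℕ) (ω : Ω) : |a.d s ω * a.X u ω| = a.d s ω * |a.X u ω| := by
    rw [abs_mul, abs_of_pos (a.d_pos s ω)]
  have hXm (u : ℕ) : Measurable[a.F u] fun ω => |a.X u ω| :=
    continuous_abs.measurable.comp (a.measurable_X u)
  have hXi (u : ℕ) : Integrable (fun ω => a.d u ω * |a.X u ω|) P := by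
    simpa only [habs] using (a.absSummable_d_mul_X.integrable u).abs
  have hle {s u : ℕ} (hu : u ∈ Finset.range (s + 1)) : u + (s - u) = s :=
    Nat.add_sub_cancel' (Nat.le_of_lt_succ (Finset.mem_range.1 hu))
  have hi (s : ℕ) : ∀ u ∈ Finset.range (s + 1), Integrable (fun ω => a.d s ω * |a.X u ω|) P := by
    intro u hu
    simpa only [hle hu] using a.integrable_d_add_mul (hXm u) (hXi u) (s - u)
  have hint (s : ℕ) : ∫ ω, ∑ u ∈ Finset.range (s + 1), a.d s ω * |a.X u ω| ∂P =
      ∑ u ∈ Finset.range (s + 1), (∫ ω, |a.d u ω * a.X u ω| ∂P) * a.β ^ (s - u) := by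
    rw [integral_finsetSum _ (hi s)]
    refine Finset.sum_congr rfl fun u hu => ?_
    have hmul := a.integral_d_add_mul (hXm u) (hXi u) (s - u)
    rw [hle hu] at hmul
    simp only [hmul, habs]
    exact mul_comm _ _
  have hX := a.absSummable_d_mul_X.summable_integral_abs
  have hβ := summable_geometric_of_lt_one a.β_nonneg a.β_lt_one
  refine AbsSummable.of_summable_integral (fun s => (integrable_finsetSum _ (hi s)).1)
    (fun s => integrable_finsetSum _ (hi s)) (fun s => .of_forall fun ω => ?_) ?_
  · exact (abs_of_nonneg (Finset.sum_nonneg fun u _ =>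
      mul_nonneg (a.d_pos s ω).le (abs_nonneg _))).le
  · simpa only [hint] using summable_sum_mul_range_of_summable_norm' hX.norm hX hβ.norm hβ

variable {a : DiscountedArm P}

namespace IsIndex

theorem measurable_runMin (hγ : a.IsIndex γ) (s : ℕ) : Measurable[a.F s] (runMin γ s) :=
  _root_.measurable_runMin (fun s => (hγ s).1) s

theorem stronglyMeasurable_excess (hγ : a.IsIndex γ) (s : ℕ) :
    StronglyMeasurable[a.F s] (a.excess γ s) :=
  ((a.stronglyMeasurable_reward s).measurable.sub ((a.measurable_d s).mul
    (hγ.measurable_runMin s))).stronglyMeasurable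

variable [IsFiniteMeasure P]

theorem abs_runMin_le (hγ : a.IsIndex γ) (s : ℕ) :
    ∀ᵐ ω ∂P, |runMin γ s ω| ≤ a.absReward 0 ω + ∑ u ∈ Finset.range (s + 1), |a.X u ω| := by
  filter_upwards [hγ.abs_mul_le 0, ae_all_iff.2 hγ.reward_le] with ω hγ₀ hX
  rw [a.d_zero, one_mul] at hγ₀
  have hreward : 0 ≤ a.absReward 0 ω := (abs_nonneg _).trans hγ₀
  have hsum : 0 ≤ ∑ u ∈ Finset.range (s + 1), |a.X u ω| :=
    Finset.sum_nonneg fun u _ => abs_nonneg _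
  refine abs_le.2 ⟨le_runMin fun u hu => ?_, ?_⟩
  · have hterm : |a.X u ω| ≤ ∑ u ∈ Finset.range (s + 1), |a.X u ω| :=
      Finset.single_le_sum (f := fun u => |a.X u ω|) (fun u _ => abs_nonneg _)
        (Finset.mem_range.2 (Nat.lt_succ_of_le hu))
    linarith [hX u, neg_abs_le (a.X u ω)]
  · linarith [runMin_le (g := γ) (Nat.zero_le s) ω, le_abs_self (γ 0 ω)]

theorem absSummable_runMin (hγ : a.IsIndex γ) :
    AbsSummable P fun s ω => a.d s ω * runMin γ s ω := by
  have hm (s : ℕ) : Measurable fun ω => a.d s ω * runMin γ s ω :=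
    ((a.measurable_d s).mul (hγ.measurable_runMin s)).mono (a.F.le s) le_rfl
  have hi : Integrable (fun ω => a.d 0 ω * a.absReward 0 ω) P := by
    simp only [a.d_zero, one_mul]
    exact integrable_condExp
  have hbound : AbsSummable P fun s ω => a.d s ω * a.absReward 0 ω +
      ∑ u ∈ Finset.range (s + 1), a.d s ω * |a.X u ω| := by
    simpa only [zero_add] using (a.absSummable_d_add_mul (a.measurable_absReward 0) hi).add
      a.absSummable_sum_range_d_mul_X
  refine hbound.mono (fun s => (hm s).aestronglyMeasurable) fun s => ?_
  filter_upwards [hγ.abs_runMin_le s] with ω hle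
  rw [abs_mul, abs_of_pos (a.d_pos s ω), ← Finset.mul_sum, ← mul_add]
  exact (mul_le_mul_of_nonneg_left hle (a.d_pos s ω).le).trans (le_abs_self _)

theorem absSummable_excess (hγ : a.IsIndex γ) : AbsSummable P (a.excess γ) :=
  a.absSummable_reward.sub hγ.absSummable_runMin

theorem integrable_tsum_excess (hγ : a.IsIndex γ) (u : ℕ) :
    Integrable (fun ω => ∑' v, a.excess γ (u + v) ω) P :=
  (hγ.absSummable_excess.comp_add_left u).integrable_tsum

-- Until the next record the prevailing charge is the index at the last one, which no stopping time
-- can beat.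
theorem setIntegral_sum_Ico_nextRecord_excess_nonpos (hγ : a.IsIndex γ) {u N : ℕ} (huN : u < N)
    {A : Set Ω} (hA : MeasurableSet[a.F u] A) (hrec : ∀ ω ∈ A, γ u ω = runMin γ u ω) :
    ∫ ω in A, ∑ v ∈ Finset.Ico u (nextRecord γ u N ω), a.excess γ v ω ∂P ≤ 0 := by
  have hτ : (fun ω => (nextRecord γ u N ω : WithTop ℕ)) ∈ a.stopsAfter u :=
    ⟨isStoppingTime_nextRecord (fun s => (hγ s).1) u N,
      fun ω => WithTop.coe_lt_coe.2 (lt_nextRecord huN ω)⟩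
  refine (setIntegral_congr_fun (a.F.le u _ hA) fun ω hω => ?_).trans_le
    (hγ.setIntegral_blockSum_le hτ hA)
  simp only [blockSum_coe, Finset.mul_sum, ← Finset.sum_sub_distrib]
  refine Finset.sum_congr rfl fun v hv => ?_
  obtain ⟨huv, hv⟩ := Finset.mem_Ico.1 hv
  rw [excess, runMin_eq_of_lt_nextRecord (hrec ω hω) huv hv, mul_comm (γ u ω)]

theorem setIntegral_sum_Ico_excess_nonpos (hγ : a.IsIndex γ) (u N : ℕ) {A : Set Ω}
    (hA : MeasurableSet[a.F u] A) (hrec : ∀ ω ∈ A, γ u ω = runMin γ u ω) :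
    ∫ ω in A, ∑ v ∈ Finset.Ico u N, a.excess γ v ω ∂P ≤ 0 := by
  have hγm (s : ℕ) : Measurable[a.F s] (γ s) := (hγ s).1
  induction hk : N - u using Nat.strong_induction_on generalizing u A with
  | _ k ih =>
    subst hk
    rcases Nat.lt_or_ge u N with huN | huN
    swap
    · simp [Finset.Ico_eq_empty_of_le huN]
    have hm (w : ℕ) : MeasurableSet {ω | nextRecord γ u N ω = w} :=
      a.F.le w _ (measurableSet_nextRecord_eq hγm u N w)
    have hi (w : ℕ) : Integrable (Set.indicator {ω | nextRecord γ u N ω = w}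
        fun ω => ∑ v ∈ Finset.Ico w N, a.excess γ v ω) P :=
      (integrable_finsetSum _ fun v _ => hγ.absSummable_excess.integrable v).indicator (hm w)
    have hi_next : Integrable (fun ω => ∑ v ∈ Finset.Ico u (nextRecord γ u N ω),
        a.excess γ v ω) P :=
      (integrable_blockSum hγ.absSummable_excess (isStoppingTime_nextRecord hγm u N) u).congr
        (.of_forall fun ω => blockSum_coe u _ _ ω)
    simp only [sum_Ico_eq_add_sum_indicator_nextRecord (g := γ) _ huN]
    rw [integral_add hi_next.integrableOn
      (integrable_finsetSum _ fun w _ => (hi w).integrableOn),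
      integral_finsetSum _ fun w _ => (hi w).integrableOn]
    refine add_nonpos (hγ.setIntegral_sum_Ico_nextRecord_excess_nonpos huN hA hrec)
      (Finset.sum_nonpos fun w hw => ?_)
    obtain ⟨huw, hwN⟩ := Finset.mem_Ioc.1 hw
    rw [setIntegral_indicator (hm w)]
    rcases hwN.eq_or_lt with rfl | hwN
    · simp
    · exact ih (N - w) (by omega) w
        ((a.F.mono huw.le _ hA).inter (measurableSet_nextRecord_eq hγm u N w))
        (fun ω hω => eq_runMin_of_nextRecord_eq hwN hω.2) rfl

theorem setIntegral_tsum_excess_nonpos (hγ : a.IsIndex γ) (u : ℕ) {A : Set Ω}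
    (hA : MeasurableSet[a.F u] A) (hrec : ∀ ω ∈ A, γ u ω = runMin γ u ω) :
    ∫ ω in A, ∑' v, a.excess γ (u + v) ω ∂P ≤ 0 := by
  refine le_of_tendsto' ((hγ.absSummable_excess.comp_add_left u).hasSum_setIntegral
    A).tendsto_sum_nat fun n => ?_
  have hsum := hγ.setIntegral_sum_Ico_excess_nonpos u (u + n) hA hrec
  rwa [integral_finsetSum _ fun v _ => (hγ.absSummable_excess.integrable v).integrableOn,
    Finset.sum_Ico_eq_sum_range, Nat.add_sub_cancel_left] at hsum

theorem condExp_blockSum_excess_le (hγ : a.IsIndex γ) {u : ℕ} {τ : Ω → WithTop ℕ}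
    (hτ : τ ∈ a.stopsAfter u) : ∀ᵐ ω ∂P, (P[blockSum u τ (a.excess γ) | a.F u]) ω ≤
      a.excess γ u ω + (P[snellEnvelope P a.F (a.excess γ) (u + 1) | a.F u]) ω := by
  have hY := hγ.absSummable_excess
  have hYm := hγ.stronglyMeasurable_excess
  have hi := integrable_snellEnvelope hY hYm (u + 1)
  refine condExp_le_of_forall_setIntegral_le (a.F.le u) (integrable_blockSum hY hτ.1 u)
    ((hY.integrable u).add integrable_condExp) ((hYm u).add stronglyMeasurable_condExp)
    fun A hA => (_root_.setIntegral_blockSum_le hY hYm hτ.1 hτ.2 hA).trans_eq ?_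
  rw [integral_add (hY.integrable u).integrableOn hi.integrableOn,
    ← setIntegral_condExp (a.F.le u) hi hA,
    ← integral_add (hY.integrable u).integrableOn integrable_condExp.integrableOn]

-- The prevailing charge at `u` is at most the index, so some stopping rule earns at least the
-- charge; keeping the charge fixed only costs more than letting it fall.
theorem excess_add_condExp_snellEnvelope_nonneg (hγ : a.IsIndex γ) (u : ℕ) : ∀ᵐ ω ∂P,
    0 ≤ a.excess γ u ω + (P[snellEnvelope P a.F (a.excess γ) (u + 1) | a.F u]) ω := by
  refine hγ.nonneg_of_forall_expReward_le (M := runMin γ u)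
    (.of_forall fun ω => runMin_le le_rfl ω) ((hγ.stronglyMeasurable_excess u).add
      stronglyMeasurable_condExp).measurable fun τ hτ => ?_
  have hi_reward := integrable_blockSum_reward hτ
  have hi_charge := integrable_mul_blockSum_d (hγ.measurable_runMin u)
    (hγ.absSummable_runMin.integrable u) hτ
  have hle : ∀ᵐ ω ∂P, blockSum u τ a.reward ω - runMin γ u ω * blockSum u τ a.d ω ≤
      blockSum u τ (a.excess γ) ω := by
    filter_upwards [a.absSummable_reward.ae_summable, a.absSummable_d.ae_summable,
      hγ.absSummable_runMin.ae_summable] with ω hreward hd hcharge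
    exact blockSum_sub_mul_le hreward hd hcharge (fun v => (a.d_pos v ω).le)
      (fun v hv => runMin_antitone γ ω hv) τ
  filter_upwards [hγ.condExp_blockSum_excess_le hτ,
    condExp_mono (m := a.F u) (hi_reward.sub hi_charge)
      (integrable_blockSum hγ.absSummable_excess hτ.1 u) hle,
    condExp_sub hi_reward hi_charge (a.F u), condExp_mul_blockSum_d (hγ.measurable_runMin u)
      (hγ.absSummable_runMin.integrable u) hτ] with ω hsnell hmono hsub hmul
  rw [Pi.sub_apply, hmul] at hsub
  exact (hsub.symm.le.trans hmono).trans hsnell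

theorem potential_nonneg (hγ : a.IsIndex γ) (u : ℕ) : 0 ≤ᵐ[P] a.potential γ u := by
  have hneg : P[fun ω => -∑' v, a.excess γ (u + v) ω | a.F u] ≤ᵐ[P] 0 := by
    refine condExp_le_of_forall_setIntegral_le (a.F.le u) (hγ.integrable_tsum_excess u).neg
      (integrable_zero _ _ _) stronglyMeasurable_zero fun A hA => ?_
    simpa [integral_neg] using setIntegral_tsum_add_nonneg_of_snell hγ.absSummable_excess
      hγ.stronglyMeasurable_excess hγ.excess_add_condExp_snellEnvelope_nonneg hA
  filter_upwards [hneg, condExp_neg (μ := P) (fun ω => ∑' v, a.excess γ (u + v) ω) (a.F u)]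
    with ω hle heq
  exact neg_nonpos.1 (heq.symm.le.trans hle)

theorem potential_eq_zero (hγ : a.IsIndex γ) (u : ℕ) :
    ∀ᵐ ω ∂P, γ u ω = runMin γ u ω → a.potential γ u ω = 0 := by
  have hrec : MeasurableSet[a.F u] {ω | γ u ω = runMin γ u ω} :=
    measurableSet_eq_fun (hγ u).1 (hγ.measurable_runMin u)
  have hi := hγ.integrable_tsum_excess u
  have hnonpos : P[Set.indicator {ω | γ u ω = runMin γ u ω}
      (fun ω => ∑' v, a.excess γ (u + v) ω) | a.F u] ≤ᵐ[P] 0 := by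
    refine condExp_le_of_forall_setIntegral_le (a.F.le u) (hi.indicator (a.F.le u _ hrec))
      (integrable_zero _ _ _) stronglyMeasurable_zero fun A hA => ?_
    rw [setIntegral_indicator (a.F.le u _ hrec)]
    refine (hγ.setIntegral_tsum_excess_nonpos u (hA.inter hrec) fun ω hω => hω.2).trans ?_
    simp
  filter_upwards [hnonpos, condExp_indicator hi hrec, hγ.potential_nonneg u]
    with ω hle heq hnonneg hω
  rw [Set.indicator_of_mem (show ω ∈ {ω | γ u ω = runMin γ u ω} from hω)] at heq
  exact le_antisymm (heq.symm.le.trans hle) hnonneg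

theorem potential_eq_add (hγ : a.IsIndex γ) (u : ℕ) :
    a.potential γ u =ᵐ[P] fun ω => a.excess γ u ω + (P[a.potential γ (u + 1) | a.F u]) ω :=
  condExp_tsum_add_eq hγ.absSummable_excess hγ.stronglyMeasurable_excess u

theorem tendsto_integral_potential (hγ : a.IsIndex γ) :
    Tendsto (fun n => ∫ ω, a.potential γ n ω ∂P) atTop (nhds 0) := by
  refine (tendsto_setIntegral_tsum_add hγ.absSummable_excess Set.univ).congr fun n => ?_
  rw [setIntegral_univ]
  exact (integral_condExp (a.F.le n)).symm

end IsIndex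

end DiscountedArm

namespace DiscountedArm

variable {Ω : Type*} {H mΩ : MeasurableSpace Ω} {P : Measure Ω} {a : DiscountedArm P}
  {γ R U Z : ℕ → Ω → ℝ} {c : ℝ}

/-- Weights in `[0, 1]`, the one of each operation being known at its onset from the arm and from
information `H` independent of the arm. They stand for the delays that other arms cause. -/
structure IsWeight (a : DiscountedArm P) (H : MeasurableSpace Ω) (R : ℕ → Ω → ℝ) : Prop where
  le : H ≤ mΩ
  indep : Indep (⨆ s, (a.F s : MeasurableSpace Ω)) H P
  stronglyMeasurable : ∀ s, StronglyMeasurable[a.F s ⊔ H] (R s)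
  nonneg : ∀ s ω, 0 ≤ R s ω
  le_one : ∀ s, ∀ᵐ ω ∂P, R s ω ≤ 1

/-- Uniformly bounded factors, determined by the whole arm, each of conditional mean `c` at the
onset of the operation. They stand for the discounted durations of the operations. -/
structure HasCondMean (a : DiscountedArm P) (U : ℕ → Ω → ℝ) (c : ℝ) : Prop where
  stronglyMeasurable : ∀ s, StronglyMeasurable[⨆ s, (a.F s : MeasurableSpace Ω)] (U s)
  exists_bound : ∃ C, ∀ s, ∀ᵐ ω ∂P, |U s ω| ≤ C
  condExp_eq : ∀ s, P[U s | a.F s] =ᵐ[P] fun _ => c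

namespace IsWeight

theorem aestronglyMeasurable (hR : a.IsWeight H R) (s : ℕ) : AEStronglyMeasurable (R s) P :=
  ((hR.stronglyMeasurable s).mono (sup_le (a.F.le s) hR.le)).aestronglyMeasurable

theorem integrable_mul (hR : a.IsWeight H R) (s : ℕ) {f : Ω → ℝ} (hf : Integrable f P) :
    Integrable (fun ω => R s ω * f ω) P :=
  hf.bdd_mul (c := 1) (hR.aestronglyMeasurable s)
    ((hR.le_one s).mono fun ω hω => by rwa [Real.norm_of_nonneg (hR.nonneg s ω)])

theorem absSummable_mul (hR : a.IsWeight H R) (hU : a.HasCondMean U c) (hZ : AbsSummable P Z) :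
    AbsSummable P fun s ω => R s ω * (Z s ω * U s ω) := by
  obtain ⟨C, hC⟩ := hU.exists_bound
  refine AbsSummable.of_summable_integral (b := fun s ω => |Z s ω| * C) (fun s => ?_)
    (fun s => (hZ.integrable s).abs.mul_const C) (fun s => ?_) ?_
  · exact (hR.aestronglyMeasurable s).mul ((hZ.1 s).mul
      ((hU.stronglyMeasurable s).mono (iSup_le a.F.le)).aestronglyMeasurable)
  · filter_upwards [hC s, hR.le_one s] with ω hU_le hR_le
    rw [abs_mul, abs_mul, abs_of_nonneg (hR.nonneg s ω)]
    calc R s ω * (|Z s ω| * |U s ω|) ≤ 1 * (|Z s ω| * |U s ω|) := by gcongr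
      _ ≤ |Z s ω| * C := by rw [one_mul]; gcongr
  · simp only [integral_mul_const]
    exact hZ.summable_integral_abs.mul_right C

variable [IsProbabilityMeasure P]

theorem integral_mul_condExp (hR : a.IsWeight H R) (s : ℕ) {f : Ω → ℝ}
    (hf : StronglyMeasurable[⨆ s, (a.F s : MeasurableSpace Ω)] f) (hfi : Integrable f P) :
    ∫ ω, R s ω * (P[f | a.F s]) ω ∂P = ∫ ω, R s ω * f ω ∂P :=
  integral_mul_condExp_of_indep (le_iSup (fun s => (a.F s : MeasurableSpace Ω)) s)
    (iSup_le a.F.le) hR.le hR.indep hf hfi (hR.stronglyMeasurable s) (hR.integrable_mul s hfi)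

end IsWeight

namespace IsIndex

variable [IsProbabilityMeasure P]

theorem integral_weight_mul_excess (hγ : a.IsIndex γ) (hR : a.IsWeight H R) (s : ℕ) :
    ∫ ω, R s ω * a.excess γ s ω ∂P =
      ∫ ω, R s ω * a.potential γ s ω ∂P - ∫ ω, R s ω * a.potential γ (s + 1) ω ∂P := by
  have hm : StronglyMeasurable[⨆ s, (a.F s : MeasurableSpace Ω)] (a.potential γ (s + 1)) :=
    (stronglyMeasurable_condExp (m := a.F (s + 1))).mono
      (le_iSup (fun s => (a.F s : MeasurableSpace Ω)) (s + 1))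
  rw [← hR.integral_mul_condExp s hm (a.integrable_potential γ _),
    ← integral_sub (hR.integrable_mul s (a.integrable_potential γ s))
      (hR.integrable_mul s integrable_condExp)]
  refine integral_congr_ae ?_
  filter_upwards [hγ.potential_eq_add s] with ω hω
  rw [hω]
  ring

theorem integral_mul_potential_zero (hγ : a.IsIndex γ) (f : Ω → ℝ) :
    ∫ ω, f ω * a.potential γ 0 ω ∂P = 0 := by
  refine integral_eq_zero_of_ae ?_
  filter_upwards [hγ.potential_eq_zero 0] with ω hω
  rw [hω (by simp [runMin]), mul_zero, Pi.zero_apply]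

-- Summation by parts, using that the potential vanishes at the start.
theorem sum_integral_weight_mul_excess (hγ : a.IsIndex γ) (hR : a.IsWeight H R) (n : ℕ) :
    ∑ s ∈ Finset.range n, ∫ ω, R s ω * a.excess γ s ω ∂P =
      -∫ ω, R n ω * a.potential γ n ω ∂P -
        ∑ s ∈ Finset.range n, ∫ ω, (R s ω - R (s + 1) ω) * a.potential γ (s + 1) ω ∂P := by
  induction n with
  | zero => simp [hγ.integral_mul_potential_zero]
  | succ n ih =>
    rw [Finset.sum_range_succ, Finset.sum_range_succ, ih, hγ.integral_weight_mul_excess hR]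
    simp only [sub_mul]
    rw [integral_sub (hR.integrable_mul n (a.integrable_potential γ (n + 1)))
      (hR.integrable_mul (n + 1) (a.integrable_potential γ (n + 1)))]
    ring

theorem integral_weight_mul_excess_mul (hγ : a.IsIndex γ) (hR : a.IsWeight H R)
    (hU : a.HasCondMean U c) (s : ℕ) :
    ∫ ω, R s ω * (a.excess γ s ω * U s ω) ∂P = c * ∫ ω, R s ω * a.excess γ s ω ∂P := by
  obtain ⟨C, hC⟩ := hU.exists_bound
  have hi : Integrable (U s) P := .of_bound
    ((hU.stronglyMeasurable s).mono (iSup_le a.F.le)).aestronglyMeasurable C (hC s)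
  have hi_mul : Integrable (a.excess γ s * U s) P :=
    (hγ.absSummable_excess.integrable s).mul_bdd (c := C) hi.1 (hC s)
  have hm : StronglyMeasurable[⨆ s, (a.F s : MeasurableSpace Ω)] (a.excess γ s * U s) :=
    ((hγ.stronglyMeasurable_excess s).mono
      (le_iSup (fun s => (a.F s : MeasurableSpace Ω)) s)).mul (hU.stronglyMeasurable s)
  have hcond : P[a.excess γ s * U s | a.F s] =ᵐ[P] fun ω => a.excess γ s ω * c := by
    filter_upwards [condExp_mul_of_stronglyMeasurable_left (hγ.stronglyMeasurable_excess s)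
      hi_mul hi, hU.condExp_eq s] with ω hmul hmean
    rw [hmul, Pi.mul_apply, hmean]
  refine (hR.integral_mul_condExp s hm hi_mul).symm.trans ?_
  rw [← integral_const_mul]
  refine integral_congr_ae ?_
  filter_upwards [hcond] with ω hω
  rw [hω]
  ring

theorem hasSum_integral_weight_mul_excess (hγ : a.IsIndex γ) (hR : a.IsWeight H R)
    (hU : a.HasCondMean U c) :
    HasSum (fun s => c * ∫ ω, R s ω * a.excess γ s ω ∂P)
      (∫ ω, ∑' s, R s ω * (a.excess γ s ω * U s ω) ∂P) := by
  simpa only [hγ.integral_weight_mul_excess_mul hR hU] using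
    (hR.absSummable_mul hU hγ.absSummable_excess).hasSum_integral

theorem integral_weight_mul_potential_nonneg (hγ : a.IsIndex γ) (hR : a.IsWeight H R) (n : ℕ) :
    0 ≤ ∫ ω, R n ω * a.potential γ n ω ∂P :=
  integral_nonneg_of_ae ((hγ.potential_nonneg n).mono fun ω hω => mul_nonneg (hR.nonneg n ω) hω)

theorem tendsto_integral_weight_mul_potential (hγ : a.IsIndex γ) (hR : a.IsWeight H R) :
    Tendsto (fun n => ∫ ω, R n ω * a.potential γ n ω ∂P) atTop (nhds 0) := by
  refine squeeze_zero (hγ.integral_weight_mul_potential_nonneg hR)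
    (fun n => integral_mono_ae (hR.integrable_mul n (a.integrable_potential γ n))
      (a.integrable_potential γ n) ?_) hγ.tendsto_integral_potential
  filter_upwards [hγ.potential_nonneg n, hR.le_one n] with ω hnonneg hle
  exact mul_le_of_le_one_left hnonneg hle

theorem integral_tsum_weight_mul_excess_nonpos (hγ : a.IsIndex γ) (hR : a.IsWeight H R)
    (hR_anti : ∀ s, ∀ᵐ ω ∂P, R (s + 1) ω ≤ R s ω) (hU : a.HasCondMean U c) (hc : 0 ≤ c) :
    ∫ ω, ∑' s, R s ω * (a.excess γ s ω * U s ω) ∂P ≤ 0 := by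
  refine le_of_tendsto' (hγ.hasSum_integral_weight_mul_excess hR hU).tendsto_sum_nat fun n => ?_
  rw [← Finset.mul_sum, hγ.sum_integral_weight_mul_excess hR]
  refine mul_nonpos_of_nonneg_of_nonpos hc (sub_nonpos.2
    ((neg_nonpos.2 (hγ.integral_weight_mul_potential_nonneg hR n)).trans ?_))
  refine Finset.sum_nonneg fun s _ => integral_nonneg_of_ae ?_
  filter_upwards [hγ.potential_nonneg (s + 1), hR_anti s] with ω hnonneg hle
  exact mul_nonneg (sub_nonneg.2 hle) hnonneg

theorem integral_tsum_weight_mul_excess_eq_zero (hγ : a.IsIndex γ) (hR : a.IsWeight H R)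
    (hU : a.HasCondMean U c)
    (hrec : ∀ s, ∀ᵐ ω ∂P, R s ω ≠ R (s + 1) ω → γ (s + 1) ω = runMin γ (s + 1) ω) :
    ∫ ω, ∑' s, R s ω * (a.excess γ s ω * U s ω) ∂P = 0 := by
  have hdrop (s : ℕ) : ∫ ω, (R s ω - R (s + 1) ω) * a.potential γ (s + 1) ω ∂P = 0 := by
    refine integral_eq_zero_of_ae ?_
    filter_upwards [hrec s, hγ.potential_eq_zero (s + 1)] with ω hω hpot
    by_cases h : R s ω = R (s + 1) ω
    · simp [h]
    · simp [hpot (hω h)]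
  refine tendsto_nhds_unique
    (hγ.hasSum_integral_weight_mul_excess hR hU).tendsto_sum_nat ?_
  simp only [← Finset.mul_sum, hγ.sum_integral_weight_mul_excess hR, hdrop,
    Finset.sum_const_zero, sub_zero]
  simpa only [neg_zero, mul_zero] using
    (hγ.tendsto_integral_weight_mul_potential hR).neg.const_mul c

end IsIndex

end DiscountedArm

section Rearrangement

/-- The integral of `exp (-q r)` over `[0, x]`. -/
noncomputable def discountedLength (q x : ℝ) : ℝ := (1 - Real.exp (-q * x)) / q

variable {q : ℝ}

theorem integral_exp_neg_mul (hq : q ≠ 0) (a b : ℝ) :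
    ∫ r in a..b, Real.exp (-q * r) = Real.exp (-q * a) * discountedLength q (b - a) := by
  rw [intervalIntegral.integral_comp_mul_left _ (neg_ne_zero.2 hq), integral_exp, smul_eq_mul,
    discountedLength, mul_sub (-q) b a, Real.exp_sub]
  field_simp
  ring

theorem discountedLength_zero (q : ℝ) : discountedLength q 0 = 0 := by simp [discountedLength]

theorem measurable_discountedLength (q : ℝ) : Measurable (discountedLength q) := by
  unfold discountedLength
  fun_prop

theorem discountedLength_add (q x w : ℝ) : discountedLength q (x + w) =
    discountedLength q x + Real.exp (-q * x) * discountedLength q w := by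
  unfold discountedLength
  rw [mul_add, Real.exp_add]
  ring

theorem discountedLength_strictMono (hq : 0 < q) : StrictMono (discountedLength q) := fun _ _ h =>
  div_lt_div_of_pos_right (sub_lt_sub_left
    (Real.exp_lt_exp.2 (mul_lt_mul_of_neg_left h (neg_neg_of_pos hq))) 1) hq

theorem discountedLength_nonneg (hq : 0 < q) {x : ℝ} (hx : 0 ≤ x) : 0 ≤ discountedLength q x :=
  (discountedLength_zero q).symm.trans_le ((discountedLength_strictMono hq).monotone hx)

theorem discountedLength_pos (hq : 0 < q) {x : ℝ} (hx : 0 < x) : 0 < discountedLength q x :=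
  (discountedLength_zero q).symm.trans_lt (discountedLength_strictMono hq hx)

theorem discountedLength_le (hq : 0 < q) (x : ℝ) : discountedLength q x ≤ 1 / q :=
  div_le_div_of_nonneg_right (sub_le_self 1 (Real.exp_pos _).le) hq.le

variable {ι : Type*} {v w : ι → ℝ} {p p' : ℕ → ι}

/-- The discounted duration of the job `p t` when the jobs `p 0, p 1, …` of durations `w` are run
in succession. -/
noncomputable def slot (q : ℝ) (w : ι → ℝ) (p : ℕ → ι) (t : ℕ) : ℝ :=
  Real.exp (-q * ∑ u ∈ Finset.range t, w (p u)) * discountedLength q (w (p t))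

theorem slot_nonneg (hq : 0 < q) (hw : ∀ x, 0 ≤ w x) (p : ℕ → ι) (t : ℕ) : 0 ≤ slot q w p t :=
  mul_nonneg (Real.exp_pos _).le (discountedLength_nonneg hq (hw _))

theorem sum_slot (q : ℝ) (w : ι → ℝ) (p : ℕ → ι) (N : ℕ) :
    ∑ t ∈ Finset.range N, slot q w p t = discountedLength q (∑ u ∈ Finset.range N, w (p u)) := by
  induction N with
  | zero => simp [discountedLength_zero]
  | succ N ih =>
    rw [Finset.sum_range_succ, ih, Finset.sum_range_succ, discountedLength_add]
    rfl

theorem sum_slot_filter_le (hq : 0 < q) (hw : ∀ x, 0 ≤ w x) (p : ℕ → ι) (S : ℕ → Prop)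
    [DecidablePred S] (N : ℕ) : ∑ t ∈ Finset.range N with S t, slot q w p t ≤
      discountedLength q (∑ t ∈ Finset.range N with S t, w (p t)) := by
  induction N with
  | zero => simp [discountedLength_zero]
  | succ N ih =>
    rw [Finset.range_add_one, Finset.filter_insert]
    split_ifs
    · rw [Finset.sum_insert (by simp), Finset.sum_insert (by simp), add_comm (w (p N)),
        discountedLength_add, add_comm]
      refine add_le_add ih (mul_le_mul_of_nonneg_right (Real.exp_le_exp.2 ?_)
        (discountedLength_nonneg hq (hw _)))
      exact mul_le_mul_of_nonpos_left (Finset.sum_le_sum_of_subset_of_nonneg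
        (Finset.filter_subset _ _) fun t _ _ => hw (p t)) (neg_nonpos.2 hq.le)
    · exact ih

theorem sum_slot_filter_mem_le [DecidableEq ι] (hq : 0 < q) (hw : ∀ x, 0 ≤ w x)
    (hp : Function.Injective p) (S : Finset ι) (N : ℕ) :
    ∑ t ∈ Finset.range N with p t ∈ S, slot q w p t ≤ discountedLength q (∑ x ∈ S, w x) := by
  refine (sum_slot_filter_le hq hw p _ N).trans ((discountedLength_strictMono hq).monotone ?_)
  rw [← Finset.sum_image (s := {t ∈ Finset.range N | p t ∈ S}) (f := w) hp.injOn]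
  refine Finset.sum_le_sum_of_subset_of_nonneg (fun x hx => ?_) fun x _ _ => hw x
  obtain ⟨t, ht, rfl⟩ := Finset.mem_image.1 hx
  exact (Finset.mem_filter.1 ht).2

theorem sum_sub_mul_discountedLength (q : ℝ) (w : ι → ℝ) (p : ℕ → ι) (α : ℕ → ℝ) (n : ℕ) :
    ∑ k ∈ Finset.range n, (α k - α (k + 1)) *
        discountedLength q (∑ u ∈ Finset.range (k + 1), w (p u)) =
      ∑ k ∈ Finset.range n, α k * slot q w p k -
        α n * discountedLength q (∑ u ∈ Finset.range n, w (p u)) := by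
  simp only [← sum_slot]
  induction n with
  | zero => simp
  | succ n ih =>
    rw [Finset.sum_range_succ, ih, Finset.sum_range_succ _ n, Finset.sum_range_succ _ n]
    ring

/-- Every job in the order `p` has the greatest rate among the jobs that were not run before. -/
def IsGreedy (v : ι → ℝ) (p : ℕ → ι) : Prop := ∀ t x, (∀ u < t, p u ≠ x) → v x ≤ v (p t)

namespace IsGreedy

theorem antitone (h : IsGreedy v p) (hp : Function.Injective p) : Antitone fun t => v (p t) :=
  fun s _ hst => h s _ fun _ hu => hp.ne (hu.trans_le hst).ne

theorem le_add_sum [DecidableEq ι] (h : IsGreedy v p) (n : ℕ) (x : ι) :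
    v x ≤ v (p n) + ∑ k ∈ Finset.range n,
      if x ∈ (Finset.range (k + 1)).image p then v (p k) - v (p (k + 1)) else 0 := by
  induction n with
  | zero => simpa using h 0 x
  | succ n ih =>
    by_cases hx : x ∈ (Finset.range (n + 1)).image p
    · rw [Finset.sum_range_succ, if_pos hx]
      linarith
    · have hne (u : ℕ) (hu : u < n + 1) : p u ≠ x := fun heq =>
        hx (Finset.mem_image.2 ⟨u, Finset.mem_range.2 hu, heq⟩)
      rw [Finset.sum_eq_zero, add_zero]
      · exact h (n + 1) x hne
      · intro k hk
        refine if_neg fun hmem => ?_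
        obtain ⟨u, hu, heq⟩ := Finset.mem_image.1 hmem
        exact hne u ((Finset.mem_range.1 hu).trans_le (Finset.mem_range.1 hk)) heq

theorem sum_mul_slot_le (h : IsGreedy v p') (hq : 0 < q) (hw : ∀ x, 0 ≤ w x)
    (hp : Function.Injective p) (hp' : Function.Injective p') (n N : ℕ) :
    ∑ t ∈ Finset.range N, v (p t) * slot q w p t ≤
      v (p' n) * discountedLength q (∑ u ∈ Finset.range N, w (p u)) +
        ∑ k ∈ Finset.range n, (v (p' k) - v (p' (k + 1))) *
          discountedLength q (∑ u ∈ Finset.range (k + 1), w (p' u)) := by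
  classical
  have hlayers : ∑ t ∈ Finset.range N, v (p t) * slot q w p t ≤
      ∑ t ∈ Finset.range N, (v (p' n) * slot q w p t + ∑ k ∈ Finset.range n,
        if p t ∈ (Finset.range (k + 1)).image p' then
          (v (p' k) - v (p' (k + 1))) * slot q w p t else 0) := by
    refine Finset.sum_le_sum fun t _ => (mul_le_mul_of_nonneg_right (h.le_add_sum n (p t))
      (slot_nonneg hq hw p t)).trans_eq ?_
    simp only [add_mul, Finset.sum_mul, ite_mul, zero_mul]
  refine hlayers.trans ?_
  rw [Finset.sum_add_distrib, ← Finset.mul_sum, sum_slot, Finset.sum_comm]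
  refine add_le_add_right (Finset.sum_le_sum fun k _ => ?_) _
  rw [← Finset.sum_filter, ← Finset.mul_sum, ← Finset.sum_image (f := w) hp'.injOn]
  exact mul_le_mul_of_nonneg_left (sum_slot_filter_mem_le hq hw hp _ N)
    (sub_nonneg.2 (h.antitone hp' (Nat.le_succ k)))

theorem tsum_mul_slot_le_sum_add (h : IsGreedy v p') (hq : 0 < q) (hw : ∀ x, 0 ≤ w x)
    (hp : Function.Injective p) (hp' : Function.Injective p')
    (hlim : Tendsto (fun n => Real.exp (-q * ∑ u ∈ Finset.range n, w (p u))) atTop (nhds 0))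
    (hs : Summable fun t => v (p t) * slot q w p t) (n : ℕ) :
    ∑' t, v (p t) * slot q w p t ≤ ∑ k ∈ Finset.range n, v (p' k) * slot q w p' k +
      v (p' n) * (Real.exp (-q * ∑ u ∈ Finset.range n, w (p' u)) / q) := by
  have hlength : Tendsto (fun N => discountedLength q (∑ u ∈ Finset.range N, w (p u))) atTop
      (nhds (1 / q)) := by
    simpa only [discountedLength, sub_zero] using (hlim.const_sub 1).div_const q
  refine (le_of_tendsto_of_tendsto' hs.hasSum.tendsto_sum_nat
    ((hlength.const_mul (v (p' n))).add_const _)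
    (h.sum_mul_slot_le hq hw hp hp' n)).trans_eq ?_
  rw [sum_sub_mul_discountedLength q w p' (fun k => v (p' k)), discountedLength]
  ring

theorem tsum_mul_slot_le (h : IsGreedy v p') (hq : 0 < q) (hw : ∀ x, 0 ≤ w x)
    (hp : Function.Injective p) (hp' : Function.Injective p')
    (hlim : Tendsto (fun n => Real.exp (-q * ∑ u ∈ Finset.range n, w (p u))) atTop (nhds 0))
    (hlim' : Tendsto (fun n => Real.exp (-q * ∑ u ∈ Finset.range n, w (p' u))) atTop (nhds 0))
    (hs : Summable fun t => v (p t) * slot q w p t)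
    (hs' : Summable fun t => v (p' t) * slot q w p' t) :
    ∑' t, v (p t) * slot q w p t ≤ ∑' t, v (p' t) * slot q w p' t := by
  have hupper := hs'.hasSum.tendsto_sum_nat.add
    ((hlim'.div_const q).const_mul (max (v (p' 0)) 0))
  simp only [zero_div, mul_zero, add_zero] at hupper
  refine ge_of_tendsto' hupper fun n => (h.tsum_mul_slot_le_sum_add hq hw hp hp' hlim hs n).trans ?_
  gcongr
  exact (h.antitone hp' (Nat.zero_le n)).trans (le_max_left _ _)

end IsGreedy

end Rearrangement

section Complete

variable {Ω : Type*} {m mΩ : MeasurableSpace Ω} {P : Measure Ω}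

theorem measurableSet_of_ae_eq (hm : ∀ N, P N = 0 → MeasurableSet[m] N) {A A' : Set Ω}
    (hA' : MeasurableSet[m] A') (h : A =ᵐ[P] A') : MeasurableSet[m] A := by
  obtain ⟨hdiff, hdiff'⟩ := ae_eq_set.1 h
  have hA : A = A' \ (A' \ A) ∪ A \ A' := by
    rw [Set.sdiff_sdiff_right_self, Set.inter_comm, Set.inter_union_sdiff]
  rw [hA]
  exact (hA'.diff (hm _ hdiff')).union (hm _ hdiff)

theorem measurable_of_ae_eq {β : Type*} [MeasurableSpace β] (hm : ∀ N, P N = 0 → MeasurableSet[m] N)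
    {g g' : Ω → β} (hg' : Measurable[m] g') (h : g =ᵐ[P] g') : Measurable[m] g := fun _ hA =>
  measurableSet_of_ae_eq hm (hg' hA) (h.preimage _)

end Complete

namespace RenewalBandit

variable {Ω : Type*} {mΩ : MeasurableSpace Ω} {P : Measure Ω} {J : ℕ} (B : RenewalBandit P J)
  {q : ℝ}

theorem measurable_W_ambient (j : Fin J) (s : ℕ) : Measurable (B.W j s) :=
  (B.measurable_W j s).mono ((B.F j).le _) le_rfl

theorem measurable_T (j : Fin J) (s : ℕ) : Measurable[B.F j s] (B.T j s) :=
  Finset.measurable_sum (m := B.F j s) _ fun u hu =>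
    (B.measurable_W j u).mono ((B.F j).mono (Finset.mem_range.1 hu)) le_rfl

/-- The discount factor `exp (-q T j s)`. -/
noncomputable def discount (q : ℝ) (j : Fin J) (s : ℕ) (ω : Ω) : ℝ := Real.exp (-q * B.T j s ω)

/-- The duration of the operation number `s` of arm `j`, discounted to its onset. -/
noncomputable def activeTime (q : ℝ) (j : Fin J) (s : ℕ) (ω : Ω) : ℝ :=
  discountedLength q (B.W j s ω)

theorem discount_pos (q : ℝ) (j : Fin J) (s : ℕ) (ω : Ω) : 0 < B.discount q j s ω :=
  Real.exp_pos _

theorem discount_succ (j : Fin J) (s : ℕ) (ω : Ω) :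
    B.discount q j (s + 1) ω = B.discount q j s ω * Real.exp (-q * B.W j s ω) := by
  simp only [discount, T, Finset.sum_range_succ, mul_add, Real.exp_add]

theorem integral_exp_neg_mul_T (hq : q ≠ 0) (j : Fin J) (s : ℕ) (ω : Ω) :
    ∫ r in (B.T j s ω)..(B.T j (s + 1) ω), Real.exp (-q * r) =
      B.discount q j s ω * B.activeTime q j s ω := by
  rw [integral_exp_neg_mul hq, T, T, Finset.sum_range_succ_sub_sum]
  rfl

theorem measurable_discount (j : Fin J) (s : ℕ) : Measurable[B.F j s] (B.discount q j s) :=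
  Real.measurable_exp.comp ((B.measurable_T j s).const_mul (-q))

theorem measurable_activeTime (j : Fin J) (s : ℕ) :
    Measurable[B.F j (s + 1)] (B.activeTime q j s) :=
  (measurable_discountedLength q).comp (B.measurable_W j s)

theorem ae_abs_activeTime_le (hq : 0 < q) (j : Fin J) (s : ℕ) :
    ∀ᵐ ω ∂P, |B.activeTime q j s ω| ≤ 1 / q := by
  filter_upwards [B.pos_W j s] with ω hω
  exact (abs_of_nonneg (discountedLength_nonneg hq hω.le)).trans_le (discountedLength_le hq _)

theorem ae_exp_neg_mul_W_lt_one (hq : 0 < q) (j : Fin J) (s : ℕ) :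
    ∀ᵐ ω ∂P, Real.exp (-q * B.W j s ω) < 1 := by
  filter_upwards [B.pos_W j s] with ω hω
  exact Real.exp_lt_one_iff.2 (mul_neg_of_neg_of_pos (neg_neg_of_pos hq) hω)

theorem ae_norm_exp_neg_mul_W_le_one (hq : 0 < q) (j : Fin J) (s : ℕ) :
    ∀ᵐ ω ∂P, ‖Real.exp (-q * B.W j s ω)‖ ≤ 1 := by
  filter_upwards [B.ae_exp_neg_mul_W_lt_one hq j s] with ω hω
  exact (Real.norm_of_nonneg (Real.exp_pos _).le).trans_le hω.le

theorem aestronglyMeasurable_exp_neg_mul_W (q : ℝ) (j : Fin J) (s : ℕ) :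
    AEStronglyMeasurable (fun ω => Real.exp (-q * B.W j s ω)) P :=
  (Real.measurable_exp.comp ((B.measurable_W_ambient j s).const_mul (-q))).aestronglyMeasurable

theorem integrable_discount_succ_mul (hq : 0 < q) (j : Fin J) (s : ℕ) {Z : Ω → ℝ}
    (hZ : Integrable (fun ω => B.discount q j s ω * Z ω) P) :
    Integrable (fun ω => B.discount q j (s + 1) ω * Z ω) P := by
  simp only [discount_succ, mul_right_comm]
  exact hZ.mul_bdd (c := 1) (B.aestronglyMeasurable_exp_neg_mul_W q j s)
    (B.ae_norm_exp_neg_mul_W_le_one hq j s)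

theorem lintegral_activeTime_ne_zero [NeZero P] (hq : 0 < q) (j : Fin J) (s : ℕ) :
    ∫⁻ ω, ENNReal.ofReal (B.activeTime q j s ω) ∂P ≠ 0 := by
  intro h
  have hm : Measurable (B.activeTime q j s) :=
    (B.measurable_activeTime j s).mono ((B.F j).le _) le_rfl
  rw [lintegral_eq_zero_iff hm.ennreal_ofReal] at h
  obtain ⟨ω, hzero, hpos⟩ := (h.and (B.pos_W j s)).exists
  exact (ENNReal.ofReal_pos.2 (discountedLength_pos hq hpos)).ne' hzero

theorem lintegral_abs_X_mul_integral (hq : q ≠ 0) (j : Fin J) (s : ℕ) :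
    ∫⁻ ω, ENNReal.ofReal (|B.X j s ω| *
        ∫ r in (B.T j s ω)..(B.T j (s + 1) ω), Real.exp (-q * r)) ∂P =
      (∫⁻ ω, ‖B.discount q j s ω * B.X j s ω‖ₑ ∂P) *
        ∫⁻ ω, ENNReal.ofReal (B.activeTime q j 0 ω) ∂P := by
  have hlength : Measurable fun w => ENNReal.ofReal (discountedLength q w) :=
    (measurable_discountedLength q).ennreal_ofReal
  have hdX : Measurable[B.F j s] fun ω => ‖B.discount q j s ω * B.X j s ω‖ₑ :=
    measurable_enorm.comp ((B.measurable_discount j s).mul (B.measurable_X j s))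
  calc _ = ∫⁻ ω, ‖B.discount q j s ω * B.X j s ω‖ₑ *
          ENNReal.ofReal (B.activeTime q j s ω) ∂P := lintegral_congr fun ω => by
        rw [B.integral_exp_neg_mul_T hq, ← mul_assoc, mul_comm |B.X j s ω|,
          ← abs_of_pos (B.discount_pos q j s ω), ← abs_mul, ENNReal.ofReal_mul (abs_nonneg _),
          ← Real.enorm_eq_ofReal_abs, abs_of_pos (B.discount_pos q j s ω)]
    _ = _ := by
        refine (lintegral_mul_eq_lintegral_mul_lintegral_of_independent_measurableSpace
          ((B.F j).le s) (B.measurable_W_ambient j s).comap_le (B.indep_W j s).symm hdX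
          (hlength.comp (comap_measurable (B.W j s)))).trans ?_
        exact congrArg _ ((B.ident_W j s).comp hlength).lintegral_eq

theorem absSummable_discount_mul_X [NeZero P] (hq : 0 < q) (hX : B.RewardsIntegrable q)
    (j : Fin J) : AbsSummable P fun s ω => B.discount q j s ω * B.X j s ω := by
  have hdX (s : ℕ) : Measurable fun ω => B.discount q j s ω * B.X j s ω :=
    ((B.measurable_discount j s).mul (B.measurable_X j s)).mono ((B.F j).le s) le_rfl
  have hterm (s : ℕ) : AEMeasurable (fun ω => ENNReal.ofReal (|B.X j s ω| *
      ∫ r in (B.T j s ω)..(B.T j (s + 1) ω), Real.exp (-q * r))) P := by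
    simp only [B.integral_exp_neg_mul_T hq.ne']
    exact ((((B.measurable_X j s).mono ((B.F j).le s) le_rfl).abs.mul
      (((B.measurable_discount j s).mono ((B.F j).le s) le_rfl).mul
        ((B.measurable_activeTime j s).mono ((B.F j).le _) le_rfl))).ennreal_ofReal).aemeasurable
  refine ⟨fun s => (hdX s).aestronglyMeasurable, fun htop => (hX j).ne ?_⟩
  rw [lintegral_tsum hterm]
  simp only [B.lintegral_abs_X_mul_integral hq.ne']
  rw [ENNReal.tsum_mul_right, htop, ENNReal.top_mul (B.lintegral_activeTime_ne_zero hq j 0)]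

theorem discountedSum_eq (j : Fin J) (s : ℕ) (τ : Ω → WithTop ℕ) (Y : ℕ → Ω → ℝ) (ω : Ω) :
    B.discountedSum q j s τ Y ω =
      Real.exp (q * B.T j s ω) * B.discountedSum₀ q j s τ Y ω := by
  simp only [discountedSum, discountedSum₀, ← tsum_mul_left]
  refine tsum_congr fun u => ?_
  by_cases h : u ∈ {u : ℕ | s ≤ u ∧ (u : WithTop ℕ) < τ ω}
  · rw [Set.indicator_of_mem h, Set.indicator_of_mem h, ← mul_assoc, ← Real.exp_add,
      Finset.sum_Ico_eq_sub _ h.1, T, T]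
    ring_nf
  · rw [Set.indicator_of_notMem h, Set.indicator_of_notMem h, mul_zero]

theorem discountedSum₀_eq_blockSum (j : Fin J) (s : ℕ) (τ : Ω → WithTop ℕ) (Y : ℕ → Ω → ℝ) :
    B.discountedSum₀ q j s τ Y = blockSum s τ fun u ω => B.discount q j u ω * Y u ω := rfl

variable [IsProbabilityMeasure P]

theorem condExp_comp_W (j : Fin J) (s : ℕ) {g : ℝ → ℝ} (hg : Measurable g) :
    P[fun ω => g (B.W j s ω) | B.F j s] =ᵐ[P] fun _ => ∫ ω, g (B.W j 0 ω) ∂P := by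
  refine (condExp_indep_eq (B.measurable_W_ambient j s).comap_le ((B.F j).le s)
    (hg.comp (comap_measurable (B.W j s))).stronglyMeasurable (B.indep_W j s)).trans ?_
  exact .of_forall fun _ => ((B.ident_W j s).comp hg).integral_eq

theorem integrable_exp_neg_mul_W (hq : 0 < q) (j : Fin J) (s : ℕ) :
    Integrable (fun ω => Real.exp (-q * B.W j s ω)) P :=
  .of_bound (B.aestronglyMeasurable_exp_neg_mul_W q j s) 1 (B.ae_norm_exp_neg_mul_W_le_one hq j s)

theorem integral_exp_neg_mul_W_lt_one (hq : 0 < q) (j : Fin J) (s : ℕ) :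
    ∫ ω, Real.exp (-q * B.W j s ω) ∂P < 1 := by
  have hlt := B.ae_exp_neg_mul_W_lt_one hq j s
  have hi := B.integrable_exp_neg_mul_W hq j s
  by_contra! hge
  have hzero : ∫ ω, (1 - Real.exp (-q * B.W j s ω)) ∂P = 0 := by
    refine le_antisymm ?_ (integral_nonneg_of_ae (hlt.mono fun ω hω => sub_nonneg.2 hω.le))
    rw [integral_sub (integrable_const 1) hi]
    simpa using hge
  have heq := (integral_eq_zero_iff_of_nonneg_ae (hlt.mono fun ω hω => sub_nonneg.2 hω.le)
    ((integrable_const 1).sub hi)).1 hzero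
  obtain ⟨ω, heq, hω⟩ := (heq.and hlt).exists
  exact (sub_pos.2 hω).ne' heq

theorem integral_discount_succ_mul (hq : 0 < q) (j : Fin J) (s : ℕ) {Z : Ω → ℝ}
    (hZ : Measurable[B.F j s] Z) (hi : Integrable (fun ω => B.discount q j s ω * Z ω) P) :
    ∫ ω, B.discount q j (s + 1) ω * Z ω ∂P =
      (∫ ω, Real.exp (-q * B.W j 0 ω) ∂P) * ∫ ω, B.discount q j s ω * Z ω ∂P := by
  have hm : StronglyMeasurable[B.F j s] fun ω => B.discount q j s ω * Z ω :=
    ((B.measurable_discount j s).mul hZ).stronglyMeasurable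
  have hprod := B.integrable_discount_succ_mul hq j s hi
  simp only [discount_succ, mul_right_comm] at hprod ⊢
  rw [← integral_mul_condExp ((B.F j).le s) hm hprod (B.integrable_exp_neg_mul_W hq j s),
    mul_comm, ← integral_mul_const]
  refine integral_congr_ae ?_
  filter_upwards [B.condExp_comp_W j s (g := fun w => Real.exp (-q * w)) (by fun_prop)] with ω hω
  rw [hω]

/-- Arm `j` of the bandit, with its discounting. -/
noncomputable def discountedArm (hq : 0 < q) (hX : B.RewardsIntegrable q) (j : Fin J) :
    DiscountedArm P where
  F := B.F j
  X := B.X j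
  d := B.discount q j
  β := ∫ ω, Real.exp (-q * B.W j 0 ω) ∂P
  measurable_X := B.measurable_X j
  measurable_d := B.measurable_discount j
  d_pos := B.discount_pos q j
  d_zero ω := by simp [discount, T]
  β_nonneg := integral_nonneg fun _ => (Real.exp_pos _).le
  β_lt_one := B.integral_exp_neg_mul_W_lt_one hq j 0
  integrable_d_succ s _ _ := B.integrable_discount_succ_mul hq j s
  integral_d_succ s _ := B.integral_discount_succ_mul hq j s
  absSummable_d_mul_X := B.absSummable_discount_mul_X hq hX j

theorem hasCondMean_activeTime (hq : 0 < q) (hX : B.RewardsIntegrable q) (j : Fin J) :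
    (B.discountedArm hq hX j).HasCondMean (B.activeTime q j) (∫ ω, B.activeTime q j 0 ω ∂P) where
  stronglyMeasurable s := ((B.measurable_activeTime j s).mono
    (le_iSup (fun s => (B.F j s : MeasurableSpace Ω)) (s + 1)) le_rfl).stronglyMeasurable
  exists_bound := ⟨1 / q, B.ae_abs_activeTime_le hq j⟩
  condExp_eq s := B.condExp_comp_W j s (measurable_discountedLength q)

section Index

variable {B} {j : Fin J} {s : ℕ} {τ : Ω → WithTop ℕ}

theorem genCondExp_discountedSum₀_X (hq : 0 < q) (hX : B.RewardsIntegrable q)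
    (hτ : τ ∈ B.stoppingTimesAfter j s) :
    genCondExp P (B.F j s) (B.discountedSum₀ q j s τ (B.X j)) =ᵐ[P]
      (B.discountedArm hq hX j).expReward s τ :=
  genCondExp_ae_eq_condExp
    (DiscountedArm.integrable_blockSum_reward (a := B.discountedArm hq hX j) hτ)

theorem genCondExp_discountedSum₀_one (hq : 0 < q) (hX : B.RewardsIntegrable q)
    (hτ : τ ∈ B.stoppingTimesAfter j s) :
    genCondExp P (B.F j s) (B.discountedSum₀ q j s τ fun _ _ => 1) =ᵐ[P]
      (B.discountedArm hq hX j).expTime s τ := by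
  simp only [discountedSum₀_eq_blockSum, mul_one]
  exact genCondExp_ae_eq_condExp
    (DiscountedArm.integrable_blockSum_d (a := B.discountedArm hq hX j) hτ)

theorem ratio₀_ae_eq_rate (hq : 0 < q) (hX : B.RewardsIntegrable q)
    (hτ : τ ∈ B.stoppingTimesAfter j s) :
    B.ratio₀ q j s τ =ᵐ[P] (B.discountedArm hq hX j).rate s τ :=
  (genCondExp_discountedSum₀_X hq hX hτ).div (genCondExp_discountedSum₀_one hq hX hτ)

theorem ratio_ae_eq_ratio₀ (hq : 0 < q) (hX : B.RewardsIntegrable q)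
    (hτ : τ ∈ B.stoppingTimesAfter j s) : B.ratio q j s τ =ᵐ[P] B.ratio₀ q j s τ := by
  have hexp : Measurable[B.F j s] fun ω => Real.exp (q * B.T j s ω) :=
    Real.measurable_exp.comp ((B.measurable_T j s).const_mul q)
  have pull_out {Y : ℕ → Ω → ℝ} (hY : AbsSummable P fun u ω => B.discount q j u ω * Y u ω) :
      genCondExp P (B.F j s) (B.discountedSum q j s τ Y) =ᵐ[P] fun ω =>
        Real.exp (q * B.T j s ω) * genCondExp P (B.F j s) (B.discountedSum₀ q j s τ Y) ω := by
    simp only [funext (B.discountedSum_eq j s τ Y)]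
    exact genCondExp_mul_of_measurable_left ((B.F j).le s) hexp (fun ω => (Real.exp_pos _).le)
      (integrable_blockSum hY hτ.1 s).aemeasurable
  have hdiscount : AbsSummable P fun u ω => B.discount q j u ω * 1 := by
    simp only [mul_one]
    exact (B.discountedArm hq hX j).absSummable_d
  filter_upwards [pull_out (B.absSummable_discount_mul_X hq hX j),
    pull_out (Y := fun _ _ => 1) hdiscount] with ω hX hone
  rw [ratio, hX, hone]
  exact mul_div_mul_left _ _ (Real.exp_pos _).ne'

theorem isEssSup_ratio_iff (hq : 0 < q) (hX : B.RewardsIntegrable q) (g : Ω → ℝ) :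
    IsEssSup P (B.ratio q j s '' B.stoppingTimesAfter j s) g ↔
      IsEssSup P ((B.discountedArm hq hX j).rate s '' (B.discountedArm hq hX j).stopsAfter s) g :=
  have hratio (τ) (hτ : τ ∈ B.stoppingTimesAfter j s) :
      B.ratio q j s τ =ᵐ[P] (B.discountedArm hq hX j).rate s τ :=
    (ratio_ae_eq_ratio₀ hq hX hτ).trans (ratio₀_ae_eq_rate hq hX hτ)
  ⟨fun h => h.congr_image hratio, fun h => h.congr_image fun τ hτ => (hratio τ hτ).symm⟩

theorem exists_isGittinsIndex (hq : 0 < q) (hX : B.RewardsIntegrable q) :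
    ∃ Γ : Fin J → ℕ → Ω → ℝ, B.IsGittinsIndex q Γ := by
  choose Γ hΓ using fun j => (B.discountedArm hq hX j).exists_isEssSup_rate
  exact ⟨Γ, fun j s => (isEssSup_ratio_iff hq hX _).2 (hΓ j s)⟩

theorem IsGittinsIndex.isIndex {Γ : Fin J → ℕ → Ω → ℝ} (hΓ : B.IsGittinsIndex q Γ) (hq : 0 < q)
    (hX : B.RewardsIntegrable q) (j : Fin J) : (B.discountedArm hq hX j).IsIndex (Γ j) := by
  intro s
  have hsup := (isEssSup_ratio_iff hq hX _).1 (hΓ j s)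
  obtain ⟨g, hg, hΓg⟩ := DiscountedArm.exists_measurable_ae_eq_of_isEssSup hsup
  exact ⟨measurable_of_ae_eq (B.complete j s) hg hΓg, hsup⟩

theorem IsGittinsIndex.isEssSup_ratio₀ {Γ : Fin J → ℕ → Ω → ℝ} (hΓ : B.IsGittinsIndex q Γ)
    (hq : 0 < q) (hX : B.RewardsIntegrable q) (j : Fin J) (s : ℕ) :
    IsEssSup P (B.ratio₀ q j s '' B.stoppingTimesAfter j s) (Γ j s) :=
  (hΓ j s).congr_image fun _ hτ => ratio_ae_eq_ratio₀ hq hX hτ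

end Index

end RenewalBandit

namespace RenewalBandit

variable {Ω : Type*} {mΩ : MeasurableSpace Ω} {P : Measure Ω} {J : ℕ} {B : RenewalBandit P J}
  {ω : Ω}

theorem T_mono (hW : ∀ j s, 0 ≤ B.W j s ω) (j : Fin J) : Monotone fun s => B.T j s ω :=
  fun _ _ h => Finset.sum_le_sum_of_subset_of_nonneg (Finset.range_mono h) fun u _ _ => hW j u

theorem T_nonneg (hW : ∀ j s, 0 ≤ B.W j s ω) (j : Fin J) (s : ℕ) : 0 ≤ B.T j s ω :=
  Finset.sum_nonneg fun u _ => hW j u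

namespace Strategy

variable (π : B.Strategy) {q : ℝ} {t u s : ℕ} {j : Fin J}

/-- The operation carried out in period `t`: the arm, and the number of its previous operations. -/
noncomputable def position (t : ℕ) (ω : Ω) : Fin J × ℕ := (π.arm t ω, π.count t ω (π.arm t ω))

theorem count_succ_eq (t : ℕ) (ω : Ω) :
    π.count (t + 1) ω = π.count t ω + Pi.single (π.arm t ω) 1 := (π.count_succ t ω).choose_spec

theorem count_succ_arm (t : ℕ) (ω : Ω) :
    π.count (t + 1) ω (π.arm t ω) = π.count t ω (π.arm t ω) + 1 := by
  simp [count_succ_eq]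

theorem count_succ_of_ne (h : j ≠ π.arm t ω) : π.count (t + 1) ω j = π.count t ω j := by
  simp [count_succ_eq, h]

theorem arm_eq_iff : π.arm t ω = j ↔ π.count (t + 1) ω = π.count t ω + Pi.single j 1 := by
  refine ⟨fun h => h ▸ π.count_succ_eq t ω, fun h => of_not_not fun hne => ?_⟩
  simpa [h, hne] using π.count_succ_arm t ω

theorem position_eq_iff : π.position t ω = (j, s) ↔ π.arm t ω = j ∧ π.count t ω j = s := by
  rw [position, Prod.mk.injEq]
  exact and_congr_right fun h => by rw [h]

theorem count_mono (ω : Ω) (j : Fin J) : Monotone fun t => π.count t ω j :=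
  monotone_nat_of_le_succ fun t => by simp [count_succ_eq]

theorem lt_count_iff : s < π.count t ω j ↔ ∃ u < t, π.position u ω = (j, s) := by
  constructor
  · intro h
    induction t with
    | zero => simp [π.count_zero] at h
    | succ t ih =>
      by_cases hs : s < π.count t ω j
      · obtain ⟨u, hu, hpos⟩ := ih hs
        exact ⟨u, hu.trans t.lt_succ_self, hpos⟩
      · have hj : π.arm t ω = j := of_not_not fun hne => hs (π.count_succ_of_ne (Ne.symm hne) ▸ h)
        have hcount := π.count_succ_arm t ω
        rw [hj] at hcount
        exact ⟨t, t.lt_succ_self, π.position_eq_iff.2 ⟨hj, by lia⟩⟩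
  · rintro ⟨u, hu, hpos⟩
    obtain ⟨rfl, rfl⟩ := π.position_eq_iff.1 hpos
    exact (Nat.lt_succ_self _).trans_le
      ((π.count_succ_arm u ω).ge.trans (π.count_mono ω _ (Nat.succ_le_of_lt hu)))

theorem position_injective (ω : Ω) : Function.Injective fun t => π.position t ω :=
  .of_lt_imp_ne fun u t hu hpos =>
    lt_irrefl (π.count t ω (π.arm t ω)) (π.lt_count_iff.2 ⟨u, hu, hpos⟩)

theorem exists_lt_position_eq (h : π.position t ω = (j, s + 1)) :
    ∃ u < t, π.position u ω = (j, s) :=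
  π.lt_count_iff.1 (s.lt_succ_self.trans_eq (π.position_eq_iff.1 h).2.symm)

theorem exists_div_le_count (t : ℕ) (ω : Ω) : ∃ j, t / J ≤ π.count t ω j := by
  by_contra! hlt
  have hsum : ∑ j, π.count t ω j < ∑ _j : Fin J, t / J :=
    Finset.sum_lt_sum_of_nonempty ⟨π.arm 0 ω, Finset.mem_univ _⟩ fun j _ => hlt j
  rw [π.sum_count, Finset.sum_const, Finset.card_univ, Fintype.card_fin, smul_eq_mul] at hsum
  exact (Nat.mul_div_le t J).not_gt hsum

/-- The time spent on arms other than `j` before period `t`. -/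
noncomputable def otherTime (j : Fin J) (t : ℕ) (ω : Ω) : ℝ :=
  ∑ i ∈ Finset.univ.erase j, B.T i (π.count t ω i) ω

theorem time_succ (t : ℕ) (ω : Ω) : π.time (t + 1) ω = π.time t ω + π.duration t ω :=
  Finset.sum_range_succ _ _

theorem otherTime_succ_arm (t : ℕ) (ω : Ω) :
    π.otherTime (π.arm t ω) (t + 1) ω = π.otherTime (π.arm t ω) t ω :=
  Finset.sum_congr rfl fun _ hi => by rw [π.count_succ_of_ne (Finset.ne_of_mem_erase hi)]

theorem T_add_otherTime (j : Fin J) (t : ℕ) (ω : Ω) :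
    B.T j (π.count t ω j) ω + π.otherTime j t ω = ∑ i, B.T i (π.count t ω i) ω :=
  Finset.add_sum_erase _ (fun i => B.T i (π.count t ω i) ω) (Finset.mem_univ j)

theorem time_eq_sum (t : ℕ) (ω : Ω) : π.time t ω = ∑ i, B.T i (π.count t ω i) ω := by
  induction t with
  | zero => simp [time, π.count_zero, T]
  | succ t ih =>
    have hT : B.T (π.arm t ω) (π.count t ω (π.arm t ω) + 1) ω =
        B.T (π.arm t ω) (π.count t ω (π.arm t ω)) ω + π.duration t ω := Finset.sum_range_succ _ _
    rw [time_succ, ih, ← π.T_add_otherTime (π.arm t ω), ← π.T_add_otherTime (π.arm t ω) (t + 1),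
      count_succ_arm, otherTime_succ_arm, hT]
    ring

theorem time_eq (j : Fin J) (t : ℕ) (ω : Ω) :
    π.time t ω = B.T j (π.count t ω j) ω + π.otherTime j t ω :=
  (π.time_eq_sum t ω).trans (π.T_add_otherTime j t ω).symm

theorem otherTime_nonneg (hW : ∀ j s, 0 ≤ B.W j s ω) (j : Fin J) (t : ℕ) :
    0 ≤ π.otherTime j t ω := Finset.sum_nonneg fun i _ => T_nonneg hW i _

theorem otherTime_mono (hW : ∀ j s, 0 ≤ B.W j s ω) (j : Fin J) :
    Monotone fun t => π.otherTime j t ω := fun _ _ h =>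
  Finset.sum_le_sum fun i _ => T_mono hW i (π.count_mono ω i h)

theorem tendsto_exp_time (hq : 0 ≤ q) (hW : ∀ j s, 0 ≤ B.W j s ω)
    (hT : ∀ j, Tendsto (fun s => B.discount q j s ω) atTop (nhds 0)) :
    Tendsto (fun t => Real.exp (-q * π.time t ω)) atTop (nhds 0) := by
  have hsum : Tendsto (fun s => ∑ j, B.discount q j s ω) atTop (nhds 0) := by
    simpa using tendsto_finsetSum Finset.univ fun j _ => hT j
  refine squeeze_zero (fun t => (Real.exp_pos _).le) (fun t => ?_)
    (hsum.comp (Nat.tendsto_div_const_atTop (π.arm 0 ω).pos.ne'))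
  obtain ⟨j, hj⟩ := π.exists_div_le_count t ω
  have htime : B.T j (t / J) ω ≤ π.time t ω := (T_mono hW j hj).trans <| by
    rw [π.time_eq j]
    exact le_add_of_nonneg_right (π.otherTime_nonneg hW j t)
  calc Real.exp (-q * π.time t ω) ≤ B.discount q j (t / J) ω :=
        Real.exp_le_exp.2 (mul_le_mul_of_nonpos_left htime (neg_nonpos.2 hq))
    _ ≤ ∑ j, B.discount q j (t / J) ω :=
        Finset.single_le_sum (f := fun j => B.discount q j (t / J) ω)
          (fun i _ => (B.discount_pos q i _ ω).le) (Finset.mem_univ j)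

section Weight

/-- The factor by which the operation of other arms has discounted the operation number `s` of arm
`j` at its onset; zero if it is never carried out. -/
noncomputable def weight (q : ℝ) (j : Fin J) (s : ℕ) (ω : Ω) : ℝ :=
  ∑' t, {ω | π.position t ω = (j, s)}.indicator (fun ω => Real.exp (-q * π.otherTime j t ω)) ω

theorem weight_of_position (h : π.position t ω = (j, s)) :
    π.weight q j s ω = Real.exp (-q * π.otherTime j t ω) := by
  rw [weight, tsum_eq_single t fun u hu => Set.indicator_of_notMem
    (fun hpos => hu (π.position_injective ω (hpos.trans h.symm))) _]
  exact Set.indicator_of_mem (s := {ω | π.position t ω = (j, s)}) h _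

theorem weight_of_forall_ne (h : ∀ t, π.position t ω ≠ (j, s)) : π.weight q j s ω = 0 :=
  (tsum_congr fun t => Set.indicator_of_notMem (s := {ω | π.position t ω = (j, s)}) (h t) _).trans
    tsum_zero

theorem weight_nonneg (j : Fin J) (s : ℕ) (ω : Ω) : 0 ≤ π.weight q j s ω :=
  tsum_nonneg fun _ => Set.indicator_nonneg (fun _ _ => (Real.exp_pos _).le) ω

theorem weight_le_one (hq : 0 ≤ q) (hW : ∀ j s, 0 ≤ B.W j s ω) (j : Fin J) (s : ℕ) :
    π.weight q j s ω ≤ 1 := by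
  by_cases h : ∃ t, π.position t ω = (j, s)
  · obtain ⟨t, ht⟩ := h
    rw [π.weight_of_position ht, Real.exp_le_one_iff]
    exact mul_nonpos_of_nonpos_of_nonneg (neg_nonpos.2 hq) (π.otherTime_nonneg hW j t)
  · rw [π.weight_of_forall_ne (not_exists.1 h)]
    exact zero_le_one

theorem weight_succ_le (hq : 0 ≤ q) (hW : ∀ j s, 0 ≤ B.W j s ω) (j : Fin J) (s : ℕ) :
    π.weight q j (s + 1) ω ≤ π.weight q j s ω := by
  by_cases h : ∃ t, π.position t ω = (j, s + 1)
  · obtain ⟨t, ht⟩ := h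
    obtain ⟨u, hut, hu⟩ := π.exists_lt_position_eq ht
    rw [π.weight_of_position ht, π.weight_of_position hu, Real.exp_le_exp]
    exact mul_le_mul_of_nonpos_left (π.otherTime_mono hW j hut.le) (neg_nonpos.2 hq)
  · rw [π.weight_of_forall_ne (not_exists.1 h)]
    exact π.weight_nonneg j s ω

theorem exists_position_eq_of_weight_ne (h : π.weight q j s ω ≠ π.weight q j (s + 1) ω) :
    ∃ t, π.position t ω = (j, s) ∧ π.arm (t + 1) ω ≠ j := by
  obtain ⟨t, ht⟩ : ∃ t, π.position t ω = (j, s) := by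
    by_contra! hne
    have hne' (t : ℕ) : π.position t ω ≠ (j, s + 1) := fun ht =>
      (π.exists_lt_position_eq ht).elim fun u hu => hne u hu.2
    rw [π.weight_of_forall_ne hne, π.weight_of_forall_ne hne'] at h
    exact h rfl
  refine ⟨t, ht, fun hj => h ?_⟩
  obtain ⟨rfl, rfl⟩ := π.position_eq_iff.1 ht
  have ht' : π.position (t + 1) ω = (π.arm t ω, π.count t ω (π.arm t ω) + 1) :=
    π.position_eq_iff.2 ⟨hj, π.count_succ_arm t ω⟩
  rw [π.weight_of_position ht, π.weight_of_position ht', otherTime_succ_arm]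

/-- The duration of period `t`, discounted to time `0`. -/
noncomputable def periodLength (q : ℝ) (t : ℕ) (ω : Ω) : ℝ :=
  slot q (fun x : Fin J × ℕ => B.W x.1 x.2 ω) (fun t => π.position t ω) t

theorem integral_exp_neg_mul_time (hq : q ≠ 0) (t : ℕ) (ω : Ω) :
    ∫ r in (π.time t ω)..(π.time (t + 1) ω), Real.exp (-q * r) = π.periodLength q t ω := by
  rw [integral_exp_neg_mul hq, time_succ, add_sub_cancel_left]
  rfl

theorem weight_mul_of_position (h : π.position t ω = (j, s)) :
    π.weight q j s ω * (B.discount q j s ω * B.activeTime q j s ω) = π.periodLength q t ω := by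
  obtain ⟨rfl, rfl⟩ := π.position_eq_iff.1 h
  have htime : π.weight q (π.arm t ω) (π.count t ω (π.arm t ω)) ω *
      B.discount q (π.arm t ω) (π.count t ω (π.arm t ω)) ω = Real.exp (-q * π.time t ω) := by
    rw [π.weight_of_position h, discount, ← Real.exp_add, π.time_eq (π.arm t ω)]
    ring_nf
  rw [← mul_assoc, htime]
  rfl

/-- The discounted income from the operation `x` under the rate `Z x`; zero if `x` is never carried
out. -/
noncomputable def share (q : ℝ) (ω : Ω) (Z : Fin J × ℕ → ℝ) (x : Fin J × ℕ) : ℝ :=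
  π.weight q x.1 x.2 ω * (B.discount q x.1 x.2 ω * Z x * B.activeTime q x.1 x.2 ω)

variable (Z : Fin J × ℕ → ℝ)

theorem share_position (t : ℕ) :
    π.share q ω Z (π.position t ω) = Z (π.position t ω) * π.periodLength q t ω := by
  rw [← π.weight_mul_of_position (j := (π.position t ω).1) (s := (π.position t ω).2) rfl, share]
  ring

theorem share_of_notMem_range {x : Fin J × ℕ} (hx : x ∉ Set.range fun t => π.position t ω) :
    π.share q ω Z x = 0 := by
  rw [share, π.weight_of_forall_ne fun t ht => hx ⟨t, ht⟩, zero_mul]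

theorem summable_mul_periodLength_iff :
    (Summable fun t => Z (π.position t ω) * π.periodLength q t ω) ↔ Summable (π.share q ω Z) := by
  simp only [← share_position]
  exact (π.position_injective ω).summable_iff fun _ => π.share_of_notMem_range Z

theorem tsum_mul_periodLength :
    ∑' t, Z (π.position t ω) * π.periodLength q t ω = ∑' x, π.share q ω Z x := by
  simp only [← share_position]
  exact (π.position_injective ω).tsum_eq
    (Function.support_subset_iff'.2 fun _ => π.share_of_notMem_range Z)

end Weight

section IndexStrategy

variable {π} {Γ : Fin J → ℕ → Ω → ℝ}

/-- Along the path `ω`, the arm operated in every period has maximal current index. -/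
def FollowsIndexAt (π : B.Strategy) (Γ : Fin J → ℕ → Ω → ℝ) (ω : Ω) : Prop :=
  ∀ t j, Γ j (π.count t ω j) ω ≤ Γ (π.arm t ω) (π.count t ω (π.arm t ω)) ω

namespace FollowsIndexAt

theorem index_le_of_ne_arm (h : π.FollowsIndexAt Γ ω) (hj : j ≠ π.arm t ω) (hu : u ≤ t) :
    Γ j (π.count t ω j) ω ≤ Γ (π.position u ω).1 (π.position u ω).2 ω := by
  induction t generalizing j with
  | zero => exact Nat.le_zero.1 hu ▸ h 0 j
  | succ t ih =>
    rcases hu.lt_or_eq with hut | rfl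
    · by_cases hj' : j = π.arm t ω
      · -- The arm operated in period `t + 1` was idle in period `t` since `j` was operated then.
        have hidle : π.arm (t + 1) ω ≠ π.arm t ω := fun heq => hj (hj'.trans heq.symm)
        refine (h (t + 1) j).trans ?_
        rw [π.count_succ_of_ne hidle]
        exact ih hidle (Nat.lt_succ_iff.1 hut)
      · rw [π.count_succ_of_ne hj']
        exact ih hj' (Nat.lt_succ_iff.1 hut)
    · exact h (t + 1) j

theorem runMin_le (h : π.FollowsIndexAt Γ ω) (t : ℕ) (j : Fin J) :
    runMin (Γ j) (π.count t ω j) ω ≤ runMin (Γ (π.arm t ω)) (π.count t ω (π.arm t ω)) ω := by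
  by_cases hj : j = π.arm t ω
  · rw [← hj]
  refine (_root_.runMin_le le_rfl ω).trans (le_runMin fun u hu => ?_)
  rcases hu.lt_or_eq with hu | rfl
  · obtain ⟨u', hut, hpos⟩ := π.lt_count_iff.1 hu
    simpa only [hpos] using h.index_le_of_ne_arm hj hut.le
  · exact h t j

theorem isGreedy_runMin (h : π.FollowsIndexAt Γ ω) :
    IsGreedy (fun x : Fin J × ℕ => runMin (Γ x.1) x.2 ω) fun t => π.position t ω := fun t x hx =>
  have hcount : π.count t ω x.1 ≤ x.2 := not_lt.1 fun hlt =>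
    (π.lt_count_iff.1 hlt).elim fun u hu => hx u hu.1 hu.2
  (runMin_antitone _ ω hcount).trans (h.runMin_le t x.1)

theorem index_eq_runMin_of_weight_ne (h : π.FollowsIndexAt Γ ω)
    (hne : π.weight q j s ω ≠ π.weight q j (s + 1) ω) :
    Γ j (s + 1) ω = runMin (Γ j) (s + 1) ω := by
  obtain ⟨t, ht, harm⟩ := π.exists_position_eq_of_weight_ne hne
  have hcount : π.count (t + 1) ω j = s + 1 := by
    obtain ⟨rfl, rfl⟩ := π.position_eq_iff.1 ht
    exact π.count_succ_arm t ω
  refine le_antisymm (le_runMin fun u hu => ?_) (_root_.runMin_le le_rfl ω)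
  rcases hu.lt_or_eq with hu | rfl
  · obtain ⟨u', hut, hpos⟩ := π.lt_count_iff.1 (hu.trans_eq hcount.symm)
    simpa only [hpos, hcount] using h.index_le_of_ne_arm harm.symm hut.le
  · exact le_rfl

end FollowsIndexAt

end IndexStrategy

end Strategy

end RenewalBandit

namespace RenewalBandit

variable {Ω : Type*} {mΩ : MeasurableSpace Ω} {P : Measure Ω} {J : ℕ} (B : RenewalBandit P J)

/-- The information of all arms other than `j`. -/
abbrev others (j : Fin J) : MeasurableSpace Ω :=
  ⨆ i ∈ ({j}ᶜ : Set (Fin J)), ⨆ s, (B.F i s : MeasurableSpace Ω)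

/-- The information of all arms other than `j` after `n i` operations of each arm `i`. -/
abbrev infoOthers (n : Fin J → ℕ) (j : Fin J) : MeasurableSpace Ω :=
  ⨆ i ∈ ({j}ᶜ : Set (Fin J)), (B.F i (n i) : MeasurableSpace Ω)

theorem info_le (n : Fin J → ℕ) : B.info n ≤ mΩ := iSup_le fun j => (B.F j).le _

theorem info_mono : Monotone B.info := fun _ _ h => iSup_mono fun j => (B.F j).mono (h j)

theorem F_le_info (n : Fin J → ℕ) (j : Fin J) : (B.F j (n j) : MeasurableSpace Ω) ≤ B.info n :=
  le_iSup (fun j => (B.F j (n j) : MeasurableSpace Ω)) j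

theorem others_le (j : Fin J) : B.others j ≤ mΩ := iSup₂_le fun i _ => iSup_le (B.F i).le

theorem F_le_others {i j : Fin J} (h : i ≠ j) (s : ℕ) :
    (B.F i s : MeasurableSpace Ω) ≤ B.others j :=
  (le_iSup (fun s => (B.F i s : MeasurableSpace Ω)) s).trans
    (le_iSup₂ (f := fun i (_ : i ∈ ({j}ᶜ : Set (Fin J))) => ⨆ s, (B.F i s : MeasurableSpace Ω)) i h)

theorem infoOthers_mono (j : Fin J) : Monotone fun n => B.infoOthers n j := fun _ _ h =>
  iSup₂_mono fun i _ => (B.F i).mono (h i)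

theorem infoOthers_le_others (n : Fin J → ℕ) (j : Fin J) : B.infoOthers n j ≤ B.others j :=
  iSup₂_le fun _ hi => B.F_le_others hi _

theorem info_eq_sup_infoOthers (n : Fin J → ℕ) (j : Fin J) :
    B.info n = (B.F j (n j) : MeasurableSpace Ω) ⊔ B.infoOthers n j :=
  iSup_split_single _ j

theorem info_le_sup_others (n : Fin J → ℕ) (j : Fin J) :
    B.info n ≤ (B.F j (n j) : MeasurableSpace Ω) ⊔ B.others j :=
  (B.info_eq_sup_infoOthers n j).trans_le (sup_le_sup_left (B.infoOthers_le_others n j) _)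

theorem indep_others (j : Fin J) :
    Indep (⨆ s, (B.F j s : MeasurableSpace Ω)) (B.others j) P := by
  simpa only [iSup_singleton] using indep_iSup_of_disjoint (fun i => iSup_le (B.F i).le)
    B.indep_arms (S := {j}) (T := {j}ᶜ) disjoint_compl_right

theorem indep_infoOthers (j : Fin J) (s : ℕ) (n : Fin J → ℕ) :
    Indep (B.F j s : MeasurableSpace Ω) (B.infoOthers n j) P :=
  indep_of_indep_of_le_left (indep_of_indep_of_le_right (B.indep_others j)
    (B.infoOthers_le_others n j)) (le_iSup (fun s => (B.F j s : MeasurableSpace Ω)) s)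

namespace Strategy

variable {B} (π : B.Strategy) (t : ℕ) (n : Fin J → ℕ) (j : Fin J)

theorem measurableSet_count_arm_info_succ :
    MeasurableSet[B.info (n + Pi.single j 1)] {ω | π.count t ω = n ∧ π.arm t ω = j} := by
  have hset : {ω | π.count t ω = n ∧ π.arm t ω = j} =
      {ω | π.count t ω = n} ∩ {ω | π.count (t + 1) ω = n + Pi.single j 1} := by
    ext ω
    exact and_congr_right fun h => π.arm_eq_iff.trans (by rw [h]; rfl)
  rw [hset]
  exact (B.info_mono le_self_add _ (π.measurableSet_count t n)).inter
    (π.measurableSet_count (t + 1) _)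

theorem measurableSet_count_arm_succ_sup_infoOthers :
    MeasurableSet[(B.F j (n j + 1) : MeasurableSpace Ω) ⊔ B.infoOthers n j]
      {ω | π.count t ω = n ∧ π.arm t ω = j} := by
  refine (?_ : B.info (n + Pi.single j 1) ≤ _) _ (π.measurableSet_count_arm_info_succ t n j)
  rw [B.info_eq_sup_infoOthers _ j]
  refine sup_le_sup (by simp) (iSup₂_mono fun i hi => (B.F i).mono ?_)
  simp [Set.mem_compl_singleton_iff.1 hi]

theorem measurableSet_count_arm_sup_infoOthers_succ :
    MeasurableSet[(B.F j (n j) : MeasurableSpace Ω) ⊔ B.infoOthers (n + 1) j]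
      {ω | π.count t ω = n ∧ π.arm t ω = j} := by
  have hle {k : Fin J} (hk : k ≠ j) : B.info (n + Pi.single k 1) ≤
      (B.F j (n j) : MeasurableSpace Ω) ⊔ B.infoOthers (n + 1) j := by
    rw [B.info_eq_sup_infoOthers _ j]
    refine sup_le_sup (by simp [hk.symm]) (B.infoOthers_mono j (add_le_add_right ?_ n))
    exact update_le_iff.2 ⟨le_rfl, fun _ _ => zero_le_one⟩
  have hset : {ω | π.count t ω = n ∧ π.arm t ω = j} = {ω | π.count t ω = n} \
      ⋃ k ∈ ({j}ᶜ : Set (Fin J)), {ω | π.count t ω = n ∧ π.arm t ω = k} := by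
    ext ω
    simp only [Set.mem_ofPred_eq, Set.mem_sdiff, Set.mem_iUnion, Set.mem_compl_iff,
      Set.mem_singleton_iff]
    grind
  rw [hset]
  refine MeasurableSet.diff ?_ (.biUnion (Set.to_countable _) fun k hk =>
    hle hk _ (π.measurableSet_count_arm_info_succ t n k))
  refine (?_ : B.info n ≤ _) _ (π.measurableSet_count t n)
  exact (B.info_eq_sup_infoOthers n j).trans_le
    (sup_le_sup_left (B.infoOthers_mono j le_self_add) _)

/-- The arm selected in period `t` is determined by the information at its onset. Operating `j`
reveals no more of the other arms, and not operating `j` reveals no more of arm `j`; as the arms are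
independent, what both revelations determine was already known. -/
theorem measurableSet_count_arm [IsProbabilityMeasure P] :
    MeasurableSet[B.info n] {ω | π.count t ω = n ∧ π.arm t ω = j} := by
  obtain ⟨A', hA', hae⟩ := exists_measurableSet_ae_eq_of_indep ((B.F j).mono (n j).le_succ)
    (B.infoOthers_mono j (le_self_add : n ≤ n + 1)) ((B.F j).le _)
    ((B.infoOthers_le_others _ j).trans (B.others_le j)) (B.indep_infoOthers j _ _)
    (π.measurableSet_count_arm_succ_sup_infoOthers t n j)
    (π.measurableSet_count_arm_sup_infoOthers_succ t n j)
  rw [← B.info_eq_sup_infoOthers] at hA'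
  exact measurableSet_of_ae_eq (fun N hN => B.F_le_info n j _ (B.complete j (n j) N hN)) hA' hae

variable [IsProbabilityMeasure P] (q : ℝ) (s : ℕ)

theorem measurableSet_count_position :
    MeasurableSet[(B.F j s : MeasurableSpace Ω) ⊔ B.others j]
      {ω | π.count t ω = n ∧ π.position t ω = (j, s)} := by
  by_cases hn : n j = s
  · subst hn
    have hset : {ω | π.count t ω = n ∧ π.position t ω = (j, n j)} =
        {ω | π.count t ω = n ∧ π.arm t ω = j} := by
      ext ω
      simp +contextual [π.position_eq_iff]
    rw [hset]
    exact B.info_le_sup_others n j _ (π.measurableSet_count_arm t n j)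
  · have hset : {ω | π.count t ω = n ∧ π.position t ω = (j, s)} = ∅ := by
      ext ω
      simp +contextual [π.position_eq_iff, hn]
    rw [hset]
    exact MeasurableSpace.measurableSet_empty _

theorem measurable_weight :
    Measurable[(B.F j s : MeasurableSpace Ω) ⊔ B.others j] (π.weight q j s) := by
  let _ : MeasurableSpace Ω := (B.F j s : MeasurableSpace Ω) ⊔ B.others j
  refine Measurable.tsum fun t => ?_
  have hsum : {ω | π.position t ω = (j, s)}.indicator
      (fun ω => Real.exp (-q * π.otherTime j t ω)) =
      fun ω => ∑' n, {ω | π.count t ω = n ∧ π.position t ω = (j, s)}.indicator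
        (fun ω => Real.exp (-q * ∑ i ∈ Finset.univ.erase j, B.T i (n i) ω)) ω := by
    funext ω
    rw [tsum_eq_single (π.count t ω) fun n hn => Set.indicator_of_notMem (fun h => hn h.1.symm) _]
    simp [Set.indicator_apply, otherTime]
  rw [hsum]
  refine Measurable.tsum fun n => Measurable.indicator ?_ (π.measurableSet_count_position t n j s)
  refine Real.measurable_exp.comp (measurable_const.mul (Finset.measurable_sum _ fun i hi => ?_))
  exact (B.measurable_T i (n i)).mono
    ((B.F_le_others (Finset.ne_of_mem_erase hi) _).trans le_sup_right) le_rfl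

end Strategy

end RenewalBandit

namespace RenewalBandit

variable {Ω : Type*} {mΩ : MeasurableSpace Ω} {P : Measure Ω} {J : ℕ} {B : RenewalBandit P J}
  {q : ℝ}

theorem ae_W_nonneg (B : RenewalBandit P J) : ∀ᵐ ω ∂P, ∀ j s, 0 ≤ B.W j s ω :=
  ae_all_iff.2 fun j => ae_all_iff.2 fun s => (B.pos_W j s).mono fun _ h => h.le

theorem integral_activeTime_nonneg (B : RenewalBandit P J) (hq : 0 < q) (j : Fin J) (s : ℕ) :
    0 ≤ ∫ ω, B.activeTime q j s ω ∂P :=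
  integral_nonneg_of_ae ((B.pos_W j s).mono fun _ h => discountedLength_nonneg hq h.le)

namespace Strategy

variable (π : B.Strategy)

/-- The total discounted income of `π` if the operation number `s` of arm `j` pays at the rate
`Z j s` instead of `B.X j s`. -/
noncomputable def income (q : ℝ) (Z : Fin J → ℕ → Ω → ℝ) (ω : Ω) : ℝ :=
  ∑' t, Z (π.position t ω).1 (π.position t ω).2 ω * π.periodLength q t ω

theorem periodReward_eq (hq : q ≠ 0) (t : ℕ) (ω : Ω) : π.periodReward q t ω =
    B.X (π.position t ω).1 (π.position t ω).2 ω * π.periodLength q t ω := by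
  rw [periodReward, π.integral_exp_neg_mul_time hq]
  rfl

theorem totalReward_eq_income (hq : q ≠ 0) : π.totalReward q = π.income q B.X :=
  funext fun ω => tsum_congr fun t => π.periodReward_eq hq t ω

theorem income_eq_tsum_share (q : ℝ) (Z : Fin J → ℕ → Ω → ℝ) (ω : Ω) :
    π.income q Z ω = ∑' x, π.share q ω (fun x => Z x.1 x.2 ω) x :=
  π.tsum_mul_periodLength fun x => Z x.1 x.2 ω

section Income

variable [IsProbabilityMeasure P] {A : Set Ω} {Z Z' : Fin J → ℕ → Ω → ℝ}

theorem isWeight_indicator_weight (hq : 0 < q) (hX : B.RewardsIntegrable q)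
    (hA : MeasurableSet[B.info 0] A) (j : Fin J) :
    (B.discountedArm hq hX j).IsWeight (B.others j) fun s => A.indicator (π.weight q j s) where
  le := B.others_le j
  indep := B.indep_others j
  stronglyMeasurable s := (π.measurable_weight j q s).stronglyMeasurable.indicator
    ((B.info_le_sup_others 0 j).trans (sup_le_sup_right ((B.F j).mono (Nat.zero_le s)) _) _ hA)
  nonneg s _ := Set.indicator_nonneg (fun ω _ => π.weight_nonneg j s ω) _
  le_one s := B.ae_W_nonneg.mono fun _ hW =>
    Set.indicator_apply_le' (fun _ => π.weight_le_one hq.le hW j s) fun _ => zero_le_one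

theorem absSummable_share (hq : 0 < q) (hX : B.RewardsIntegrable q)
    (hZ : ∀ j, AbsSummable P fun s ω => B.discount q j s ω * Z j s ω) :
    AbsSummable P fun x ω => π.share q ω (fun x => Z x.1 x.2 ω) x := by
  refine AbsSummable.prod (f := fun j s ω => π.share q ω (fun x => Z x.1 x.2 ω) (j, s)) fun j => ?_
  simpa only [Set.indicator_univ, share] using
    (π.isWeight_indicator_weight hq hX .univ j).absSummable_mul
      (B.hasCondMean_activeTime hq hX j) (hZ j)

theorem ae_summable_income (hq : 0 < q) (hX : B.RewardsIntegrable q)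
    (hZ : ∀ j, AbsSummable P fun s ω => B.discount q j s ω * Z j s ω) : ∀ᵐ ω ∂P, Summable fun t =>
      Z (π.position t ω).1 (π.position t ω).2 ω * π.periodLength q t ω :=
  (π.absSummable_share hq hX hZ).ae_summable.mono fun ω hω =>
    (π.summable_mul_periodLength_iff fun x => Z x.1 x.2 ω).2 hω

theorem integrable_income (hq : 0 < q) (hX : B.RewardsIntegrable q)
    (hZ : ∀ j, AbsSummable P fun s ω => B.discount q j s ω * Z j s ω) :
    Integrable (π.income q Z) P :=
  (π.absSummable_share hq hX hZ).integrable_tsum.congr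
    (.of_forall fun ω => (π.income_eq_tsum_share q Z ω).symm)

theorem setIntegral_income (hq : 0 < q) (hX : B.RewardsIntegrable q)
    (hZ : ∀ j, AbsSummable P fun s ω => B.discount q j s ω * Z j s ω) (hA : MeasurableSet A) :
    ∫ ω in A, π.income q Z ω ∂P = ∑ j, ∫ ω, ∑' s, A.indicator (π.weight q j s) ω *
      (B.discount q j s ω * Z j s ω * B.activeTime q j s ω) ∂P := by
  have hshare := π.absSummable_share hq hX hZ
  have hsum := hshare.hasSum_setIntegral A
  simp only [income_eq_tsum_share]
  rw [← hsum.tsum_eq, hsum.summable.tsum_prod, tsum_fintype]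
  refine Finset.sum_congr rfl fun j _ => ?_
  have harm := (hshare.comp_injective (Prod.mk_right_injective j)).hasSum_setIntegral A
  rw [harm.tsum_eq, ← integral_indicator hA]
  refine integral_congr_ae (.of_forall fun ω => ?_)
  by_cases hω : ω ∈ A <;> simp [hω, share]

theorem setIntegral_income_sub (hq : 0 < q) (hX : B.RewardsIntegrable q)
    (hZ : ∀ j, AbsSummable P fun s ω => B.discount q j s ω * Z j s ω)
    (hZ' : ∀ j, AbsSummable P fun s ω => B.discount q j s ω * Z' j s ω) (A : Set Ω) :
    ∫ ω in A, π.income q Z ω ∂P - ∫ ω in A, π.income q Z' ω ∂P =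
      ∫ ω in A, π.income q (fun j s ω => Z j s ω - Z' j s ω) ω ∂P := by
  rw [← integral_sub (π.integrable_income hq hX hZ).integrableOn
    (π.integrable_income hq hX hZ').integrableOn]
  refine integral_congr_ae (ae_restrict_of_ae ?_)
  filter_upwards [π.ae_summable_income hq hX hZ, π.ae_summable_income hq hX hZ'] with ω hs hs'
  simp only [income, sub_mul, hs.tsum_sub hs']

end Income

section Optimal

variable [IsProbabilityMeasure P] {A : Set Ω} {Γ : Fin J → ℕ → Ω → ℝ}

theorem setIntegral_totalReward_sub (hΓ : B.IsGittinsIndex q Γ) (hq : 0 < q)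
    (hX : B.RewardsIntegrable q) (hA : MeasurableSet A) :
    ∫ ω in A, π.totalReward q ω ∂P - ∫ ω in A, π.income q (fun j => runMin (Γ j)) ω ∂P =
      ∑ j, ∫ ω, ∑' s, A.indicator (π.weight q j s) ω *
        ((B.discountedArm hq hX j).excess (Γ j) s ω * B.activeTime q j s ω) ∂P := by
  have hdX := B.absSummable_discount_mul_X hq hX
  have hdM (j : Fin J) : AbsSummable P fun s ω => B.discount q j s ω * runMin (Γ j) s ω :=
    (hΓ.isIndex hq hX j).absSummable_runMin
  have hexcess (j : Fin J) (s : ℕ) (ω : Ω) : (B.discountedArm hq hX j).excess (Γ j) s ω =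
      B.discount q j s ω * (B.X j s ω - runMin (Γ j) s ω) := (mul_sub _ _ _).symm
  simp only [π.totalReward_eq_income hq.ne', hexcess]
  rw [π.setIntegral_income_sub hq hX hdX hdM, π.setIntegral_income hq hX (fun j => ?_) hA]
  simpa only [mul_sub] using (hdX j).sub (hdM j)

theorem setIntegral_totalReward_le (hΓ : B.IsGittinsIndex q Γ) (hq : 0 < q)
    (hX : B.RewardsIntegrable q) (hA : MeasurableSet[B.info 0] A) :
    ∫ ω in A, π.totalReward q ω ∂P ≤ ∫ ω in A, π.income q (fun j => runMin (Γ j)) ω ∂P := by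
  rw [← sub_nonpos, π.setIntegral_totalReward_sub hΓ hq hX (B.info_le 0 _ hA)]
  refine Finset.sum_nonpos fun j _ =>
    (hΓ.isIndex hq hX j).integral_tsum_weight_mul_excess_nonpos
      (π.isWeight_indicator_weight hq hX hA j) (fun s => ?_) (B.hasCondMean_activeTime hq hX j)
      (B.integral_activeTime_nonneg hq j 0)
  exact B.ae_W_nonneg.mono fun _ hW => Set.indicator_le_indicator (π.weight_succ_le hq.le hW j s)

theorem setIntegral_totalReward_eq (hΓ : B.IsGittinsIndex q Γ) (hq : 0 < q)
    (hX : B.RewardsIntegrable q) (hπ : π.FollowsIndex Γ) (hA : MeasurableSet[B.info 0] A) :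
    ∫ ω in A, π.totalReward q ω ∂P = ∫ ω in A, π.income q (fun j => runMin (Γ j)) ω ∂P := by
  rw [← sub_eq_zero, π.setIntegral_totalReward_sub hΓ hq hX (B.info_le 0 _ hA)]
  refine Finset.sum_eq_zero fun j _ =>
    (hΓ.isIndex hq hX j).integral_tsum_weight_mul_excess_eq_zero
      (π.isWeight_indicator_weight hq hX hA j) (B.hasCondMean_activeTime hq hX j) fun s => ?_
  filter_upwards [ae_all_iff.2 hπ] with ω hω hne
  refine FollowsIndexAt.index_eq_runMin_of_weight_ne (q := q) hω fun heq => hne ?_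
  by_cases hωA : ω ∈ A <;> simp [hωA, heq]

theorem income_runMin_le (hΓ : B.IsGittinsIndex q Γ) (hq : 0 < q) (hX : B.RewardsIntegrable q)
    (π' : B.Strategy) (hπ : π.FollowsIndex Γ) :
    π'.income q (fun j => runMin (Γ j)) ≤ᵐ[P] π.income q (fun j => runMin (Γ j)) := by
  have hdM (j : Fin J) := (hΓ.isIndex hq hX j).absSummable_runMin
  have hdiscount : ∀ᵐ ω ∂P, ∀ j, Tendsto (fun s => B.discount q j s ω) atTop (nhds 0) :=
    ae_all_iff.2 fun j => (B.discountedArm hq hX j).absSummable_d.ae_summable.mono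
      fun _ hω => hω.tendsto_atTop_zero
  filter_upwards [B.ae_W_nonneg, hdiscount, ae_all_iff.2 hπ, π'.ae_summable_income hq hX hdM,
    π.ae_summable_income hq hX hdM] with ω hW htendsto hω hs' hs
  exact (FollowsIndexAt.isGreedy_runMin hω).tsum_mul_slot_le hq (fun x => hW x.1 x.2)
    (π'.position_injective ω) (π.position_injective ω) (π'.tendsto_exp_time hq.le hW htendsto)
    (π.tendsto_exp_time hq.le hW htendsto) hs' hs

theorem isOptimal_of_followsIndex (hΓ : B.IsGittinsIndex q Γ) (hq : 0 < q)
    (hX : B.RewardsIntegrable q) (hπ : π.FollowsIndex Γ) : π.IsOptimal q := fun π' => by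
  have hincome (π : B.Strategy) : Integrable (π.income q fun j => runMin (Γ j)) P :=
    π.integrable_income hq hX fun j => (hΓ.isIndex hq hX j).absSummable_runMin
  have hreward (π : B.Strategy) : Integrable (π.totalReward q) P :=
    π.totalReward_eq_income hq.ne' ▸
      π.integrable_income hq hX (B.absSummable_discount_mul_X hq hX)
  refine condExp_le_of_forall_setIntegral_le (B.info_le 0) (hreward π') integrable_condExp
    stronglyMeasurable_condExp fun A hA => ?_
  calc ∫ ω in A, π'.totalReward q ω ∂P
      ≤ ∫ ω in A, π'.income q (fun j => runMin (Γ j)) ω ∂P :=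
        π'.setIntegral_totalReward_le hΓ hq hX hA
    _ ≤ ∫ ω in A, π.income q (fun j => runMin (Γ j)) ω ∂P :=
        setIntegral_mono_ae (hincome π').integrableOn (hincome π).integrableOn
          (π.income_runMin_le hΓ hq hX π' hπ)
    _ = ∫ ω in A, π.totalReward q ω ∂P := (π.setIntegral_totalReward_eq hΓ hq hX hπ hA).symm
    _ = ∫ ω in A, π.value q ω ∂P := (setIntegral_condExp (B.info_le 0) (hreward π) hA).symm

end Optimal

end Strategy

section Existence

variable [NeZero J] (Γ : Fin J → ℕ → Ω → ℝ) (n : Fin J → ℕ) (ω : Ω)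

/-- An arm of maximal index after `n j` operations of each arm `j`. Ties are broken by the number of
the arm, in order that the choice be measurable. -/
noncomputable def bestArm : Fin J :=
  sInf {j | ∀ i, Γ i (n i) ω ≤ Γ j (n j) ω}

theorem index_le_bestArm (i : Fin J) : Γ i (n i) ω ≤ Γ (bestArm Γ n ω) (n (bestArm Γ n ω)) ω :=
  csInf_mem (Finite.exists_max fun j => Γ j (n j) ω) i

theorem bestArm_eq_iff {j : Fin J} :
    bestArm Γ n ω = j ↔ (∀ i, Γ i (n i) ω ≤ Γ j (n j) ω) ∧
      ∀ k < j, ∃ i, Γ k (n k) ω < Γ i (n i) ω := by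
  constructor
  · rintro rfl
    refine ⟨index_le_bestArm Γ n ω, fun k hk => ?_⟩
    simpa using notMem_of_lt_csInf' hk
  · rintro ⟨hj, hlt⟩
    refine IsLeast.csInf_eq ⟨hj, fun k hk => not_lt.1 fun hkj => ?_⟩
    obtain ⟨i, hi⟩ := hlt k hkj
    exact hi.not_ge (hk i)

variable {Γ}

theorem measurableSet_bestArm (hΓ : ∀ j s, Measurable[B.F j s] (Γ j s)) (j : Fin J) :
    MeasurableSet[B.info n] {ω | bestArm Γ n ω = j} := by
  have hΓ_info (i : Fin J) : Measurable[B.info n] (Γ i (n i)) :=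
    (hΓ i (n i)).mono (B.F_le_info n i) le_rfl
  simp only [bestArm_eq_iff, Set.ofPred_and, Set.ofPred_forall, Set.ofPred_exists]
  exact (MeasurableSet.iInter fun i => measurableSet_le (hΓ_info i) (hΓ_info j)).inter
    (.iInter fun k => .iInter fun _ => .iUnion fun i => measurableSet_lt (hΓ_info k) (hΓ_info i))

variable (Γ)

/-- The numbers of operations of the arms when an arm of maximal index is always operated. -/
noncomputable def indexCount : ℕ → Ω → Fin J → ℕ
  | 0, _ => 0
  | t + 1, ω => indexCount t ω + Pi.single (bestArm Γ (indexCount t ω) ω) 1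

variable {Γ}

theorem measurableSet_indexCount (hΓ : ∀ j s, Measurable[B.F j s] (Γ j s)) (t : ℕ)
    (n : Fin J → ℕ) : MeasurableSet[B.info n] {ω | indexCount Γ t ω = n} := by
  induction t generalizing n with
  | zero => exact @MeasurableSet.const _ (B.info n) ((0 : Fin J → ℕ) = n)
  | succ t ih =>
    have hset : {ω | indexCount Γ (t + 1) ω = n} =
        ⋃ (p : (Fin J → ℕ) × Fin J) (_ : p.1 + Pi.single p.2 1 = n),
          {ω | indexCount Γ t ω = p.1} ∩ {ω | bestArm Γ p.1 ω = p.2} := by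
      ext ω
      simp only [Set.mem_ofPred_eq, Set.mem_iUnion, Set.mem_inter_iff, exists_prop]
      refine ⟨fun h => ⟨(indexCount Γ t ω, bestArm Γ (indexCount Γ t ω) ω), h, rfl, rfl⟩, ?_⟩
      rintro ⟨p, hp, hcount, harm⟩
      rw [indexCount, hcount, harm, hp]
    rw [hset]
    refine .iUnion fun p => .iUnion fun hp => ?_
    have hle : B.info p.1 ≤ B.info n := B.info_mono (le_self_add.trans_eq hp)
    exact (hle _ (ih p.1)).inter (hle _ (measurableSet_bestArm p.1 hΓ p.2))

theorem exists_followsIndex (hΓ : ∀ j s, Measurable[B.F j s] (Γ j s)) :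
    ∃ π : B.Strategy, π.FollowsIndex Γ := by
  let π : B.Strategy :=
    { count := indexCount Γ
      count_zero := fun _ => rfl
      sum_count := fun t ω => by
        induction t with
        | zero => simp [indexCount]
        | succ t ih => simp [indexCount, Finset.sum_add_distrib, ih]
      count_succ := fun t ω => ⟨bestArm Γ (indexCount Γ t ω) ω, rfl⟩
      measurableSet_count := measurableSet_indexCount hΓ }
  refine ⟨π, fun t => .of_forall fun ω j => ?_⟩
  have harm : π.arm t ω = bestArm Γ (π.count t ω) ω := π.arm_eq_iff.2 rfl
  rw [harm]
  exact index_le_bestArm Γ (π.count t ω) ω j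

end Existence

end RenewalBandit

theorem theorem2p1 {Ω : Type*} {mΩ : MeasurableSpace Ω} {P : Measure Ω} [IsProbabilityMeasure P]
    {J : ℕ} (hJ : 0 < J) (B : RenewalBandit P J) {q : ℝ} (hq : 0 < q)
    (hX : B.RewardsIntegrable q) :
    -- the value of every admissible strategy is well defined
    (∀ π : B.Strategy, (∀ᵐ ω ∂P, Summable fun t => π.periodReward q t ω) ∧
      Integrable (π.totalReward q) P) ∧
    -- the Gittins index process exists, as a real-valued process
    (∃ Γ : Fin J → ℕ → Ω → ℝ, B.IsGittinsIndex q Γ) ∧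
    ∀ Γ : Fin J → ℕ → Ω → ℝ, B.IsGittinsIndex q Γ →
      -- the two expressions for the index agree
      (∀ j s, IsEssSup P (B.ratio₀ q j s '' B.stoppingTimesAfter j s) (Γ j s)) ∧
      -- there is a Gittins index strategy, and every such strategy is optimal
      (∃ π : B.Strategy, π.FollowsIndex Γ) ∧
      ∀ π : B.Strategy, π.FollowsIndex Γ → π.IsOptimal q := by
  have : NeZero J := ⟨hJ.ne'⟩
  have hdX := B.absSummable_discount_mul_X hq hX
  refine ⟨fun π => ⟨?_, ?_⟩, RenewalBandit.exists_isGittinsIndex hq hX, fun Γ hΓ =>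
    ⟨hΓ.isEssSup_ratio₀ hq hX, ?_, fun π hπ => π.isOptimal_of_followsIndex hΓ hq hX hπ⟩⟩
  · simpa only [π.periodReward_eq hq.ne'] using π.ae_summable_income hq hX hdX
  · simpa only [π.totalReward_eq_income hq.ne'] using π.integrable_income hq hX hdX
  · exact RenewalBandit.exists_followsIndex fun j s => (hΓ.isIndex hq hX j s).1
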